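/- A \emph{tree-form decision problem} is a finite rooted tree whose internal nodes are decision points (the player chooses a child) or observation points (the environment chooses a child); every decision point has at least two children, and decision and observation points alternate. Its dimension $N$ is the number of terminal nodes (leaves) $\mathcal Z$; assume $N\ge 2$. A pure strategy assigns an action to every decision point and is identified with the vector $x\in\{0,1\}^{\mathcal Z}$ with $x[z]=1$ iff all player actions on the path from the root to $z$ are played; $\mathcal X$ is the set of these vectors, $\Delta(\mathcal X)$ is the set of mixed strategies, and $\mathcal U=\{u\in\mathbb R^{\mathcal Z}: |\langle u,x\rangle|\le 1\ \forall x\in\mathcal X\}$. The dual $\bar{\mathcal X}$ is obtained by exchanging decision and observation points. In the interleaving $\mathcal X\otimes\bar{\mathcal X}^{\otimes k}$ a state is a tuple $(s_0,\dots,s_k)$ of nodes, initially all roots. A state is terminal if all components are terminal. If some component is at an observation point, the state is an observation point and the environment moves every such component to a child. Otherwise the player selects a component and a child in it. A strategy chooses an action at every history (path of states) that ends in a decision point; the reduced strategy of a pure strategy is the vector $q$ over $\mathcal Z^{k+1}$ where $q[z,z_1,\dots,z_k]$ is the number of histories that end in the state $(z,z_1,\dots,z_k)$ and along which all the player's actions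 are those of the strategy; reduced mixed strategies are convex combinations of these. The set $\Phi^k_{\mathrm{med}}$ of $k$-mediator deviations consists of the maps $$\phi_q(x)[z]=\sum_{z_1,\dots,z_k}q[z,z_1,\dots,z_k]\prod_{i=1}^k x[z_i]\qquad(x\in\mathcal X)$$ for all (pure or mixed) reduced strategies $q$. \textbf{Statement.} There are an absolute constant $C$ and a deterministic online algorithm on a real RAM with unit-cost operations such that the following holds for every tree-form decision problem of dimension $N\ge2$, every integer $k\ge 0$ and every $0<\varepsilon\le 2$, all of which are given to the algorithm as input. Put $K=\max(k,1)$. In each round $t$ the algorithm outputs a mixed strategy $\pi^{(t)}\in\Delta(\mathcal X)$, written out as an explicit list of pure strategies with weights, and then observes a utility vector $u^{(t)}\in\mathcal U$, chosen by a strongly adaptive adversary. It performs at most $N^{CK}/\varepsilon$ steps in each round, and for every $T\ge N^{CK}/\varepsilon^2$ its average $\Phi^k_{\mathrm{med}}$-regret satisfies $$\frac1T\max_{\phi\in\Phi^k_{\mathrm{med}}}\sum_{t=1}^T\Big\langle u^{(t)},\ \mathop{\mathbb E}_{x\sim\pi^{(t)}}[\phi(x)-x]\Big\rangle\le\varepsilon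 .$$ -/

import Mathlib

/-! Tree-form decision problems -/

/-- The three types of nodes of a tree-form decision problem. -/
inductive NodeKind where
  | decision
  | observation
  | terminal
  deriving DecidableEq

/-- Exchanges decision points and observation points. -/
def NodeKind.swap : NodeKind → NodeKind
  | .decision => .observation
  | .observation => .decision
  | .terminal => .terminal

theorem NodeKind.swap_eq_terminal (t : NodeKind) :
    t.swap = NodeKind.terminal ↔ t = NodeKind.terminal := by
  cases t <;> simp [NodeKind.swap]

/-- A finite rooted tree whose nodes are decision points, observation points, or terminal nodes
(the leaves). The nodes are numbered `0, …, size` with root `0`, in such a way that a parent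
precedes its children; the value of `parent` at the root is irrelevant. -/
structure TreeProblem where
  size : ℕ
  kind : Fin (size + 1) → NodeKind
  parent : Fin (size + 1) → Fin (size + 1)
  parent_lt : ∀ s, s ≠ 0 → parent s < s
  terminal_iff : ∀ s, kind s = NodeKind.terminal ↔ ¬ ∃ c, c ≠ 0 ∧ parent c = s

namespace TreeProblem

/-- The nodes. -/
abbrev Node (X : TreeProblem) : Type := Fin (X.size + 1)

/-- The terminal nodes. -/
abbrev Terminal (X : TreeProblem) : Type := {s : X.Node // X.kind s = NodeKind.terminal}

/-- The dimension `N`: the number of terminal nodes. -/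
def dim (X : TreeProblem) : ℕ := Fintype.card X.Terminal

/-- `c` is a child of `s`. -/
def IsChild (X : TreeProblem) (s c : X.Node) : Prop := c ≠ 0 ∧ X.parent c = s

/-- The standing conventions on decision problems: every decision point has at least two children,
and decision points and observation points alternate. -/
structure IsStandard (X : TreeProblem) : Prop where
  branching : ∀ j, X.kind j = NodeKind.decision →
    ∃ c d, c ≠ d ∧ X.IsChild j c ∧ X.IsChild j d
  alternating : ∀ s c, X.IsChild s c →
    X.kind c = NodeKind.terminal ∨ X.kind c ≠ X.kind s

/-- The dual decision problem: decision points and observation points are exchanged. -/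
def dual (X : TreeProblem) : TreeProblem where
  size := X.size
  kind s := (X.kind s).swap
  parent := X.parent
  parent_lt := X.parent_lt
  terminal_iff s := (NodeKind.swap_eq_terminal _).trans (X.terminal_iff s)

/-- A terminal node, seen as a terminal node of the dual. -/
def toDual (X : TreeProblem) (z : X.Terminal) : X.dual.Terminal :=
  ⟨z.1, (NodeKind.swap_eq_terminal _).mpr z.2⟩

/-- An assignment of an action (a child) to each decision point. Its values at the other nodes are
irrelevant. -/
def IsAssignment (X : TreeProblem) (a : X.Node → X.Node) : Prop :=
  ∀ j, X.kind j = NodeKind.decision → X.IsChild j (a j)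

/-- `X.Played a s`: the assignment `a` plays all the actions on the path from the root to `s`. -/
inductive Played (X : TreeProblem) (a : X.Node → X.Node) : X.Node → Prop
  | root : Played X a 0
  | obs (s c : X.Node) : Played X a s → X.kind s = NodeKind.observation → X.IsChild s c →
      Played X a c
  | act (s : X.Node) : Played X a s → X.kind s = NodeKind.decision → Played X a (a s)

open Classical in
/-- The tree-form representation of a pure strategy. -/
noncomputable def treeForm (X : TreeProblem) (a : X.Node → X.Node) (z : X.Terminal) : ℝ :=
  if X.Played a z.1 then 1 else 0

/-- The set of pure strategies in tree-form representation. -/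
def pureStrategies (X : TreeProblem) : Set (X.Terminal → ℝ) :=
  {x | ∃ a, X.IsAssignment a ∧ x = X.treeForm a}

/-- The scalar product of a utility vector with a vector indexed by the terminal nodes. -/
def pairing (X : TreeProblem) (u x : X.Terminal → ℝ) : ℝ := ∑ z, u z * x z

/-- The utility vectors whose value on every pure strategy lies in `[-1, 1]`. -/
def utilities (X : TreeProblem) : Set (X.Terminal → ℝ) :=
  {u | ∀ x ∈ X.pureStrategies, |X.pairing u x| ≤ 1}

/-- A mixed strategy: a probability distribution on the (finite) set of pure strategies, given as
an explicit list of pure strategies with their weights. -/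
structure Mixed (X : TreeProblem) where
  count : ℕ
  weight : Fin count → ℝ
  strategy : Fin count → X.pureStrategies
  weight_nonneg : ∀ l, 0 ≤ weight l
  weight_sum : ∑ l, weight l = 1

/-- `⟨u, E_{x ∼ π} [φ(x) - x]⟩`. -/
def Mixed.gain {X : TreeProblem} (π : X.Mixed) (u : X.Terminal → ℝ)
    (φ : X.pureStrategies → X.Terminal → ℝ) : ℝ :=
  X.pairing u (∑ l, π.weight l • (φ (π.strategy l) - (π.strategy l : X.Terminal → ℝ)))

end TreeProblem

/-! Interleavings -/

namespace Interleaving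

variable {ι : Type} (P : ι → TreeProblem)

/-- The states of the interleaving `⨂ i, P i`. -/
abbrev State : Type := ∀ i, (P i).Node

/-- A state at which some component is at an observation point is an observation point. -/
def IsObs (s : State P) : Prop := ∃ i, (P i).kind (s i) = NodeKind.observation

/-- A state is a decision point if it is not an observation point and not every component is
terminal. -/
def IsDec (s : State P) : Prop :=
  ¬ IsObs P s ∧ ∃ i, (P i).kind (s i) ≠ NodeKind.terminal

/-- The moves of the environment: every component that is at an observation point (there is only
one such component except at the root) moves to a child, the others stay. -/
def ObsStep (s t : State P) : Prop :=
  ∀ i, ((P i).kind (s i) = NodeKind.observation → (P i).IsChild (s i) (t i)) ∧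
    ((P i).kind (s i) ≠ NodeKind.observation → t i = s i)

/-- The moves of the player: select one component and a child in it. -/
def DecStep (s t : State P) : Prop :=
  ∃ i, (P i).IsChild (s i) (t i) ∧ ∀ j, j ≠ i → t j = s j

/-- A pure strategy in the tree of histories. A history is the list of the states visited, the
current one first; at a history whose state is a decision point the strategy selects the next
state. The values of `σ` on other lists are irrelevant. -/
def IsStrategy (σ : List (State P) → State P) : Prop :=
  ∀ s h, IsDec P s → DecStep P s (σ (s :: h))

/-- `Reached P σ v`: the list `v` is a history of the interleaving, and `σ` plays all the actions
on the path from the root to `v` (that is, `σ[v] = 1` in tree form). -/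
inductive Reached (σ : List (State P) → State P) : List (State P) → Prop
  | root : Reached σ [fun _ => 0]
  | obs (s t : State P) (h : List (State P)) : Reached σ (s :: h) → IsObs P s → ObsStep P s t →
      Reached σ (t :: s :: h)
  | act (s : State P) (h : List (State P)) : Reached σ (s :: h) → IsDec P s →
      Reached σ (σ (s :: h) :: s :: h)

/-- The projection of a pure strategy to the terminal states: the sum of `σ[v]` over the histories
`v` whose state is `z`. -/
noncomputable def projection (σ : List (State P) → State P) (z : ∀ i, (P i).Terminal) : ℝ :=
  (Set.ncard {v | Reached P σ v ∧ v.head? = some (fun i => (z i).1)} : ℝ)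

/-- The reduced pure strategies of the interleaving. -/
def reducedStrategies : Set ((∀ i, (P i).Terminal) → ℝ) :=
  {q | ∃ σ, IsStrategy P σ ∧ q = projection P σ}

end Interleaving

/-! Deviations with `k` mediators -/

namespace TreeProblem

/-- The components of the interleaving `X ⊗ X̄ ⊗ ⋯ ⊗ X̄` with `k` copies of the dual. -/
def mediated (X : TreeProblem) (k : ℕ) : Option (Fin k) → TreeProblem
  | none => X
  | some _ => X.dual

/-- The terminal state `(z, z₁, …, z_k)`. -/
def mediatedTerminal (X : TreeProblem) (k : ℕ) (z : X.Terminal) (zs : Fin k → X.Terminal) :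
    ∀ o, (X.mediated k o).Terminal
  | none => z
  | some i => X.toDual (zs i)

/-- `φ_q(x)[z] = ∑ q[z, z₁, …, z_k] ∏ x[z_i]`, the sum being over `z₁, …, z_k`. -/
def deviation (X : TreeProblem) (k : ℕ) (q : (∀ o, (X.mediated k o).Terminal) → ℝ)
    (x : X.pureStrategies) (z : X.Terminal) : ℝ :=
  ∑ zs : Fin k → X.Terminal, q (X.mediatedTerminal k z zs) * ∏ i, x.1 (zs i)

/-- The set of `k`-mediator deviations: the functions `φ_q` induced by the (pure or mixed) reduced
strategies `q` of the interleaving of `X` with `k` copies of its dual. -/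
def mediatorDeviations (X : TreeProblem) (k : ℕ) : Set (X.pureStrategies → X.Terminal → ℝ) :=
  {φ | ∃ q ∈ convexHull ℝ (Interleaving.reducedStrategies (X.mediated k)), φ = X.deviation k q}

end TreeProblem

/-! A real random access machine, programmed in a structured language. It has natural-number and
real variables and arrays, which are named by numbers; every operation has unit cost. Natural
numbers admit only addition, truncated subtraction and comparison, real numbers the four
arithmetic operations and comparison; there is no rounding. -/

namespace RealRAM

structure Memory where
  natVar : ℕ → ℕ
  natArr : ℕ → ℕ → ℕ
  realVar : ℕ → ℝ
  realArr : ℕ → ℕ → ℝ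

/-- Natural-number expressions; `arr A i` is the entry `i` of the array named `A`. -/
inductive NatExp where
  | const (c : ℕ)
  | var (x : ℕ)
  | arr (A : ℕ) (i : NatExp)
  | add (a b : NatExp)
  | sub (a b : NatExp)

def NatExp.eval (m : Memory) : NatExp → ℕ
  | .const c => c
  | .var x => m.natVar x
  | .arr A i => m.natArr A (i.eval m)
  | .add a b => a.eval m + b.eval m
  | .sub a b => a.eval m - b.eval m

def NatExp.cost : NatExp → ℕ
  | .const _ => 1
  | .var _ => 1
  | .arr _ i => i.cost + 1
  | .add a b => a.cost + b.cost + 1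
  | .sub a b => a.cost + b.cost + 1

/-- Real expressions. A quotient with denominator `0` has the value `0`. -/
inductive RealExp where
  | const (c : ℚ)
  | var (x : ℕ)
  | arr (A : ℕ) (i : NatExp)
  | add (a b : RealExp)
  | sub (a b : RealExp)
  | mul (a b : RealExp)
  | div (a b : RealExp)

noncomputable def RealExp.eval (m : Memory) : RealExp → ℝ
  | .const c => (c : ℝ)
  | .var x => m.realVar x
  | .arr A i => m.realArr A (i.eval m)
  | .add a b => a.eval m + b.eval m
  | .sub a b => a.eval m - b.eval m
  | .mul a b => a.eval m * b.eval m
  | .div a b => a.eval m / b.eval m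

def RealExp.cost : RealExp → ℕ
  | .const _ => 1
  | .var _ => 1
  | .arr _ i => i.cost + 1
  | .add a b => a.cost + b.cost + 1
  | .sub a b => a.cost + b.cost + 1
  | .mul a b => a.cost + b.cost + 1
  | .div a b => a.cost + b.cost + 1

/-- Tests. -/
inductive Test where
  | natLt (a b : NatExp)
  | natEq (a b : NatExp)
  | realLt (a b : RealExp)
  | neg (p : Test)
  | conj (p q : Test)

def Test.holds (m : Memory) : Test → Prop
  | .natLt a b => a.eval m < b.eval m
  | .natEq a b => a.eval m = b.eval m
  | .realLt a b => a.eval m < b.eval m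
  | .neg p => ¬ p.holds m
  | .conj p q => p.holds m ∧ q.holds m

def Test.cost : Test → ℕ
  | .natLt a b => a.cost + b.cost + 1
  | .natEq a b => a.cost + b.cost + 1
  | .realLt a b => a.cost + b.cost + 1
  | .neg p => p.cost + 1
  | .conj p q => p.cost + q.cost + 1

/-- Programs. -/
inductive Program where
  | skip
  | setNat (x : ℕ) (e : NatExp)
  | setNatArr (A : ℕ) (i e : NatExp)
  | setReal (x : ℕ) (e : RealExp)
  | setRealArr (A : ℕ) (i : NatExp) (e : RealExp)
  | seq (p q : Program)
  | cond (b : Test) (p q : Program)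
  | loop (b : Test) (p : Program)

/-- Overwrite the entry `i` of the array named `A`. -/
def writeArr {α : Type} (arr : ℕ → ℕ → α) (A i : ℕ) (v : α) : ℕ → ℕ → α :=
  Function.update arr A (Function.update (arr A) i v)

/-- `Exec p m m' c`: the program `p`, started in the memory `m`, stops after exactly `c` steps
with the memory `m'`. The language is deterministic. -/
inductive Exec : Program → Memory → Memory → ℕ → Prop
  | skip (m : Memory) : Exec .skip m m 1
  | setNat (m : Memory) (x : ℕ) (e : NatExp) :
      Exec (.setNat x e) m { m with natVar := Function.update m.natVar x (e.eval m) } (e.cost + 1)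
  | setNatArr (m : Memory) (A : ℕ) (i e : NatExp) :
      Exec (.setNatArr A i e) m { m with natArr := writeArr m.natArr A (i.eval m) (e.eval m) }
        (i.cost + e.cost + 1)
  | setReal (m : Memory) (x : ℕ) (e : RealExp) :
      Exec (.setReal x e) m { m with realVar := Function.update m.realVar x (e.eval m) }
        (e.cost + 1)
  | setRealArr (m : Memory) (A : ℕ) (i : NatExp) (e : RealExp) :
      Exec (.setRealArr A i e) m { m with realArr := writeArr m.realArr A (i.eval m) (e.eval m) }
        (i.cost + e.cost + 1)
  | seq {p q : Program} {m₁ m₂ m₃ : Memory} {c d : ℕ} :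
      Exec p m₁ m₂ c → Exec q m₂ m₃ d → Exec (.seq p q) m₁ m₃ (c + d)
  | condTrue {b : Test} {p q : Program} {m m' : Memory} {c : ℕ} :
      b.holds m → Exec p m m' c → Exec (.cond b p q) m m' (b.cost + c)
  | condFalse {b : Test} {p q : Program} {m m' : Memory} {c : ℕ} :
      ¬ b.holds m → Exec q m m' c → Exec (.cond b p q) m m' (b.cost + c)
  | loopFalse {b : Test} {p : Program} {m : Memory} :
      ¬ b.holds m → Exec (.loop b p) m m b.cost
  | loopTrue {b : Test} {p : Program} {m₁ m₂ m₃ : Memory} {c d : ℕ} :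
      b.holds m₁ → Exec p m₁ m₂ c → Exec (.loop b p) m₂ m₃ d →
      Exec (.loop b p) m₁ m₃ (b.cost + c + d)

end RealRAM

/-! Online learners on the machine -/

namespace TreeProblem

open RealRAM

/-- The numerical code of a node type. -/
def kindCode : NodeKind → ℕ
  | .decision => 0
  | .observation => 1
  | .terminal => 2

/-- The memory before the first round. Natural variable `0` holds the number of nodes and natural
variable `1` the number of mediators, real variable `0` holds `ε`; natural array `0` holds the
parents of the nodes and natural array `1` their types; all the rest is `0`. -/
noncomputable def startMemory (X : TreeProblem) (k : ℕ) (ε : ℝ) : Memory where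
  natVar x := if x = 0 then X.size + 1 else if x = 1 then k else 0
  natArr A i :=
    if h : i < X.size + 1 then
      if A = 0 then (X.parent ⟨i, h⟩ : ℕ) else if A = 1 then kindCode (X.kind ⟨i, h⟩) else 0
    else 0
  realVar x := if x = 0 then ε else 0
  realArr _ _ := 0

/-- The memory after the utility vector has been revealed: real array `0` holds `u[z]` at every
terminal node `z` (and `0` elsewhere); the rest of the memory is unchanged. -/
noncomputable def revealUtility (X : TreeProblem) (u : X.Terminal → ℝ) (m : Memory) : Memory :=
  { m with
    realArr := Function.update m.realArr 0 fun i =>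
      if h : ∃ hi : i < X.size + 1, X.kind ⟨i, hi⟩ = NodeKind.terminal then u ⟨⟨i, h.1⟩, h.2⟩
      else 0 }

/-- The memory displays the mixed strategy `π`, written out in full: natural variable `2` holds the
number of listed pure strategies, entry `l` of real array `1` holds the weight of the `l`-th one,
and natural array `2` holds, row by row, the entries of their tree-form representations (a row has
one place for each node, of which only the places of the terminal nodes matter). -/
def Displays (X : TreeProblem) (m : Memory) (π : X.Mixed) : Prop :=
  m.natVar 2 = π.count ∧
  (∀ l : Fin π.count, m.realArr 1 l = π.weight l) ∧
  ∀ (l : Fin π.count) (z : X.Terminal),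
    (m.natArr 2 ((l : ℕ) * (X.size + 1) + (z.1 : ℕ)) : ℝ) = (π.strategy l).1 z

/-- The learner consisting of the two programs `next` and `observe`, started on `(X, k, ε)` and
facing the utility vectors `u 0, u 1, …`, plays the mixed strategies `π 0, π 1, …`, and the number
of its steps in each round is at most `B`. In each round, `next` computes the mixed strategy of
the round and displays it, the utility vector of the round is revealed, and `observe` updates the
memory. The learner is deterministic, and it sees a utility vector only after having played, so to
face every sequence `u` is to face every strongly adaptive adversary. -/
def Plays (X : TreeProblem) (k : ℕ) (ε : ℝ) (next observe : Program)
    (u : ℕ → X.Terminal → ℝ) (π : ℕ → X.Mixed) (B : ℝ) : Prop :=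
  ∃ m m' : ℕ → Memory, m 0 = X.startMemory k ε ∧
    ∀ t, X.Displays (m' t) (π t) ∧
      ∃ c d : ℕ, Exec next (m t) (m' t) c ∧
        Exec observe (X.revealUtility (u t) (m' t)) (m (t + 1)) d ∧ (c + d : ℝ) ≤ B

/-- The time-average regret after `T` rounds with respect to the set of deviations `Φ` is at most
`ε`. -/
def RegretAtMost (X : TreeProblem) (Φ : Set (X.pureStrategies → X.Terminal → ℝ))
    (u : ℕ → X.Terminal → ℝ) (π : ℕ → X.Mixed) (T : ℕ) (ε : ℝ) : Prop :=
  ∀ φ ∈ Φ, (1 / (T : ℝ)) * ∑ t ∈ Finset.range T, (π t).gain (u t) φ ≤ ε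

end TreeProblem

/-! The proof reduces Φ-regret to external regret by fixed points. In each round the learner holds a
reduced mixed strategy q of the interleaving and plays a π with E_π[φ_q(x) - x] nearly zero. Then
the regret against φ_{q*} is, up to that defect, the external regret of q against q* for the reward
q ↦ ⟨u, E_π φ_q(x)⟩. This reward is linear in q, with coefficients u[z] · E_π ∏ x[z_i].

External regret. Everything takes place on the acyclic graph of positions, the (k+1)-tuples of
nodes. There are M = n^(k+1) of them, where n is the number of nodes. Simultaneous observations are
resolved one component at a time. The learner's q chooses moves by the current position only,
although competitors may use the whole history. For the masses G(s), the probability under π that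
all mediator components of s are consistent with x, a backward recursion gives values V(s). Each
decision position runs regret matching with cumulative regrets truncated at 0, fed with the local
gains V(t) - V(s). The normalisation of utilities bounds these gains by 2 (`IsValue.abs_sub_le`).
Hence every cumulative local gain is at most √(4MT) (`sum_sub_le_of_regretPolicy`). For a competitor
σ, the difference between its value and that of the policies telescopes over the histories reached
by σ (`sum_histories`, `sum_projection_le`). There are at most M of these, since the product of the
subtree sizes of the components is a potential that each move lowers by at least 1 in total
(`card_histories_le`). The regret is therefore at most M√(4MT), which is at most Tε/2 as soon as T ≥
16M³/ε².

Fixed points. In general φ_q depends on the whole distribution of x and not only on its mean, so the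
iteration passes through mixtures. A unit flow y_l on the tree is split into at most n weighted pure
strategies by repeatedly peeling off a greedy one (`IsFlow.card_support`, `splitFlow_spec`). The
expectation of φ_q over this mixture is again a unit flow y_{l+1}, because the masses are conserved
along the moves (`isFlow_imageFlow`, `imageFlow_terminal`). With π the average of the first L
mixtures, E_π[φ_q(x) - x] = (y_L - y_0)/L. Against a utility this is at most 2/L ≤ ε/2 for L = ⌈4/ε⌉
(`IsIterate.value_root_le`).

Running time. The algorithm is written in a small language of bounded sums and counting loops with a
verified compiler to the machine. The number of steps of a fixed statement is polynomial in a bound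
W for the loop lengths (`Stmt.polyBounded_cost`). Here W = M² suffices, and n ≤ 4N gives M ≤ N^(6K)
(`pow_positions_le`). A round costs at most L + 1 times a polynomial in W. -/

/-! A structured language with bounded sums and counting loops, and its compilation to programs
of the machine -/

namespace RealRAM

/-- The types of expressions. -/
inductive Ty where
  | nat
  | real
  | bool

abbrev Ty.Val : Ty → Type
  | .nat => ℕ
  | .real => ℝ
  | .bool => Prop

/-- Expressions with bounded sums; `nsum b x e` is the sum of `e` over all values of the variable
`x` that are less than the value of the variable `b`. -/
inductive Exp : Ty → Type where
  | nconst (c : ℕ) : Exp .nat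
  | nvar (x : ℕ) : Exp .nat
  | narr (A : ℕ) (i : Exp .nat) : Exp .nat
  | nadd (a b : Exp .nat) : Exp .nat
  | nsub (a b : Exp .nat) : Exp .nat
  | nsum (b x : ℕ) (e : Exp .nat) : Exp .nat
  | nite (p : Exp .bool) (a b : Exp .nat) : Exp .nat
  | rconst (c : ℚ) : Exp .real
  | rvar (x : ℕ) : Exp .real
  | rarr (A : ℕ) (i : Exp .nat) : Exp .real
  | radd (a b : Exp .real) : Exp .real
  | rsub (a b : Exp .real) : Exp .real
  | rmul (a b : Exp .real) : Exp .real
  | rdiv (a b : Exp .real) : Exp .real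
  | rsum (b x : ℕ) (e : Exp .real) : Exp .real
  | rite (p : Exp .bool) (a b : Exp .real) : Exp .real
  | lt (a b : Exp .nat) : Exp .bool
  | eq (a b : Exp .nat) : Exp .bool
  | rlt (a b : Exp .real) : Exp .bool
  | not (p : Exp .bool) : Exp .bool
  | and (p q : Exp .bool) : Exp .bool

/-! ### Memory updates, and agreement of memories up to scratch variables -/

namespace Memory

def setN (m : Memory) (x v : ℕ) : Memory := { m with natVar := Function.update m.natVar x v }

def setR (m : Memory) (x : ℕ) (v : ℝ) : Memory :=
  { m with realVar := Function.update m.realVar x v }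

def setNA (m : Memory) (A i v : ℕ) : Memory := { m with natArr := writeArr m.natArr A i v }

def setRA (m : Memory) (A i : ℕ) (v : ℝ) : Memory :=
  { m with realArr := writeArr m.realArr A i v }

variable (m : Memory) (x y v A B i j : ℕ) (w : ℝ)

@[simp] theorem setN_natVar : (m.setN x v).natVar y = if y = x then v else m.natVar y := by
  simp [setN, Function.update_apply]
@[simp] theorem setN_natArr : (m.setN x v).natArr = m.natArr := rfl
@[simp] theorem setN_realVar : (m.setN x v).realVar = m.realVar := rfl
@[simp] theorem setN_realArr : (m.setN x v).realArr = m.realArr := rfl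
@[simp] theorem setR_natVar : (m.setR x w).natVar = m.natVar := rfl
@[simp] theorem setR_natArr : (m.setR x w).natArr = m.natArr := rfl
@[simp] theorem setR_realVar : (m.setR x w).realVar y = if y = x then w else m.realVar y := by
  simp [setR, Function.update_apply]
@[simp] theorem setR_realArr : (m.setR x w).realArr = m.realArr := rfl
@[simp] theorem setNA_natVar : (m.setNA A i v).natVar = m.natVar := rfl
@[simp] theorem setNA_natArr :
    (m.setNA A i v).natArr B j = if B = A ∧ j = i then v else m.natArr B j := by
  simp only [setNA, writeArr, Function.update_apply]
  split_ifs with h1 h2 h3 <;> simp_all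
@[simp] theorem setNA_realVar : (m.setNA A i v).realVar = m.realVar := rfl
@[simp] theorem setNA_realArr : (m.setNA A i v).realArr = m.realArr := rfl
@[simp] theorem setRA_natVar : (m.setRA A i w).natVar = m.natVar := rfl
@[simp] theorem setRA_natArr : (m.setRA A i w).natArr = m.natArr := rfl
@[simp] theorem setRA_realVar : (m.setRA A i w).realVar = m.realVar := rfl
@[simp] theorem setRA_realArr :
    (m.setRA A i w).realArr B j = if B = A ∧ j = i then w else m.realArr B j := by
  simp only [setRA, writeArr, Function.update_apply]
  split_ifs with h1 h2 h3 <;> simp_all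

/-- The memories agree except in the scratch variables from `200 + d` on. -/
structure Agree (d : ℕ) (m m' : Memory) : Prop where
  natVar : ∀ x, x < 200 + d → m'.natVar x = m.natVar x
  natArr : ∀ A i, m'.natArr A i = m.natArr A i
  realVar : ∀ x, x < 200 + d → m'.realVar x = m.realVar x
  realArr : ∀ A i, m'.realArr A i = m.realArr A i

variable {m}

theorem Agree.refl (d : ℕ) (m : Memory) : Agree d m m :=
  ⟨fun _ _ => rfl, fun _ _ => rfl, fun _ _ => rfl, fun _ _ => rfl⟩

theorem Agree.trans {d : ℕ} {m₁ m₂ m₃ : Memory} (h : Agree d m₁ m₂) (h' : Agree d m₂ m₃) :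
    Agree d m₁ m₃ :=
  ⟨fun x hx => (h'.natVar x hx).trans (h.natVar x hx),
    fun A i => (h'.natArr A i).trans (h.natArr A i),
    fun x hx => (h'.realVar x hx).trans (h.realVar x hx),
    fun A i => (h'.realArr A i).trans (h.realArr A i)⟩

theorem Agree.mono {d e : ℕ} {m₁ m₂ : Memory} (h : Agree d m₁ m₂) (hd : e ≤ d) :
    Agree e m₁ m₂ :=
  ⟨fun x hx => h.natVar x (by omega), h.natArr, fun x hx => h.realVar x (by omega), h.realArr⟩

theorem Agree.setN_scratch {d x v : ℕ} {m₁ m₂ : Memory} (h : Agree d m₁ m₂) (hx : 200 + d ≤ x) :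
    Agree d m₁ (m₂.setN x v) :=
  ⟨fun y hy => by rw [setN_natVar, if_neg (by omega), h.natVar y hy], h.natArr, h.realVar,
    h.realArr⟩

theorem Agree.setR_scratch {d x : ℕ} {v : ℝ} {m₁ m₂ : Memory} (h : Agree d m₁ m₂)
    (hx : 200 + d ≤ x) : Agree d m₁ (m₂.setR x v) :=
  ⟨h.natVar, h.natArr, fun y hy => by rw [setR_realVar, if_neg (by omega), h.realVar y hy],
    h.realArr⟩

theorem Agree.setN {d : ℕ} {m₁ m₂ : Memory} (h : Agree d m₁ m₂) (x v : ℕ) :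
    Agree d (m₁.setN x v) (m₂.setN x v) :=
  ⟨fun y hy => by rw [setN_natVar, setN_natVar, h.natVar y hy], h.natArr, h.realVar, h.realArr⟩

theorem Agree.setR {d : ℕ} {m₁ m₂ : Memory} (h : Agree d m₁ m₂) (x : ℕ) (v : ℝ) :
    Agree d (m₁.setR x v) (m₂.setR x v) :=
  ⟨h.natVar, h.natArr, fun y hy => by rw [setR_realVar, setR_realVar, h.realVar y hy], h.realArr⟩

theorem Agree.setNA {d : ℕ} {m₁ m₂ : Memory} (h : Agree d m₁ m₂) (A i v : ℕ) :
    Agree d (m₁.setNA A i v) (m₂.setNA A i v) :=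
  ⟨h.natVar, fun B j => by rw [setNA_natArr, setNA_natArr, h.natArr], h.realVar, h.realArr⟩

theorem Agree.setRA {d : ℕ} {m₁ m₂ : Memory} (h : Agree d m₁ m₂) (A i : ℕ) (v : ℝ) :
    Agree d (m₁.setRA A i v) (m₂.setRA A i v) :=
  ⟨h.natVar, h.natArr, h.realVar, fun B j => by rw [setRA_realArr, setRA_realArr, h.realArr]⟩

end Memory

open Memory

/-! ### Expressions: semantics, code and cost -/

/-- The variables that serve as bounds of sums and loops. -/
def isBound (x : ℕ) : Bool := x == 0 || x == 3 || x == 4 || x == 5 || x == 6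

namespace Exp

open Classical in
-- Sums bind their variable: the summand is evaluated in a modified memory, and the memory itself
-- never changes.
noncomputable def eval : {τ : Ty} → Exp τ → Memory → τ.Val
  | _, nconst c, _ => c
  | _, nvar x, m => m.natVar x
  | _, narr A i, m => m.natArr A (i.eval m)
  | _, nadd a b, m => (show ℕ from a.eval m) + (show ℕ from b.eval m)
  | _, nsub a b, m => (show ℕ from a.eval m) - (show ℕ from b.eval m)
  | _, nsum b x e, m => ∑ j ∈ Finset.range (m.natVar b), (show ℕ from e.eval (m.setN x j))
  | _, nite p a b, m => if p.eval m then a.eval m else b.eval m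
  | _, rconst c, _ => (c : ℝ)
  | _, rvar x, m => m.realVar x
  | _, rarr A i, m => m.realArr A (i.eval m)
  | _, radd a b, m => (show ℝ from a.eval m) + (show ℝ from b.eval m)
  | _, rsub a b, m => (show ℝ from a.eval m) - (show ℝ from b.eval m)
  | _, rmul a b, m => (show ℝ from a.eval m) * (show ℝ from b.eval m)
  | _, rdiv a b, m => (show ℝ from a.eval m) / (show ℝ from b.eval m)
  | _, rsum b x e, m => ∑ j ∈ Finset.range (m.natVar b), (show ℝ from e.eval (m.setN x j))
  | _, rite p a b, m => if p.eval m then a.eval m else b.eval m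
  | _, lt a b, m => (show ℕ from a.eval m) < (show ℕ from b.eval m)
  | _, eq a b, m => (show ℕ from a.eval m) = (show ℕ from b.eval m)
  | _, rlt a b, m => (show ℝ from a.eval m) < (show ℝ from b.eval m)
  | _, not p, m => ¬ p.eval m
  | _, and p q, m => p.eval m ∧ q.eval m

/-- All variables are ordinary ones, the bounds of sums are bound variables and are not
summation variables. -/
def ok : {τ : Ty} → Exp τ → Bool
  | _, nconst _ => true
  | _, nvar x => decide (x < 200)
  | _, narr _ i => i.ok
  | _, nadd a b => a.ok && b.ok
  | _, nsub a b => a.ok && b.ok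
  | _, nsum b x e => isBound b && !isBound x && decide (x < 200) && e.ok
  | _, nite p a b => p.ok && a.ok && b.ok
  | _, rconst _ => true
  | _, rvar x => decide (x < 200)
  | _, rarr _ i => i.ok
  | _, radd a b => a.ok && b.ok
  | _, rsub a b => a.ok && b.ok
  | _, rmul a b => a.ok && b.ok
  | _, rdiv a b => a.ok && b.ok
  | _, rsum b x e => isBound b && !isBound x && decide (x < 200) && e.ok
  | _, rite p a b => p.ok && a.ok && b.ok
  | _, lt a b => a.ok && b.ok
  | _, eq a b => a.ok && b.ok
  | _, rlt a b => a.ok && b.ok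
  | _, not p => p.ok
  | _, and p q => p.ok && q.ok

/-- The program that writes the value of an expression into the scratch variable `200 + d`. -/
def code : {τ : Ty} → Exp τ → ℕ → Program
  | _, nconst c, d => .setNat (200 + d) (.const c)
  | _, nvar x, d => .setNat (200 + d) (.var x)
  | _, narr A i, d => .seq (i.code d) (.setNat (200 + d) (.arr A (.var (200 + d))))
  | _, nadd a b, d => .seq (a.code d) (.seq (b.code (d + 1))
      (.setNat (200 + d) (.add (.var (200 + d)) (.var (200 + (d + 1))))))
  | _, nsub a b, d => .seq (a.code d) (.seq (b.code (d + 1))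
      (.setNat (200 + d) (.sub (.var (200 + d)) (.var (200 + (d + 1))))))
  -- Slot d accumulates the sum, slot d + 1 saves the old value of x, which is restored at the end,
  -- and slot d + 2 freezes the bound.
  | _, nsum b x e, d =>
    .seq (.setNat (200 + d) (.const 0)) (.seq (.setNat (200 + (d + 1)) (.var x))
      (.seq (.setNat (200 + (d + 2)) (.var b)) (.seq (.setNat x (.const 0))
        (.seq (.loop (.natLt (.var x) (.var (200 + (d + 2)))) (.seq (e.code (d + 3))
          (.seq (.setNat (200 + d) (.add (.var (200 + d)) (.var (200 + (d + 3)))))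
            (.setNat x (.add (.var x) (.const 1)))))) (.setNat x (.var (200 + (d + 1))))))))
  | _, nite p a b, d => .seq (p.code d)
      (.cond (.natEq (.var (200 + d)) (.const 1)) (a.code d) (b.code d))
  | _, rconst c, d => .setReal (200 + d) (.const c)
  | _, rvar x, d => .setReal (200 + d) (.var x)
  | _, rarr A i, d => .seq (i.code d) (.setReal (200 + d) (.arr A (.var (200 + d))))
  | _, radd a b, d => .seq (a.code d) (.seq (b.code (d + 1))
      (.setReal (200 + d) (.add (.var (200 + d)) (.var (200 + (d + 1))))))
  | _, rsub a b, d => .seq (a.code d) (.seq (b.code (d + 1))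
      (.setReal (200 + d) (.sub (.var (200 + d)) (.var (200 + (d + 1))))))
  | _, rmul a b, d => .seq (a.code d) (.seq (b.code (d + 1))
      (.setReal (200 + d) (.mul (.var (200 + d)) (.var (200 + (d + 1))))))
  | _, rdiv a b, d => .seq (a.code d) (.seq (b.code (d + 1))
      (.setReal (200 + d) (.div (.var (200 + d)) (.var (200 + (d + 1))))))
  | _, rsum b x e, d =>
    .seq (.setReal (200 + d) (.const 0)) (.seq (.setNat (200 + (d + 1)) (.var x))
      (.seq (.setNat (200 + (d + 2)) (.var b)) (.seq (.setNat x (.const 0))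
        (.seq (.loop (.natLt (.var x) (.var (200 + (d + 2)))) (.seq (e.code (d + 3))
          (.seq (.setReal (200 + d) (.add (.var (200 + d)) (.var (200 + (d + 3)))))
            (.setNat x (.add (.var x) (.const 1)))))) (.setNat x (.var (200 + (d + 1))))))))
  | _, rite p a b, d => .seq (p.code d)
      (.cond (.natEq (.var (200 + d)) (.const 1)) (a.code d) (b.code d))
  | _, lt a b, d => .seq (a.code d) (.seq (b.code (d + 1))
      (.cond (.natLt (.var (200 + d)) (.var (200 + (d + 1)))) (.setNat (200 + d) (.const 1))
        (.setNat (200 + d) (.const 0))))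
  | _, eq a b, d => .seq (a.code d) (.seq (b.code (d + 1))
      (.cond (.natEq (.var (200 + d)) (.var (200 + (d + 1)))) (.setNat (200 + d) (.const 1))
        (.setNat (200 + d) (.const 0))))
  | _, rlt a b, d => .seq (a.code d) (.seq (b.code (d + 1))
      (.cond (.realLt (.var (200 + d)) (.var (200 + (d + 1)))) (.setNat (200 + d) (.const 1))
        (.setNat (200 + d) (.const 0))))
  | _, not p, d => .seq (p.code d) (.setNat (200 + d) (.sub (.const 1) (.var (200 + d))))
  | _, and p q, d => .seq (p.code d) (.seq (q.code (d + 1))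
      (.cond (.natEq (.add (.var (200 + d)) (.var (200 + (d + 1)))) (.const 2))
        (.setNat (200 + d) (.const 1)) (.setNat (200 + d) (.const 0))))

/-- A bound on the number of steps of `code` if the bound variables are at most `W`. -/
def cost : {τ : Ty} → Exp τ → ℕ → ℕ
  | _, nconst _, _ => 2
  | _, nvar _, _ => 2
  | _, narr _ i, W => i.cost W + 3
  | _, nadd a b, W => a.cost W + b.cost W + 4
  | _, nsub a b, W => a.cost W + b.cost W + 4
  | _, nsum _ _ e, W => W * (e.cost W + 11) + 13
  | _, nite p a b, W => p.cost W + a.cost W + b.cost W + 3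
  | _, rconst _, _ => 2
  | _, rvar _, _ => 2
  | _, rarr _ i, W => i.cost W + 3
  | _, radd a b, W => a.cost W + b.cost W + 4
  | _, rsub a b, W => a.cost W + b.cost W + 4
  | _, rmul a b, W => a.cost W + b.cost W + 4
  | _, rdiv a b, W => a.cost W + b.cost W + 4
  | _, rsum _ _ e, W => W * (e.cost W + 11) + 13
  | _, rite p a b, W => p.cost W + a.cost W + b.cost W + 3
  | _, lt a b, W => a.cost W + b.cost W + 5
  | _, eq a b, W => a.cost W + b.cost W + 5
  | _, rlt a b, W => a.cost W + b.cost W + 5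
  | _, not p, W => p.cost W + 4
  | _, and p q, W => p.cost W + q.cost W + 7

open Classical in
/-- The scratch variable `200 + d` holds the value `v`. -/
def Holds (m : Memory) (d : ℕ) : (τ : Ty) → τ.Val → Prop
  | .nat, v => m.natVar (200 + d) = v
  | .real, v => m.realVar (200 + d) = v
  | .bool, v => m.natVar (200 + d) = if v then 1 else 0

/-- Admissible expressions read no scratch variable. An operand therefore keeps its value after the
code of another operand has run. -/
theorem eval_congr {τ : Ty} (e : Exp τ) (he : e.ok = true) {m m' : Memory}
    (h : Agree 0 m m') : e.eval m' = e.eval m := by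
  induction e generalizing m m' with
  | nconst c => rfl
  | rconst c => rfl
  | nvar x => exact h.natVar x (by simpa [ok] using he)
  | rvar x => exact h.realVar x (by simpa [ok] using he)
  | narr A i ih => simp only [eval, ih he h, h.natArr]
  | rarr A i ih => simp only [eval, ih he h, h.realArr]
  | nadd a b iha ihb | nsub a b iha ihb | radd a b iha ihb | rsub a b iha ihb | rmul a b iha ihb
  | rdiv a b iha ihb | lt a b iha ihb | eq a b iha ihb | rlt a b iha ihb | and a b iha ihb =>
    simp only [ok, Bool.and_eq_true] at he
    simp only [eval, iha he.1 h, ihb he.2 h]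
  | not p ih => simp only [eval, ih he h]
  | nite p a b ihp iha ihb | rite p a b ihp iha ihb =>
    simp only [ok, Bool.and_eq_true] at he
    have hp := ihp he.1.1 h
    simp only [eval, iha he.1.2 h, ihb he.2 h]
    congr 1
  | nsum b x e ih | rsum b x e ih =>
    simp only [ok, Bool.and_eq_true] at he
    have hb : b < 200 := by
      have := he.1.1.1
      simp only [isBound, Bool.or_eq_true, beq_iff_eq] at this
      omega
    simp only [eval, h.natVar b (by omega)]
    exact Finset.sum_congr rfl fun j _ => ih he.2 (h.setN x j)

end Exp

/-- A counting loop, with an invariant indexed by the number of completed iterations. -/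
theorem exec_loop {t : Test} {p : Program} (I : ℕ → Memory → Prop) (N K : ℕ)
    (hstep : ∀ j, j < N → ∀ m, I j m → t.holds m ∧ ∃ m' c, Exec p m m' c ∧ c ≤ K ∧ I (j + 1) m')
    (hend : ∀ m, I N m → ¬ t.holds m) {m : Memory} (h0 : I 0 m) :
    ∃ m' c, Exec (.loop t p) m m' c ∧ I N m' ∧ c ≤ N * (t.cost + K) + t.cost := by
  have key : ∀ r j, j + r = N → ∀ m, I j m →
      ∃ m' c, Exec (.loop t p) m m' c ∧ I N m' ∧ c ≤ r * (t.cost + K) + t.cost := by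
    intro r
    induction r with
    | zero =>
      intro j hj m hm
      obtain rfl : j = N := by omega
      exact ⟨m, _, .loopFalse (hend m hm), hm, by simp⟩
    | succ r ih =>
      intro j hj m hm
      obtain ⟨ht, m₁, c, hc, hcK, h1⟩ := hstep j (by omega) m hm
      obtain ⟨m₂, d, hd, h2, hdK⟩ := ih (j + 1) (by omega) m₁ h1
      exact ⟨m₂, _, .loopTrue ht hc hd, h2, by rw [Nat.succ_mul]; omega⟩
  exact key N 0 (by omega) m h0

theorem exec_setN (m : Memory) (x : ℕ) (e : NatExp) :
    Exec (.setNat x e) m (m.setN x (e.eval m)) (e.cost + 1) := .setNat m x e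

theorem exec_setR (m : Memory) (x : ℕ) (e : RealExp) :
    Exec (.setReal x e) m (m.setR x (e.eval m)) (e.cost + 1) := .setReal m x e

namespace Exp

theorem isBound_lt {b : ℕ} (h : isBound b = true) : b < 200 := by
  simp only [isBound, Bool.or_eq_true, beq_iff_eq] at h
  omega

open Classical in
theorem exec_flag {t : Test} {m : Memory} {d : ℕ} {v : Prop} (h : t.holds m ↔ v) :
    Exec (.cond t (.setNat (200 + d) (.const 1)) (.setNat (200 + d) (.const 0))) m
      (m.setN (200 + d) (if v then 1 else 0)) (t.cost + 2) := by
  split_ifs with hv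
  · exact .condTrue (h.mpr hv) (exec_setN _ _ _)
  · exact .condFalse (mt h.mp hv) (exec_setN _ _ _)

open Classical in
theorem holds_flag (m : Memory) (d : ℕ) (v : Prop) :
    Holds (m.setN (200 + d) (if v then 1 else 0)) d .bool v := by
  simp [Holds]

/-- Scratch variables are used as a stack: code at depth d writes only to slots from d on, apart
from summation variables, which it restores. The value in slot d thus survives the evaluation of the
next operand at depth d + 1. -/
theorem code_spec {τ : Ty} (e : Exp τ) (he : e.ok = true) (W d : ℕ) (m : Memory)
    (hW : ∀ b, isBound b = true → m.natVar b ≤ W) :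
    ∃ m' c, Exec (e.code d) m m' c ∧ Agree d m m' ∧ Holds m' d τ (e.eval m) ∧ c ≤ e.cost W := by
  have mono : ∀ {d : ℕ} {m m' : Memory}, Agree d m m' →
      (∀ b, isBound b = true → m.natVar b ≤ W) → ∀ b, isBound b = true → m'.natVar b ≤ W := by
    intro d m m' h hW b hb
    rw [h.natVar b (by have := isBound_lt hb; omega)]
    exact hW b hb
  induction e generalizing d m with
  | nconst c | nvar x =>
    exact ⟨_, _, exec_setN _ _ _, (Agree.refl d m).setN_scratch le_rfl, by
      simp [Holds, eval, NatExp.eval], by simp [cost, NatExp.cost]⟩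
  | rconst c | rvar x =>
    exact ⟨_, _, exec_setR _ _ _, (Agree.refl d m).setR_scratch le_rfl, by
      simp [Holds, eval, RealExp.eval], by simp [cost, RealExp.cost]⟩
  | narr A i ih =>
    obtain ⟨m₁, c₁, h1, a1, v1, k1⟩ := ih he d m hW
    refine ⟨_, _, .seq h1 (exec_setN _ _ _), a1.setN_scratch le_rfl, ?_, ?_⟩
    · simp only [Holds] at v1
      simp [Holds, eval, NatExp.eval, v1, a1.natArr]
    · simp only [cost, NatExp.cost]; omega
  | rarr A i ih =>
    obtain ⟨m₁, c₁, h1, a1, v1, k1⟩ := ih he d m hW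
    refine ⟨_, _, .seq h1 (exec_setR _ _ _), a1.setR_scratch le_rfl, ?_, ?_⟩
    · simp only [Holds] at v1
      simp [Holds, eval, NatExp.eval, RealExp.eval, v1, a1.realArr]
    · simp only [cost, RealExp.cost, NatExp.cost]; omega
  | nadd a b iha ihb | nsub a b iha ihb =>
    simp only [ok, Bool.and_eq_true] at he
    obtain ⟨m₁, c₁, h1, a1, v1, k1⟩ := iha he.1 d m hW
    obtain ⟨m₂, c₂, h2, a2, v2, k2⟩ := ihb he.2 (d + 1) m₁ (mono a1 hW)
    refine ⟨_, _, .seq h1 (.seq h2 (exec_setN _ _ _)),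
      (a1.trans (a2.mono (by omega))).setN_scratch le_rfl, ?_, ?_⟩
    · simp only [Holds] at v1 v2
      rw [eval_congr _ he.2 (a1.mono (by omega))] at v2
      simp [Holds, eval, NatExp.eval, v2, a2.natVar (200 + d) (by omega), v1]
    · simp only [cost, NatExp.cost]; omega
  | radd a b iha ihb | rsub a b iha ihb | rmul a b iha ihb | rdiv a b iha ihb =>
    simp only [ok, Bool.and_eq_true] at he
    obtain ⟨m₁, c₁, h1, a1, v1, k1⟩ := iha he.1 d m hW
    obtain ⟨m₂, c₂, h2, a2, v2, k2⟩ := ihb he.2 (d + 1) m₁ (mono a1 hW)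
    refine ⟨_, _, .seq h1 (.seq h2 (exec_setR _ _ _)),
      (a1.trans (a2.mono (by omega))).setR_scratch le_rfl, ?_, ?_⟩
    · simp only [Holds] at v1 v2
      rw [eval_congr _ he.2 (a1.mono (by omega))] at v2
      simp [Holds, eval, RealExp.eval, v2, a2.realVar (200 + d) (by omega), v1]
    · simp only [cost, RealExp.cost]; omega
  | not p ih =>
    obtain ⟨m₁, c₁, h1, a1, v1, k1⟩ := ih he d m hW
    refine ⟨_, _, .seq h1 (exec_setN _ _ _), a1.setN_scratch le_rfl, ?_, ?_⟩
    · simp only [Holds] at v1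
      by_cases hp : p.eval m <;> simp [Holds, eval, NatExp.eval, v1, hp]
    · simp only [cost, NatExp.cost]; omega
  | lt a b iha ihb | eq a b iha ihb | rlt a b iha ihb =>
    simp only [ok, Bool.and_eq_true] at he
    obtain ⟨m₁, c₁, h1, a1, v1, k1⟩ := iha he.1 d m hW
    obtain ⟨m₂, c₂, h2, a2, v2, k2⟩ := ihb he.2 (d + 1) m₁ (mono a1 hW)
    simp only [Holds] at v1 v2
    rw [eval_congr _ he.2 (a1.mono (by omega))] at v2
    have w1 : m₂.natVar (200 + d) = m₁.natVar (200 + d) := a2.natVar (200 + d) (by omega)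
    have w1' : m₂.realVar (200 + d) = m₁.realVar (200 + d) := a2.realVar (200 + d) (by omega)
    refine ⟨_, _, .seq h1 (.seq h2 (exec_flag ?_)),
      (a1.trans (a2.mono (by omega))).setN_scratch le_rfl, holds_flag _ _ _, ?_⟩
    · simp only [Test.holds, NatExp.eval, RealExp.eval, eval, v1, v2, w1, w1']
    · simp only [cost, Test.cost, NatExp.cost, RealExp.cost]; omega
  | and a b iha ihb =>
    simp only [ok, Bool.and_eq_true] at he
    obtain ⟨m₁, c₁, h1, a1, v1, k1⟩ := iha he.1 d m hW
    obtain ⟨m₂, c₂, h2, a2, v2, k2⟩ := ihb he.2 (d + 1) m₁ (mono a1 hW)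
    simp only [Holds] at v1 v2
    rw [eval_congr _ he.2 (a1.mono (by omega))] at v2
    have w1 : m₂.natVar (200 + d) = m₁.natVar (200 + d) := a2.natVar (200 + d) (by omega)
    have w1' : m₂.realVar (200 + d) = m₁.realVar (200 + d) := a2.realVar (200 + d) (by omega)
    refine ⟨_, _, .seq h1 (.seq h2 (exec_flag ?_)),
      (a1.trans (a2.mono (by omega))).setN_scratch le_rfl, holds_flag _ _ _, ?_⟩
    · by_cases ha : a.eval m <;> by_cases hb : b.eval m <;>
        simp [Test.holds, NatExp.eval, eval, v1, v2, w1, ha, hb]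
    · simp only [cost, Test.cost, NatExp.cost]; omega
  | nite p a b ihp iha ihb | rite p a b ihp iha ihb =>
    simp only [ok, Bool.and_eq_true] at he
    obtain ⟨m₁, c₁, h1, a1, v1, k1⟩ := ihp he.1.1 d m hW
    simp only [Holds] at v1
    by_cases hp : p.eval m
    · obtain ⟨m₂, c₂, h2, a2, v2, k2⟩ := iha he.1.2 d m₁ (mono a1 hW)
      rw [eval_congr _ he.1.2 (a1.mono (by omega))] at v2
      refine ⟨m₂, _, .seq h1 (.condTrue ?_ h2), a1.trans a2, ?_, ?_⟩
      · simp [Test.holds, NatExp.eval, v1, hp]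
      · simpa only [eval, if_pos hp] using v2
      · simp only [cost, Test.cost, NatExp.cost]; omega
    · obtain ⟨m₂, c₂, h2, a2, v2, k2⟩ := ihb he.2 d m₁ (mono a1 hW)
      rw [eval_congr _ he.2 (a1.mono (by omega))] at v2
      refine ⟨m₂, _, .seq h1 (.condFalse ?_ h2), a1.trans a2, ?_, ?_⟩
      · simp [Test.holds, NatExp.eval, v1, hp]
      · simpa only [eval, if_neg hp] using v2
      · simp only [cost, Test.cost, NatExp.cost]; omega
  | nsum b x e ih =>
    simp only [ok, Bool.and_eq_true, decide_eq_true_eq] at he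
    obtain ⟨⟨⟨hb, hx⟩, hx'⟩, he⟩ := he
    have hb' := isBound_lt hb
    obtain ⟨m', c, hc, hI, hK⟩ := exec_loop (t := .natLt (.var x) (.var (200 + (d + 2))))
      (p := .seq (e.code (d + 3))
          (.seq (.setNat (200 + d) (.add (.var (200 + d)) (.var (200 + (d + 3)))))
            (.setNat x (.add (.var x) (.const 1)))))
      -- The reference memory already has x = j, so the summand computed by the body is the j-th
      -- term of the semantic sum.
      (fun j μ => Agree d (m.setN x j) μ ∧
        μ.natVar (200 + d) = ∑ i ∈ Finset.range j, (show ℕ from e.eval (m.setN x i)) ∧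
        μ.natVar (200 + (d + 1)) = m.natVar x ∧ μ.natVar (200 + (d + 2)) = m.natVar b)
      (m.natVar b) (e.cost W + 8) (by
        rintro j hj μ ⟨hA, hs, h1, h2⟩
        have hxj : μ.natVar x = j := by rw [hA.natVar x (by omega)]; simp
        refine ⟨by simp [Test.holds, NatExp.eval, hxj, h2, hj], ?_⟩
        obtain ⟨μ', c, hc, a', v', k'⟩ := ih he (d + 3) μ (mono hA (by
          intro y hy
          rw [Memory.setN_natVar, if_neg (by rintro rfl; simp [hy] at hx)]
          exact hW y hy))
        simp only [Holds] at v'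
        rw [eval_congr _ he (hA.mono (by omega))] at v'
        refine ⟨_, _, .seq hc (.seq (exec_setN _ _ _) (exec_setN _ _ _)), ?_,
          ⟨?_, ?_, ?_, ?_⟩, ?_, ?_, ?_⟩
        · simp only [NatExp.cost]; omega
        · intro y hy
          by_cases hyx : y = x
          · subst hyx
            simp [NatExp.eval, show y ≠ 200 + d by omega, a'.natVar y (by omega), hxj]
          · have := hA.natVar y hy
            simp only [Memory.setN_natVar, if_neg hyx, if_neg (show y ≠ 200 + d by omega)] at this ⊢
            rw [a'.natVar y (by omega), this]
        · intro A i
          simp [a'.natArr, hA.natArr]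
        · intro y hy
          simp [a'.realVar y (by omega), hA.realVar y hy]
        · intro A i
          simp [a'.realArr, hA.realArr]
        · simp [NatExp.eval, show 200 + d ≠ x by omega, a'.natVar (200 + d) (by omega), hs, v',
            Finset.sum_range_succ]
        · simp [show 200 + (d + 1) ≠ x by omega, a'.natVar (200 + (d + 1)) (by omega), h1]
        · simp [show 200 + (d + 2) ≠ x by omega, a'.natVar (200 + (d + 2)) (by omega), h2])
      (by
        rintro μ ⟨hA, hs, h1, h2⟩
        have hxj : μ.natVar x = m.natVar b := by rw [hA.natVar x (by omega)]; simp
        simp [Test.holds, NatExp.eval, hxj, h2])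
      (m := (((m.setN (200 + d) 0).setN (200 + (d + 1)) (m.natVar x)).setN (200 + (d + 2))
        (m.natVar b)).setN x 0) (by
        refine ⟨⟨fun y hy => ?_, fun _ _ => rfl, fun _ _ => rfl, fun _ _ => rfl⟩, ?_, ?_, ?_⟩
        · simp [show y ≠ 200 + d by omega, show y ≠ 200 + (d + 1) by omega,
            show y ≠ 200 + (d + 2) by omega]
        · simp [show 200 + d ≠ x by omega]
        · simp [show 200 + (d + 1) ≠ x by omega]
        · simp [show 200 + (d + 2) ≠ x by omega])
    obtain ⟨hA, hs, h1, h2⟩ := hI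
    refine ⟨m'.setN x (m.natVar x), _, .seq (exec_setN _ _ _) (.seq (exec_setN _ _ _)
      (.seq (exec_setN _ _ _) (.seq (exec_setN _ _ _)
      (.seq (c := c) (d := 2) (m₂ := m') ?_ ?_)))), ⟨?_, ?_, ?_, ?_⟩, ?_, ?_⟩
    · simpa [NatExp.eval, show x ≠ 200 + d by omega, show b ≠ 200 + d by omega,
        show b ≠ 200 + (d + 1) by omega] using hc
    · have := exec_setN m' x (.var (200 + (d + 1)))
      rwa [NatExp.eval, h1] at this
    · intro y hy
      by_cases hyx : y = x
      · simp [hyx]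
      · simpa [hyx] using hA.natVar y hy
    · exact hA.natArr
    · exact hA.realVar
    · exact hA.realArr
    · simpa [Holds, eval, show 200 + d ≠ x by omega] using hs
    · have := Nat.mul_le_mul_right (e.cost W + 11) (hW b hb)
      simp only [Test.cost, NatExp.cost] at hK
      rw [show 1 + 1 + 1 + (e.cost W + 8) = e.cost W + 11 by ring] at hK
      simp only [cost, NatExp.cost]; omega
  | rsum b x e ih =>
    simp only [ok, Bool.and_eq_true, decide_eq_true_eq] at he
    obtain ⟨⟨⟨hb, hx⟩, hx'⟩, he⟩ := he
    have hb' := isBound_lt hb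
    obtain ⟨m', c, hc, hI, hK⟩ := exec_loop (t := .natLt (.var x) (.var (200 + (d + 2))))
      (p := .seq (e.code (d + 3))
          (.seq (.setReal (200 + d) (.add (.var (200 + d)) (.var (200 + (d + 3)))))
            (.setNat x (.add (.var x) (.const 1)))))
      (fun j μ => Agree d (m.setN x j) μ ∧
        μ.realVar (200 + d) = ∑ i ∈ Finset.range j, (show ℝ from e.eval (m.setN x i)) ∧
        μ.natVar (200 + (d + 1)) = m.natVar x ∧ μ.natVar (200 + (d + 2)) = m.natVar b)
      (m.natVar b) (e.cost W + 8) (by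
        rintro j hj μ ⟨hA, hs, h1, h2⟩
        have hxj : μ.natVar x = j := by rw [hA.natVar x (by omega)]; simp
        refine ⟨by simp [Test.holds, NatExp.eval, hxj, h2, hj], ?_⟩
        obtain ⟨μ', c, hc, a', v', k'⟩ := ih he (d + 3) μ (mono hA (by
          intro y hy
          rw [Memory.setN_natVar, if_neg (by rintro rfl; simp [hy] at hx)]
          exact hW y hy))
        simp only [Holds] at v'
        rw [eval_congr _ he (hA.mono (by omega))] at v'
        refine ⟨_, _, .seq hc (.seq (exec_setR _ _ _) (exec_setN _ _ _)), ?_,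
          ⟨?_, ?_, ?_, ?_⟩, ?_, ?_, ?_⟩
        · simp only [NatExp.cost, RealExp.cost]; omega
        · intro y hy
          by_cases hyx : y = x
          · subst hyx
            simp [NatExp.eval, a'.natVar y (by omega), hxj]
          · have := hA.natVar y hy
            simp only [Memory.setN_natVar, Memory.setR_natVar, if_neg hyx] at this ⊢
            rw [a'.natVar y (by omega), this]
        · intro A i
          simp [a'.natArr, hA.natArr]
        · intro y hy
          simp [show y ≠ 200 + d by omega, a'.realVar y (by omega), hA.realVar y hy]
        · intro A i
          simp [a'.realArr, hA.realArr]
        · simp [RealExp.eval, a'.realVar (200 + d) (by omega), hs, v',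
            Finset.sum_range_succ]
        · simp [show 200 + (d + 1) ≠ x by omega, a'.natVar (200 + (d + 1)) (by omega), h1]
        · simp [show 200 + (d + 2) ≠ x by omega, a'.natVar (200 + (d + 2)) (by omega), h2])
      (by
        rintro μ ⟨hA, hs, h1, h2⟩
        have hxj : μ.natVar x = m.natVar b := by rw [hA.natVar x (by omega)]; simp
        simp [Test.holds, NatExp.eval, hxj, h2])
      (m := (((m.setR (200 + d) 0).setN (200 + (d + 1)) (m.natVar x)).setN (200 + (d + 2))
        (m.natVar b)).setN x 0) (by
        refine ⟨⟨fun y hy => ?_, fun _ _ => rfl, fun y hy => ?_, fun _ _ => rfl⟩, ?_, ?_, ?_⟩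
        · simp [show y ≠ 200 + (d + 1) by omega,
            show y ≠ 200 + (d + 2) by omega]
        · simp [show y ≠ 200 + d by omega]
        · simp
        · simp [show 200 + (d + 1) ≠ x by omega]
        · simp [show 200 + (d + 2) ≠ x by omega])
    obtain ⟨hA, hs, h1, h2⟩ := hI
    refine ⟨m'.setN x (m.natVar x), _, .seq (exec_setR _ _ _) (.seq (exec_setN _ _ _)
      (.seq (exec_setN _ _ _) (.seq (exec_setN _ _ _)
      (.seq (c := c) (d := 2) (m₂ := m') ?_ ?_)))), ⟨?_, ?_, ?_, ?_⟩, ?_, ?_⟩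
    · simpa [NatExp.eval, RealExp.eval,
        show b ≠ 200 + (d + 1) by omega] using hc
    · have := exec_setN m' x (.var (200 + (d + 1)))
      rwa [NatExp.eval, h1] at this
    · intro y hy
      by_cases hyx : y = x
      · simp [hyx]
      · simpa [hyx] using hA.natVar y hy
    · exact hA.natArr
    · exact hA.realVar
    · exact hA.realArr
    · simpa [Holds, eval] using hs
    · have := Nat.mul_le_mul_right (e.cost W + 11) (hW b hb)
      simp only [Test.cost, NatExp.cost] at hK
      rw [show 1 + 1 + 1 + (e.cost W + 8) = e.cost W + 11 by ring] at hK
      simp only [cost, NatExp.cost, RealExp.cost]; omega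

/-- Syntactic occurrence of natural variables. -/
def readsN : {τ : Ty} → Exp τ → ℕ → Bool
  | _, nconst _, _ => false
  | _, nvar x, y => x == y
  | _, narr _ i, y => i.readsN y
  | _, nadd a b, y => a.readsN y || b.readsN y
  | _, nsub a b, y => a.readsN y || b.readsN y
  | _, nsum b x e, y => b == y || x != y && e.readsN y
  | _, nite p a b, y => p.readsN y || a.readsN y || b.readsN y
  | _, rconst _, _ => false
  | _, rvar _, _ => false
  | _, rarr _ i, y => i.readsN y
  | _, radd a b, y => a.readsN y || b.readsN y
  | _, rsub a b, y => a.readsN y || b.readsN y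
  | _, rmul a b, y => a.readsN y || b.readsN y
  | _, rdiv a b, y => a.readsN y || b.readsN y
  | _, rsum b x e, y => b == y || x != y && e.readsN y
  | _, rite p a b, y => p.readsN y || a.readsN y || b.readsN y
  | _, lt a b, y => a.readsN y || b.readsN y
  | _, eq a b, y => a.readsN y || b.readsN y
  | _, rlt a b, y => a.readsN y || b.readsN y
  | _, not p, y => p.readsN y
  | _, and p q, y => p.readsN y || q.readsN y

/-- Assigning a variable without free occurrences is invisible; a summation variable is not free in
its own summand. This makes the auxiliary variables of `mulE` and `divE` harmless, even when
products are nested. -/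
theorem eval_setN {τ : Ty} (e : Exp τ) (x v : ℕ) (he : e.readsN x = false) (m : Memory) :
    e.eval (m.setN x v) = e.eval m := by
  induction e generalizing m with
  | nconst c | rconst c | rvar x => rfl
  | nvar y =>
    simp only [readsN, beq_eq_false_iff_ne] at he
    simp [eval, he]
  | narr A i ih | rarr A i ih => simp [eval, ih he]
  | nadd a b iha ihb | nsub a b iha ihb | radd a b iha ihb | rsub a b iha ihb | rmul a b iha ihb
  | rdiv a b iha ihb | lt a b iha ihb | eq a b iha ihb | rlt a b iha ihb | and a b iha ihb =>
    simp only [readsN, Bool.or_eq_false_iff] at he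
    simp only [eval, iha he.1, ihb he.2]
  | not p ih => simp only [eval, ih he]
  | nite p a b ihp iha ihb | rite p a b ihp iha ihb =>
    simp only [readsN, Bool.or_eq_false_iff] at he
    have hp := ihp he.1.1
    simp only [eval, iha he.1.2, ihb he.2]
    congr 1
    rw [hp]
  | nsum b y e ih | rsum b y e ih =>
    simp only [readsN, Bool.or_eq_false_iff, beq_eq_false_iff_ne, Bool.and_eq_false_iff,
      bne_eq_false_iff_eq] at he
    simp only [eval, setN_natVar, if_neg he.1]
    refine Finset.sum_congr rfl fun j _ => ?_
    rcases he.2 with h | h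
    · subst h
      congr 1
      simp [Memory.setN]
    · by_cases hxy : y = x
      · subst hxy
        congr 1
        simp [Memory.setN]
      · rw [← ih h (m.setN y j)]
        congr 1
        simp [Memory.setN, Function.update_comm (Ne.symm hxy)]

end Exp

/-! ### Statements: semantics, frame rules, code and cost -/

/-- Statements: assignments and loops in which the variable `x` runs through the natural numbers
less than the value of the variable `b`. -/
inductive Stmt where
  | setN (x : ℕ) (e : Exp .nat)
  | setR (x : ℕ) (e : Exp .real)
  | setNA (A : ℕ) (i e : Exp .nat)
  | setRA (A : ℕ) (i : Exp .nat) (e : Exp .real)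
  | seq (s t : Stmt)
  | count (x b : ℕ) (s : Stmt)

namespace Stmt

/-- A loop reads its bound once, at the start, and leaves the value of the bound in its counter. -/
noncomputable def den : Stmt → Memory → Memory
  | setN x e, m => m.setN x (e.eval m)
  | setR x e, m => m.setR x (e.eval m)
  | setNA A i e, m => m.setNA A (i.eval m) (e.eval m)
  | setRA A i e, m => m.setRA A (i.eval m) (e.eval m)
  | seq s t, m => t.den (s.den m)
  | count x b s, m =>
    Nat.rec (m.setN x 0) (fun j μ => (s.den μ).setN x (j + 1)) (m.natVar b)

def setsN : Stmt → ℕ → Bool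
  | setN x _, y => x == y
  | setR _ _, _ => false
  | setNA _ _ _, _ => false
  | setRA _ _ _, _ => false
  | seq s t, y => s.setsN y || t.setsN y
  | count x _ s, y => x == y || s.setsN y

/-- Bound variables are never assigned and a loop body does not touch its own counter. The compiled
loop, which tests the bound anew each time, then runs exactly as often as `den` prescribes. -/
def ok : Stmt → Bool
  | setN x e => !isBound x && decide (x < 200) && e.ok
  | setR x e => decide (x < 200) && e.ok
  | setNA _ i e => i.ok && e.ok
  | setRA _ i e => i.ok && e.ok
  | seq s t => s.ok && t.ok
  | count x b s => isBound b && !isBound x && decide (x < 200) && s.ok && !s.setsN x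
def setsR : Stmt → ℕ → Bool
  | setN _ _, _ => false
  | setR x _, y => x == y
  | setNA _ _ _, _ => false
  | setRA _ _ _, _ => false
  | seq s t, y => s.setsR y || t.setsR y
  | count _ _ s, y => s.setsR y

def setsNA : Stmt → ℕ → Bool
  | setN _ _, _ => false
  | setR _ _, _ => false
  | setNA A _ _, B => A == B
  | setRA _ _ _, _ => false
  | seq s t, y => s.setsNA y || t.setsNA y
  | count _ _ s, y => s.setsNA y

def setsRA : Stmt → ℕ → Bool
  | setN _ _, _ => false
  | setR _ _, _ => false
  | setNA _ _ _, _ => false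
  | setRA A _ _, B => A == B
  | seq s t, y => s.setsRA y || t.setsRA y
  | count _ _ s, y => s.setsRA y

def code : Stmt → Program
  | setN x e => .seq (e.code 0) (.setNat x (.var 200))
  | setR x e => .seq (e.code 0) (.setReal x (.var 200))
  | setNA A i e => .seq (i.code 0) (.seq (e.code 1) (.setNatArr A (.var 200) (.var 201)))
  | setRA A i e => .seq (i.code 0) (.seq (e.code 1) (.setRealArr A (.var 200) (.var 201)))
  | seq s t => .seq s.code t.code
  | count x b s => .seq (.setNat x (.const 0))
      (.loop (.natLt (.var x) (.var b)) (.seq s.code (.setNat x (.add (.var x) (.const 1)))))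

def cost : Stmt → ℕ → ℕ
  | setN _ e, W => e.cost W + 2
  | setR _ e, W => e.cost W + 2
  | setNA _ i e, W => i.cost W + e.cost W + 3
  | setRA _ i e, W => i.cost W + e.cost W + 3
  | seq s t, W => s.cost W + t.cost W
  | count _ _ s, W => W * (s.cost W + 7) + 5

/-- The invariant rule for loops. -/
theorem den_count (I : ℕ → Memory → Prop) (x b : ℕ) (s : Stmt) (m : Memory)
    (h0 : I 0 (m.setN x 0))
    (hs : ∀ j, j < m.natVar b → ∀ μ, μ.natVar x = j → I j μ →
      I (j + 1) ((s.den μ).setN x (j + 1))) :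
    I (m.natVar b) ((count x b s).den m) := by
  simp only [den]
  have key : ∀ j, j ≤ m.natVar b → I j (Nat.rec (motive := fun _ => Memory) (m.setN x 0)
      (fun j μ => (s.den μ).setN x (j + 1)) j) ∧
      (Nat.rec (motive := fun _ => Memory) (m.setN x 0)
      (fun j μ => (s.den μ).setN x (j + 1)) j : Memory).natVar x = j := by
    intro j
    induction j with
    | zero => intro _; exact ⟨h0, by simp⟩
    | succ j ih =>
      intro hj
      obtain ⟨h1, h2⟩ := ih (by omega)
      exact ⟨hs j (by omega) _ h2 h1, by simp⟩
  exact (key _ le_rfl).1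

/-- A frame rule whose hypothesis is a computation on syntax; for concrete programs it is discharged
by `rfl`. The next three are its analogues for the other kinds of storage. -/
theorem den_natVar (s : Stmt) (m : Memory) (y : ℕ) (h : s.setsN y = false) :
    (s.den m).natVar y = m.natVar y := by
  induction s generalizing m with
  | setN x e =>
    simp only [setsN, beq_eq_false_iff_ne] at h
    simp [den, Ne.symm h]
  | setR | setNA | setRA => rfl
  | seq s t ihs iht =>
    simp only [setsN, Bool.or_eq_false_iff] at h
    rw [den, iht _ h.2, ihs _ h.1]
  | count x b s ih =>
    simp only [setsN, Bool.or_eq_false_iff, beq_eq_false_iff_ne] at h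
    refine den_count (fun _ μ => μ.natVar y = m.natVar y) x b s m (by simp [Ne.symm h.1]) ?_
    intro j _ μ _ hI
    rw [setN_natVar, if_neg (Ne.symm h.1), ih _ h.2, hI]

theorem den_realVar (s : Stmt) (m : Memory) (y : ℕ) (h : s.setsR y = false) :
    (s.den m).realVar y = m.realVar y := by
  induction s generalizing m with
  | setR x e =>
    simp only [setsR, beq_eq_false_iff_ne] at h
    simp [den, Ne.symm h]
  | setN | setNA | setRA => rfl
  | seq s t ihs iht =>
    simp only [setsR, Bool.or_eq_false_iff] at h
    rw [den, iht _ h.2, ihs _ h.1]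
  | count x b s ih =>
    refine den_count (fun _ μ => μ.realVar y = m.realVar y) x b s m (by simp) ?_
    intro j _ μ _ hI
    rw [setN_realVar, ih _ h, hI]

theorem den_natArr (s : Stmt) (m : Memory) (B : ℕ) (h : s.setsNA B = false) :
    (s.den m).natArr B = m.natArr B := by
  induction s generalizing m with
  | setNA A i e =>
    simp only [setsNA, beq_eq_false_iff_ne] at h
    funext j
    simp [den, Ne.symm h]
  | setN | setR | setRA => rfl
  | seq s t ihs iht =>
    simp only [setsNA, Bool.or_eq_false_iff] at h
    rw [den, iht _ h.2, ihs _ h.1]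
  | count x b s ih =>
    refine den_count (fun _ μ => μ.natArr B = m.natArr B) x b s m (by simp) ?_
    intro j _ μ _ hI
    rw [setN_natArr, ih _ h, hI]

theorem den_realArr (s : Stmt) (m : Memory) (B : ℕ) (h : s.setsRA B = false) :
    (s.den m).realArr B = m.realArr B := by
  induction s generalizing m with
  | setRA A i e =>
    simp only [setsRA, beq_eq_false_iff_ne] at h
    funext j
    simp [den, Ne.symm h]
  | setN | setR | setNA => rfl
  | seq s t ihs iht =>
    simp only [setsRA, Bool.or_eq_false_iff] at h
    rw [den, iht _ h.2, ihs _ h.1]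
  | count x b s ih =>
    refine den_count (fun _ μ => μ.realArr B = m.realArr B) x b s m (by simp) ?_
    intro j _ μ _ hI
    rw [setN_realArr, ih _ h, hI]

theorem setsN_bound {s : Stmt} (h : s.ok = true) {b : ℕ} (hb : isBound b = true) :
    s.setsN b = false := by
  induction s with
  | setN x e =>
    simp only [ok, Bool.and_eq_true] at h
    simp only [setsN, beq_eq_false_iff_ne]
    rintro rfl
    simp [hb] at h
  | setR | setNA | setRA => rfl
  | seq s t ihs iht =>
    simp only [ok, Bool.and_eq_true] at h
    simp [setsN, ihs h.1, iht h.2]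
  | count x c s ih =>
    simp only [ok, Bool.and_eq_true] at h
    simp only [setsN, ih h.1.2, Bool.or_false, beq_eq_false_iff_ne]
    rintro rfl
    simp [hb] at h

/-- A simulation up to scratch variables: the actual memory μ only has to agree with the ideal
memory m, and this relation is maintained. The bound W stays valid because statements do not assign
bound variables. -/
theorem code_spec (s : Stmt) (hs : s.ok = true) (W : ℕ) (m μ : Memory) (h : Agree 0 m μ)
    (hW : ∀ b, isBound b = true → m.natVar b ≤ W) :
    ∃ μ' c, Exec s.code μ μ' c ∧ Agree 0 (s.den m) μ' ∧ c ≤ s.cost W := by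
  have hWμ : ∀ {m μ : Memory}, Agree 0 m μ → (∀ b, isBound b = true → m.natVar b ≤ W) →
      ∀ b, isBound b = true → μ.natVar b ≤ W := fun h hW b hb => by
    rw [h.natVar b (Exp.isBound_lt hb)]; exact hW b hb
  induction s generalizing m μ with
  | setN x e =>
    simp only [ok, Bool.and_eq_true] at hs
    obtain ⟨μ', c, hc, a', v', k'⟩ := e.code_spec hs.2 W 0 μ (hWμ h hW)
    refine ⟨_, _, .seq hc (exec_setN _ _ _), ?_, ?_⟩
    · simp only [Exp.Holds, add_zero] at v'
      rw [den, NatExp.eval, v', Exp.eval_congr e hs.2 h]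
      exact (h.trans a').setN _ _
    · simp only [cost, NatExp.cost]; omega
  | setR x e =>
    simp only [ok, Bool.and_eq_true] at hs
    obtain ⟨μ', c, hc, a', v', k'⟩ := e.code_spec hs.2 W 0 μ (hWμ h hW)
    refine ⟨_, _, .seq hc (exec_setR _ _ _), ?_, ?_⟩
    · simp only [Exp.Holds, add_zero] at v'
      rw [den, RealExp.eval, v', Exp.eval_congr e hs.2 h]
      exact (h.trans a').setR _ _
    · simp only [cost, RealExp.cost]; omega
  | setNA A i e =>
    simp only [ok, Bool.and_eq_true] at hs
    obtain ⟨μ₁, c₁, h1, a1, v1, k1⟩ := i.code_spec hs.1 W 0 μ (hWμ h hW)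
    obtain ⟨μ₂, c₂, h2, a2, v2, k2⟩ := e.code_spec hs.2 W 1 μ₁ (hWμ (h.trans a1) hW)
    refine ⟨μ₂.setNA A (i.eval m) (e.eval m), _, .seq h1 (.seq (d := 3) h2 ?_),
      (h.trans (a1.trans (a2.mono (by omega)))).setNA _ _ _, ?_⟩
    · simp only [Exp.Holds] at v1 v2
      have := Exec.setNatArr μ₂ A (.var 200) (.var 201)
      simp only [NatExp.eval] at this
      rwa [a2.natVar 200 (by omega), v1, v2, Exp.eval_congr i hs.1 h,
        Exp.eval_congr e hs.2 (h.trans a1)] at this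
    · simp only [cost]; omega
  | setRA A i e =>
    simp only [ok, Bool.and_eq_true] at hs
    obtain ⟨μ₁, c₁, h1, a1, v1, k1⟩ := i.code_spec hs.1 W 0 μ (hWμ h hW)
    obtain ⟨μ₂, c₂, h2, a2, v2, k2⟩ := e.code_spec hs.2 W 1 μ₁ (hWμ (h.trans a1) hW)
    refine ⟨μ₂.setRA A (i.eval m) (e.eval m), _, .seq h1 (.seq (d := 3) h2 ?_),
      (h.trans (a1.trans (a2.mono (by omega)))).setRA _ _ _, ?_⟩
    · simp only [Exp.Holds] at v1 v2
      have := Exec.setRealArr μ₂ A (.var 200) (.var 201)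
      simp only [NatExp.eval, RealExp.eval] at this
      rwa [a2.natVar 200 (by omega), v1, v2, Exp.eval_congr i hs.1 h,
        Exp.eval_congr e hs.2 (h.trans a1)] at this
    · simp only [cost]; omega
  | seq s t ihs iht =>
    simp only [ok, Bool.and_eq_true] at hs
    obtain ⟨μ₁, c₁, h1, a1, k1⟩ := ihs hs.1 m μ h hW
    obtain ⟨μ₂, c₂, h2, a2, k2⟩ := iht hs.2 _ μ₁ a1 (fun b hb => by
      rw [den_natVar _ _ _ (setsN_bound hs.1 hb)]; exact hW b hb)
    exact ⟨μ₂, _, .seq h1 h2, a2, by simp only [cost]; omega⟩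
  | count x b s ih =>
    simp only [ok, Bool.and_eq_true, decide_eq_true_eq] at hs
    obtain ⟨⟨⟨⟨hb, hx⟩, hx'⟩, hs⟩, hxs⟩ := hs
    have hb' := Exp.isBound_lt hb
    have hbx : b ≠ x := by rintro rfl; simp [hb] at hx
    -- `g j` is the ideal memory after j iterations.
    set g : ℕ → Memory := fun j => Nat.rec (motive := fun _ => Memory) (m.setN x 0)
      (fun j μ => (s.den μ).setN x (j + 1)) j with hg
    have hgx : ∀ j, (g j).natVar x = j := by
      intro j
      cases j <;> simp [hg]
    have hgb : ∀ j c, isBound c = true → (g j).natVar c = m.natVar c := by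
      intro j c hc
      have hcx : c ≠ x := by rintro rfl; simp [hc] at hx
      induction j with
      | zero => simp [hg, hcx]
      | succ j ih =>
        change ((s.den (g j)).setN x (j + 1)).natVar c = _
        rw [setN_natVar, if_neg hcx, den_natVar _ _ _ (setsN_bound hs hc), ih]
    obtain ⟨μ', c, hc, hI, hK⟩ := exec_loop (t := .natLt (.var x) (.var b))
      (p := .seq s.code (.setNat x (.add (.var x) (.const 1))))
      (fun j ν => Agree 0 (g j) ν) (m.natVar b) (s.cost W + 4) (by
        intro j hj ν hν
        refine ⟨?_, ?_⟩
        · simp only [Test.holds, NatExp.eval]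
          rw [hν.natVar x (by omega), hν.natVar b (by omega), hgx, hgb j b hb]
          exact hj
        · obtain ⟨ν', c, hc, a', k'⟩ := ih hs (g j) ν hν (fun c hc => by
            rw [hgb j c hc]; exact hW c hc)
          refine ⟨_, _, .seq hc (exec_setN _ _ _), ?_, ?_⟩
          · simp only [NatExp.cost]; omega
          · have : ν'.natVar x = j := by
              rw [a'.natVar x (by omega), den_natVar _ _ _ (by simpa using hxs), hgx]
            simp only [NatExp.eval, this]
            exact a'.setN x (j + 1)) (by
        intro ν hν
        simp only [Test.holds, NatExp.eval]
        rw [hν.natVar x (by omega), hν.natVar b (by omega), hgx, hgb _ b hb]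
        simp) (m := μ.setN x 0) (h.setN x 0)
    refine ⟨μ', _, .seq (exec_setN _ _ _) hc, hI, ?_⟩
    have := Nat.mul_le_mul_right (s.cost W + 7) (hW b hb)
    simp only [Test.cost, NatExp.cost] at hK
    rw [show 1 + 1 + 1 + (s.cost W + 4) = s.cost W + 7 by ring] at hK
    simp only [cost, NatExp.cost]; omega

end Stmt

/-! ### Polynomial cost bounds -/

/-- Functions that are bounded by a polynomial. -/
def PolyBounded (f : ℕ → ℕ) : Prop := ∃ c, ∀ W, f W ≤ c * (W + 1) ^ c

theorem PolyBounded.const (a : ℕ) : PolyBounded fun _ => a :=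
  ⟨a, fun W => Nat.le_mul_of_pos_right a (by positivity)⟩

theorem PolyBounded.add {f g : ℕ → ℕ} (hf : PolyBounded f) (hg : PolyBounded g) :
    PolyBounded fun W => f W + g W := by
  obtain ⟨a, ha⟩ := hf
  obtain ⟨b, hb⟩ := hg
  refine ⟨a + b, fun W => (add_le_add (ha W) (hb W)).trans ?_⟩
  rw [add_mul]
  gcongr <;> omega

theorem PolyBounded.self_mul {f : ℕ → ℕ} (hf : PolyBounded f) :
    PolyBounded fun W => W * f W := by
  obtain ⟨a, ha⟩ := hf
  refine ⟨a + 1, fun W => (Nat.mul_le_mul (Nat.le_succ W) (ha W)).trans ?_⟩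
  calc (W + 1) * (a * (W + 1) ^ a) = a * (W + 1) ^ (a + 1) := by ring
    _ ≤ (a + 1) * (W + 1) ^ (a + 1) := by gcongr; omega

/-- Only a sum multiplies the cost by W, so the degree is governed by the nesting depth, which is
fixed by the expression. -/
theorem Exp.polyBounded_cost {τ : Ty} (e : Exp τ) : PolyBounded e.cost := by
  induction e with
  | nconst | nvar | rconst | rvar => exact .const _
  | narr A i ih | rarr A i ih | not i ih => exact ih.add (.const _)
  | nadd a b iha ihb | nsub a b iha ihb | radd a b iha ihb | rsub a b iha ihb | rmul a b iha ihb
  | rdiv a b iha ihb | lt a b iha ihb | eq a b iha ihb | rlt a b iha ihb | and a b iha ihb =>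
    exact (iha.add ihb).add (.const _)
  | nite p a b ihp iha ihb | rite p a b ihp iha ihb => exact ((ihp.add iha).add ihb).add (.const _)
  | nsum b x e ih | rsum b x e ih => exact (ih.add (.const _)).self_mul.add (.const _)

theorem Stmt.polyBounded_cost (s : Stmt) : PolyBounded s.cost := by
  induction s with
  | setN x e | setR x e => exact e.polyBounded_cost.add (.const _)
  | setNA A i e | setRA A i e => exact (i.polyBounded_cost.add e.polyBounded_cost).add (.const _)
  | seq s t ihs iht => exact ihs.add iht
  | count x b s ih => exact (ih.add (.const _)).self_mul.add (.const _)

end RealRAM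

/-! Flows on a tree-form decision problem -/

namespace TreeProblem

variable {X : TreeProblem}

theorem IsChild.lt {s c : X.Node} (h : X.IsChild s c) : s < c := h.2 ▸ X.parent_lt c h.1

open Classical in
/-- The children of a node. -/
noncomputable def children (X : TreeProblem) (v : X.Node) : Finset X.Node :=
  Finset.univ.filter (X.IsChild v)

@[simp] theorem mem_children {v c : X.Node} : c ∈ X.children v ↔ X.IsChild v c := by
  simp [children]

theorem children_terminal {v : X.Node} (h : X.kind v = .terminal) : X.children v = ∅ := by
  have := (X.terminal_iff v).mp h
  ext c
  simp only [mem_children, Finset.notMem_empty, iff_false]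
  exact fun hc => this ⟨c, hc⟩

theorem exists_child {v : X.Node} (h : X.kind v ≠ .terminal) : ∃ c, X.IsChild v c := by
  by_contra hc
  exact h ((X.terminal_iff v).mpr hc)

/-- Every node except the root is a child of exactly one node. -/
theorem sum_children {M : Type*} [AddCommGroup M] (F : X.Node → M) :
    ∑ v, ∑ c ∈ X.children v, F c = (∑ c, F c) - F 0 := by
  classical
  have h : ∀ c : X.Node, (∑ v, if X.IsChild v c then F c else 0) = if c = 0 then 0 else F c := by
    intro c
    by_cases hc : c = 0
    · simp [IsChild, hc]
    · simp [IsChild, hc]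
  simp only [children, Finset.sum_filter]
  rw [Finset.sum_comm]
  simp only [h]
  have h' : ∀ c : X.Node, (if c = 0 then 0 else F c) = F c - if c = 0 then F c else 0 := by
    intro c
    split_ifs <;> simp
  simp only [h', Finset.sum_sub_distrib]
  simp

/-- Existence of functions defined by recursion from the leaves to the root. -/
theorem exists_backward {n : ℕ} (Φ : Fin n → (Fin n → ℝ) → ℝ)
    (h : ∀ s F G, (∀ c, s < c → F c = G c) → Φ s F = Φ s G) : ∃ F, ∀ s, F s = Φ s F := by
  have wf : WellFounded fun a b : Fin n => b < a := wellFounded_gt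
  refine ⟨wf.fix fun s rec => Φ s fun c => if hc : s < c then rec c hc else 0, fun s => ?_⟩
  rw [wf.fix_eq]
  exact h _ _ _ fun c hc => by simp [hc]

/-- The nonnegative multiples of mixed strategies, as vectors indexed by all nodes. -/
structure IsFlow (X : TreeProblem) (y : X.Node → ℝ) : Prop where
  nonneg : ∀ v, 0 ≤ y v
  dec : ∀ j, X.kind j = .decision → ∑ c ∈ X.children j, y c = y j
  obs : ∀ j c, X.kind j = .observation → X.IsChild j c → y c = y j

/-- A function that is at each node at least the maximal value of the subproblem. -/
structure IsUpper (X : TreeProblem) (u F : X.Node → ℝ) : Prop where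
  term : ∀ z, X.kind z = .terminal → F z = u z
  obs : ∀ j, X.kind j = .observation → ∑ c ∈ X.children j, F c = F j
  dec : ∀ j c, X.kind j = .decision → X.IsChild j c → F c ≤ F j

/-- Telescoping over the tree: the nonnegative defects φ(v) - ∑ φ(c) at the inner nodes add up to
the difference of the two sides. -/
theorem sum_terminal_le {φ : X.Node → ℝ}
    (h : ∀ v, X.kind v ≠ .terminal → ∑ c ∈ X.children v, φ c ≤ φ v) :
    ∑ z : X.Terminal, φ z.1 ≤ φ 0 := by
  classical
  have h0 := sum_children φ
  have h1 : ∑ z : X.Terminal, φ z.1 = ∑ v, if X.kind v = .terminal then φ v else 0 := by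
    rw [← Finset.sum_filter]
    exact (Finset.sum_subtype _ (by simp) φ).symm
  have h2 : ∑ v, (if X.kind v = .terminal then φ v else 0) ≤
      ∑ v, (φ v - ∑ c ∈ X.children v, φ c) := by
    refine Finset.sum_le_sum fun v _ => ?_
    split_ifs with hv
    · simp [children_terminal hv]
    · linarith [h v hv]
  rw [Finset.sum_sub_distrib] at h2
  linarith

/-- Weak duality: the product F · y does not increase in passing to the sum over the children,
because F splits and y is copied at observation points, while y splits and F does not increase at
decision points. -/
theorem IsUpper.le {u F y : X.Node → ℝ} (hF : X.IsUpper u F) (hy : X.IsFlow y) :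
    ∑ z : X.Terminal, u z.1 * y z.1 ≤ F 0 * y 0 := by
  have := sum_terminal_le (X := X) (φ := fun v => F v * y v) (fun v hv => by
    cases hk : X.kind v with
    | terminal => exact absurd hk hv
    | decision =>
      rw [← hy.dec v hk, Finset.mul_sum]
      refine Finset.sum_le_sum fun c hc => ?_
      exact mul_le_mul_of_nonneg_right (hF.dec v c hk (by simpa using hc)) (hy.nonneg c)
    | observation =>
      rw [← hF.obs v hk, Finset.sum_mul]
      refine (Finset.sum_congr rfl fun c hc => ?_).le
      rw [hy.obs v c hk (by simpa using hc)])
  refine le_trans (Finset.sum_le_sum fun z _ => ?_) this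
  rw [hF.term z.1 z.2]

/-- This turns the inductive path predicate into a recursion on the parent, the form in which a
table can be filled. -/
theorem played_iff {a : X.Node → X.Node} (ha : X.IsAssignment a) (c : X.Node) :
    X.Played a c ↔ c = 0 ∨ c ≠ 0 ∧ X.Played a (X.parent c) ∧
      (X.kind (X.parent c) = .observation ∨
        X.kind (X.parent c) = .decision ∧ a (X.parent c) = c) := by
  constructor
  · intro h
    cases h with
    | root => exact .inl rfl
    | obs s c hs hk hc => exact .inr ⟨hc.1, by rw [hc.2]; exact ⟨hs, .inl hk⟩⟩
    | act s hs hk =>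
      have hc := ha s hk
      exact .inr ⟨hc.1, by rw [hc.2]; exact ⟨hs, .inr ⟨hk, rfl⟩⟩⟩
  · rintro (rfl | ⟨h0, hp, hk | ⟨hk, h⟩⟩)
    · exact .root
    · exact .obs _ _ hp hk ⟨h0, rfl⟩
    · rw [← h]; exact .act _ hp hk

theorem IsChild.played_obs {a : X.Node → X.Node} (ha : X.IsAssignment a) {j c : X.Node}
    (hc : X.IsChild j c) (hk : X.kind j = .observation) : X.Played a c ↔ X.Played a j := by
  rw [played_iff ha c]
  simp [hc.1, hc.2, hk]

theorem IsChild.played_dec {a : X.Node → X.Node} (ha : X.IsAssignment a) {j c : X.Node}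
    (hc : X.IsChild j c) (hk : X.kind j = .decision) :
    X.Played a c ↔ X.Played a j ∧ a j = c := by
  rw [played_iff ha c]
  simp [hc.1, hc.2, hk]

open Classical in
theorem sum_played_dec {a : X.Node → X.Node} (ha : X.IsAssignment a) {j : X.Node}
    (hk : X.kind j = .decision) (f : X.Node → ℝ) :
    ∑ c ∈ X.children j, (if X.Played a c then f c else 0) =
      if X.Played a j then f (a j) else 0 := by
  rw [Finset.sum_eq_single_of_mem (a j) (by simpa using ha j hk)]
  · simp [(ha j hk).played_dec ha hk]
  · intro c hc hca
    simp only [mem_children] at hc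
    simp [hc.played_dec ha hk, Ne.symm hca]

open Classical in
theorem isFlow_played {a : X.Node → X.Node} (ha : X.IsAssignment a) :
    X.IsFlow fun v => if X.Played a v then 1 else 0 where
  nonneg v := by positivity
  dec j hk := sum_played_dec ha hk _
  obs j c hk hc := by simp [hc.played_obs ha hk]

open Classical in
/-- The maximal value function, and a pure strategy that attains it. -/
theorem exists_upper (u : X.Node → ℝ) : ∃ F a, X.IsUpper u F ∧ X.IsAssignment a ∧
    ∑ z : X.Terminal, u z.1 * (if X.Played a z.1 then 1 else 0) = F 0 := by
  obtain ⟨F, hF⟩ := exists_backward (fun (v : X.Node) (F : X.Node → ℝ) =>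
    match X.kind v with
    | .terminal => u v
    | .observation => ∑ c ∈ X.children v, F c
    | .decision => ⨆ c : X.children v, F c) (by
    intro s F G h
    have : ∀ c ∈ X.children s, F c = G c := fun c hc => h c (mem_children.mp hc).lt
    cases hk : X.kind s with
    | terminal => rfl
    | observation => exact Finset.sum_congr rfl this
    | decision => exact iSup_congr fun c => this c c.2)
  have hmax : ∀ j, ∃ c, X.kind j = .decision → X.IsChild j c ∧ F c = F j := by
    intro j
    by_cases hk : X.kind j = .decision
    · obtain ⟨c, hc⟩ := exists_child (X := X) (v := j) (by simp [hk])
      have : Nonempty (X.children j) := ⟨⟨c, by simpa using hc⟩⟩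
      obtain ⟨d, hd⟩ := exists_eq_ciSup_of_finite (f := fun c : X.children j => F c)
      refine ⟨d, fun _ => ⟨mem_children.mp d.2, ?_⟩⟩
      rw [hF j, hk]
      exact hd
    · exact ⟨0, fun h => absurd h hk⟩
  choose a ha using hmax
  have hup : X.IsUpper u F := by
    refine ⟨fun z hz => ?_, fun j hj => ?_, fun j c hj hc => ?_⟩
    · rw [hF z, hz]
    · rw [hF j, hj]
    · rw [hF j, hj]
      exact le_ciSup (f := fun c : X.children j => F c) (Set.finite_range _).bddAbove
        ⟨c, by simpa using hc⟩
  have haa : X.IsAssignment a := fun j hj => (ha j hj).1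
  refine ⟨F, a, hup, haa, le_antisymm ?_ ?_⟩
  · have := hup.le (isFlow_played haa)
    simpa [Played.root] using this
  -- For the maximising actions the weak duality estimate is conserved at every node; the
  -- telescoping inequality, applied to the negative, gives the missing direction.
  · have := sum_terminal_le (X := X)
      (φ := fun v => -(F v * (if X.Played a v then 1 else 0))) (fun v hv => by
      refine le_of_eq ?_
      rw [Finset.sum_neg_distrib]
      congr 1
      cases hk : X.kind v with
      | terminal => exact absurd hk hv
      | decision =>
        have := sum_played_dec haa hk F
        simp only [mul_ite, mul_one, mul_zero]
        rw [this, (ha v hk).2]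
      | observation =>
        rw [← hup.obs v hk, Finset.sum_mul]
        refine Finset.sum_congr rfl fun c hc => ?_
        simp only [mem_children] at hc
        simp [hc.played_obs haa hk])
    rw [Finset.sum_neg_distrib, neg_le_neg_iff] at this
    simp only [Played.root, if_true, mul_one] at this
    refine this.trans (Finset.sum_le_sum fun z _ => ?_)
    rw [hup.term z.1 z.2]

/-- Utilities have value functions of oscillation at most `2`. -/
theorem exists_bounds {u : X.Terminal → ℝ} (hu : u ∈ X.utilities) {w : X.Node → ℝ}
    (hw : ∀ z : X.Terminal, w z.1 = u z) :
    ∃ F F', X.IsUpper w F ∧ X.IsUpper (-w) F' ∧ F 0 ≤ 1 ∧ F' 0 ≤ 1 ∧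
      ∀ v, 0 ≤ F v + F' v ∧ F v + F' v ≤ 2 := by
  classical
  obtain ⟨F, a, hF, ha, h1⟩ := exists_upper w
  obtain ⟨F', a', hF', ha', h2⟩ := exists_upper (-w)
  have e : ∀ b : X.Node → X.Node, X.pairing u (X.treeForm b) =
      ∑ z : X.Terminal, w z.1 * (if X.Played b z.1 then 1 else 0) := by
    intro b
    unfold pairing treeForm
    refine Finset.sum_congr rfl fun z _ => ?_
    rw [hw]
  have b1 : F 0 ≤ 1 := by
    rw [← h1, ← e]
    exact (abs_le.mp (hu _ ⟨a, ha, rfl⟩)).2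
  have b2 : F' 0 ≤ 1 := by
    have := (abs_le.mp (hu _ ⟨a', ha', rfl⟩)).1
    rw [e] at this
    rw [← h2]
    simp only [Pi.neg_apply, neg_mul, Finset.sum_neg_distrib]
    linarith
  -- F + F' is the spread between the maximal and the minimal value of a subproblem. Nonnegativity
  -- is proved from the leaves upwards.
  have b0 : ∀ v, 0 ≤ F v + F' v := by
    intro v
    induction v using WellFoundedGT.induction with
    | ind v ih =>
    cases hk : X.kind v with
    | terminal => simp [hF.term v hk, hF'.term v hk]
    | observation =>
      rw [← hF.obs v hk, ← hF'.obs v hk, ← Finset.sum_add_distrib]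
      exact Finset.sum_nonneg fun c hc => ih c (mem_children.mp hc).lt
    | decision =>
      obtain ⟨c, hc⟩ := exists_child (X := X) (v := v) (by simp [hk])
      linarith [ih c hc.lt, hF.dec v c hk hc, hF'.dec v c hk hc]
  refine ⟨F, F', hF, hF', b1, b2, fun v => ⟨b0 v, ?_⟩⟩
  -- The bound 2 is proved from the root downwards: it holds at the root since F and F' are at most
  -- 1 there. Below an observation point a child carries one of several nonnegative summands; below
  -- a decision point both functions do not increase.
  induction v using WellFoundedLT.induction with
  | ind v ih =>
  by_cases hv : v = 0
  · subst hv; linarith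
  · have hc : X.IsChild (X.parent v) v := ⟨hv, rfl⟩
    have := ih (X.parent v) hc.lt
    cases hk : X.kind (X.parent v) with
    | terminal => exact absurd ⟨v, hc⟩ ((X.terminal_iff _).mp hk)
    | observation =>
      rw [← hF.obs _ hk, ← hF'.obs _ hk, ← Finset.sum_add_distrib] at this
      exact (Finset.single_le_sum (f := fun c => F c + F' c) (fun c _ => b0 c)
        (mem_children.mpr hc)).trans this
    | decision => linarith [hF.dec _ v hk hc, hF'.dec _ v hk hc]

/-- The value of a utility vector on a unit flow. -/
theorem abs_value_le_one {u : X.Terminal → ℝ} (hu : u ∈ X.utilities) {y : X.Node → ℝ}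
    (hy : X.IsFlow y) (h0 : y 0 = 1) : |∑ z : X.Terminal, u z * y z.1| ≤ 1 := by
  classical
  set w : X.Node → ℝ := fun v => if h : X.kind v = .terminal then u ⟨v, h⟩ else 0 with hwd
  have hw : ∀ z : X.Terminal, w z.1 = u z := fun z => by simp [hwd, z.2]
  obtain ⟨F, F', hF, hF', b1, b2, -⟩ := exists_bounds hu hw
  have e1 := hF.le hy
  have e2 := hF'.le hy
  simp only [Pi.neg_apply, neg_mul, Finset.sum_neg_distrib, hw, h0, mul_one] at e1 e2
  rw [abs_le]
  constructor <;> linarith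

/-! Extraction of a pure strategy from a flow -/

/-- `c` is not the chosen child: a sibling has a larger flow, or the same flow and a smaller
number. -/
def Beaten (X : TreeProblem) (y : X.Node → ℝ) (c : X.Node) : Prop :=
  ∃ d, d ≠ 0 ∧ X.parent d = X.parent c ∧ (y c < y d ∨ ¬ y d < y c ∧ d < c)

/-- At each decision point the child of largest flow is chosen, with ties broken in favour of the
smallest number. The tie-breaking makes the choice unique, so that it can be tested child by child
through `Beaten`. -/
theorem exists_assignment (y : X.Node → ℝ) : ∃ a, X.IsAssignment a ∧
    (∀ j c, X.kind j = .decision → X.IsChild j c → (y c ≤ y (a j) ∧ (¬ X.Beaten y c ↔ a j = c))) := by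
  have : ∀ j, ∃ d, X.kind j = .decision → X.IsChild j d ∧
      ∀ c, X.IsChild j c → (y c ≤ y d ∧ (¬ X.Beaten y c ↔ d = c)) := by
    intro j
    by_cases hk : X.kind j = .decision
    · obtain ⟨c, hc⟩ := exists_child (X := X) (v := j) (by simp [hk])
      obtain ⟨d, hd, hmax⟩ := Finset.exists_max_image (X.children j)
        -- A lexicographic maximum in which the second coordinate is reversed, so that ties go to
        -- the smaller number.
        (fun c => toLex (y c, OrderDual.toDual c)) ⟨c, by simpa using hc⟩
      simp only [mem_children] at hd hmax
      have hm : ∀ c, X.IsChild j c → y c < y d ∨ y c = y d ∧ d ≤ c := by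
        intro c hc
        have := hmax c hc
        rw [Prod.Lex.toLex_le_toLex] at this
        simpa using this
      refine ⟨d, fun _ => ⟨hd, fun c hc => ⟨?_, ?_⟩⟩⟩
      · rcases hm c hc with h | h
        · exact h.le
        · exact h.1.le
      · constructor
        · intro hb
          by_contra hne
          refine hb ⟨d, hd.1, by rw [hd.2, hc.2], ?_⟩
          rcases hm c hc with h | ⟨h, h'⟩
          · exact .inl h
          · exact .inr ⟨by rw [h]; exact lt_irrefl _, lt_of_le_of_ne h' hne⟩
        · rintro rfl ⟨e, he0, hep, he⟩
          have hec : X.IsChild j e := ⟨he0, by rw [hep, hc.2]⟩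
          rcases hm e hec with h | ⟨h, h'⟩
          · rcases he with he | he
            · exact lt_asymm h he
            · exact he.1 h
          · rcases he with he | he
            · exact absurd h he.ne'
            · exact absurd he.2 (not_lt.mpr h')
    · exact ⟨0, fun h => absurd h hk⟩
  choose a ha using this
  exact ⟨a, fun j hj => (ha j hj).1, fun j c hj hc => (ha j hj).2 c hc⟩

theorem IsFlow.eq_zero {y : X.Node → ℝ} (hy : X.IsFlow y) (h0 : y 0 = 0) (v : X.Node) :
    y v = 0 := by
  induction v using WellFoundedLT.induction with
  | ind v ih =>
  by_cases hv : v = 0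
  · rw [hv, h0]
  · have hc : X.IsChild (X.parent v) v := ⟨hv, rfl⟩
    have h := ih _ hc.lt
    cases hk : X.kind (X.parent v) with
    | terminal => exact absurd ⟨v, hc⟩ ((X.terminal_iff _).mp hk)
    | observation => rw [hy.obs _ v hk hc, h]
    | decision =>
      have := Finset.single_le_sum (f := y) (fun c _ => hy.nonneg c) (mem_children.mpr hc)
      rw [hy.dec _ hk, h] at this
      exact le_antisymm this (hy.nonneg v)

open Classical in
theorem IsFlow.sub_played {y : X.Node → ℝ} (hy : X.IsFlow y) {a : X.Node → X.Node}
    (ha : X.IsAssignment a) {w : ℝ} (hw : ∀ v, X.Played a v → w ≤ y v) :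
    X.IsFlow fun v => y v - if X.Played a v then w else 0 where
  nonneg v := by
    split_ifs with h
    · linarith [hw v h]
    · linarith [hy.nonneg v]
  dec j hj := by
    rw [Finset.sum_sub_distrib, hy.dec j hj, sum_played_dec ha hj fun _ => w]
  obs j c hj hc := by rw [hy.obs j c hj hc, hc.played_obs ha hj]

open Classical in
/-- Subtracting as much as possible of the extracted pure strategy annihilates one more entry. -/
theorem IsFlow.card_support {y : X.Node → ℝ} (hy : X.IsFlow y) {a : X.Node → X.Node}
    (hmax : ∀ j c, X.kind j = .decision → X.IsChild j c → y c ≤ y (a j))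
    {v₀ : X.Node} (hv₀ : X.Played a v₀) {r : ℕ}
    (hr : y 0 = 0 ∨ (Finset.univ.filter fun v => y v ≠ 0).card ≤ r + 1) :
    (y 0 - if X.Played a 0 then y v₀ else 0) = 0 ∨
      (Finset.univ.filter fun v => (y v - if X.Played a v then y v₀ else 0) ≠ 0).card ≤ r := by
  -- An exhausted flow vanishes everywhere and the step subtracts 0. This alternative lets a loop of
  -- fixed length run past exhaustion.
  by_cases h0 : y 0 = 0
  · left
    simp [hy.eq_zero h0]
  · right
    -- Positivity propagates along the played paths: where the children sum to a positive number,
    -- the largest of them is positive. Hence removing the flow at v₀ really kills an entry.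
    have hpos : ∀ v, X.Played a v → 0 < y v := by
      intro v hv
      induction hv with
      | root => exact lt_of_le_of_ne (hy.nonneg 0) (Ne.symm h0)
      | obs s c _ hk hc ih => rwa [hy.obs s c hk hc]
      | act s _ hk ih =>
        by_contra hle
        have h' : ∀ c ∈ X.children s, y c = 0 := fun c hc =>
          le_antisymm ((hmax s c hk (mem_children.mp hc)).trans (not_lt.mp hle)) (hy.nonneg c)
        rw [← hy.dec s hk, Finset.sum_eq_zero h'] at ih
        exact lt_irrefl _ ih
    have hc := hr.resolve_left h0
    refine Nat.lt_succ_iff.mp (lt_of_lt_of_le (Finset.card_lt_card ?_) hc)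
    rw [Finset.ssubset_iff_of_subset]
    · exact ⟨v₀, by simp [(hpos v₀ hv₀).ne'], by simp [hv₀]⟩
    · intro v hv
      simp only [Finset.mem_filter, Finset.mem_univ, true_and] at hv ⊢
      intro hyv
      split_ifs at hv with hp
      · exact absurd hyv (hpos v hp).ne'
      · simp [hyv] at hv

/-! ### Counting nodes against leaves -/

/-- A standard decision problem has at most four times as many nodes as leaves. -/
theorem IsStandard.size_le (hX : X.IsStandard) : X.size + 1 ≤ 4 * X.dim := by
  classical
  set T := Finset.univ.filter fun v : X.Node => X.kind v = .terminal with hT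
  set D := Finset.univ.filter fun v : X.Node => X.kind v = .decision with hD
  set O := Finset.univ.filter fun v : X.Node => X.kind v = .observation with hO
  have hdim : X.dim = T.card := by
    rw [dim, Fintype.card_subtype]
  have hcard : X.size + 1 = T.card + D.card + O.card := by
    have h1 : (Finset.univ : Finset X.Node).card = X.size + 1 := by simp
    rw [← h1, hT, hD, hO, Finset.card_filter, Finset.card_filter, Finset.card_filter,
      ← Finset.sum_add_distrib, ← Finset.sum_add_distrib, Finset.card_eq_sum_ones]
    refine Finset.sum_congr rfl fun v _ => ?_
    cases X.kind v <;> simp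
  -- Alternation gives every observation point a child that is a decision point or a leaf; distinct
  -- parents have distinct children.
  have hO' : O.card ≤ T.card + D.card := by
    have : ∀ v, ∃ c, v ∈ O → X.IsChild v c := by
      intro v
      by_cases hv : v ∈ O
      · obtain ⟨c, hc⟩ := exists_child (X := X) (v := v) (by
          simp only [hO, Finset.mem_filter] at hv
          simp [hv.2])
        exact ⟨c, fun _ => hc⟩
      · exact ⟨0, fun h => absurd h hv⟩
    choose f hf using this
    calc O.card ≤ (T ∪ D).card := by
          refine Finset.card_le_card_of_injOn f (fun v hv => ?_) (fun v hv w hw h => ?_)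
          · have hc := hf v hv
            simp only [hO, Finset.coe_filter, Finset.mem_univ, true_and, Set.mem_ofPred_eq] at hv
            have := hX.alternating v _ hc
            rw [hv] at this
            simp only [hT, hD, Finset.coe_union, Finset.coe_filter, Finset.mem_univ, true_and,
              Set.mem_union, Set.mem_ofPred_eq]
            cases hk : X.kind (f v) <;> simp_all
          · rw [← (hf v hv).2, ← (hf w hw).2, h]
      _ ≤ _ := Finset.card_union_le _ _
  -- Counting edges, of which there are one fewer than nodes. With the partition into three types
  -- this yields D < T, and then O < 2T.
  have hch : D.card * 2 + O.card ≤ X.size := by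
    have h1 := sum_children (X := X) (fun _ => (1 : ℤ))
    simp only [Finset.sum_const, Finset.card_univ, Fintype.card_fin, nsmul_eq_mul, mul_one] at h1
    have h2 : ((D.card * 2 + O.card : ℕ) : ℤ) ≤ ∑ v, ((X.children v).card : ℤ) := by
      push_cast
      rw [hD, hO, Finset.card_filter, Finset.card_filter]
      push_cast
      rw [Finset.sum_mul, ← Finset.sum_add_distrib]
      refine Finset.sum_le_sum fun v _ => ?_
      cases hk : X.kind v with
      | terminal => simp
      | observation =>
        obtain ⟨c, hc⟩ := exists_child (X := X) (v := v) (by simp [hk])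
        have : 1 ≤ (X.children v).card := Finset.card_pos.mpr ⟨c, by simpa using hc⟩
        simp only [reduceCtorEq, if_false, if_true]
        omega
      | decision =>
        obtain ⟨c, d, hcd, hc, hd⟩ := hX.branching v hk
        have : 1 < (X.children v).card :=
          Finset.one_lt_card.mpr ⟨c, by simpa using hc, d, by simpa using hd, hcd⟩
        simp only [reduceCtorEq, if_false, if_true]
        omega
    push_cast at h1 h2
    omega
  omega

end TreeProblem

/-! The graph of positions of the interleaving -/

namespace TreeProblem

open Function Finset

variable {X : TreeProblem} {k : ℕ}

/-- Positions: component `0` belongs to `X`, the others to its dual. -/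
abbrev Pos (X : TreeProblem) (k : ℕ) : Type := Fin (k + 1) → X.Node

def compKind (X : TreeProblem) {k : ℕ} (i : Fin (k + 1)) (v : X.Node) : NodeKind :=
  if i = 0 then X.kind v else (X.kind v).swap

def ObsAt (s : X.Pos k) (i : Fin (k + 1)) : Prop := X.compKind i (s i) = .observation

/-- A component moves to a child; at observation points this is the first component that is at an
observation point. -/
def Adj (s t : X.Pos k) : Prop :=
  ∃ i, X.IsChild (s i) (t i) ∧ (∀ j, j ≠ i → t j = s j) ∧
    ((∀ j, ¬ ObsAt s j) ∨ ObsAt s i ∧ ∀ j, j < i → ¬ ObsAt s j)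

def Final (s : X.Pos k) : Prop := ∀ i, X.kind (s i) = .terminal

theorem eq_update {s t : X.Pos k} {i : Fin (k + 1)} (h : ∀ j, j ≠ i → t j = s j) :
    t = update s i (t i) := by
  funext j
  by_cases hj : j = i
  · subst hj; simp
  · simp [hj, h j hj]

/-- Moves increase the position in the product order. All forward and backward recursions on
positions are founded on this. -/
theorem Adj.lt {s t : X.Pos k} (h : Adj s t) : s < t := by
  obtain ⟨i, hc, ht, -⟩ := h
  rw [Pi.lt_def]
  refine ⟨fun j => ?_, i, hc.lt⟩
  by_cases hj : j = i
  · subst hj; exact hc.lt.le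
  · exact (ht j hj).ge

theorem Final.not_adj {s t : X.Pos k} (h : Final s) : ¬ Adj s t := by
  rintro ⟨i, hc, -⟩
  exact (X.terminal_iff _).mp (h i) ⟨_, hc⟩

theorem Final.not_obsAt {s : X.Pos k} (h : Final s) (i : Fin (k + 1)) : ¬ ObsAt s i := by
  intro ho
  unfold ObsAt compKind at ho
  rw [h i] at ho
  split_ifs at ho; all_goals simp [NodeKind.swap] at ho

theorem exists_first {s : X.Pos k} (h : ∃ i, ObsAt s i) :
    ∃ i, ObsAt s i ∧ ∀ j, j < i → ¬ ObsAt s j := by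
  classical
  obtain ⟨i, hi, hm⟩ := Finset.exists_min_image (univ.filter fun i => ObsAt s i) id
    (by obtain ⟨i, hi⟩ := h; exact ⟨i, by simpa using hi⟩)
  simp only [mem_filter, mem_univ, true_and, id] at hi hm
  exact ⟨i, hi, fun j hj hjo => absurd (hm j hjo) (not_le.mpr hj)⟩

theorem adj_first {s t : X.Pos k} {i : Fin (k + 1)} (hi : ObsAt s i)
    (hm : ∀ j, j < i → ¬ ObsAt s j) :
    Adj s t ↔ ∃ c, X.IsChild (s i) c ∧ t = update s i c := by
  constructor
  · rintro ⟨j, hc, ht, h | ⟨hj, hj'⟩⟩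
    · exact absurd hi (h i)
    · obtain rfl : i = j := le_antisymm (not_lt.mp fun h => hm j h hj)
        (not_lt.mp fun h => hj' i h hi)
      exact ⟨t i, hc, eq_update ht⟩
  · rintro ⟨c, hc, rfl⟩
    exact ⟨i, by simpa using hc, fun j hj => by simp [hj], .inr ⟨hi, hm⟩⟩

theorem adj_dec {s t : X.Pos k} (hs : ∀ i, ¬ ObsAt s i) :
    Adj s t ↔ ∃ i c, X.IsChild (s i) c ∧ t = update s i c := by
  constructor
  · rintro ⟨i, hc, ht, -⟩
    exact ⟨i, t i, hc, eq_update ht⟩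
  · rintro ⟨i, c, hc, rfl⟩
    exact ⟨i, by simpa using hc, fun j hj => by simp [hj], .inl hs⟩

theorem exists_adj {s : X.Pos k} (h : ¬ Final s) : ∃ t, Adj s t := by
  by_cases ho : ∃ i, ObsAt s i
  · obtain ⟨i, hi, hm⟩ := exists_first ho
    obtain ⟨c, hc⟩ := exists_child (X := X) (v := s i) (by
      intro ht
      unfold ObsAt compKind at hi
      rw [ht] at hi
      split_ifs at hi; all_goals simp [NodeKind.swap] at hi)
    exact ⟨_, (adj_first hi hm).mpr ⟨c, hc, rfl⟩⟩
  · push Not at ho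
    unfold Final at h
    push Not at h
    obtain ⟨i, hi⟩ := h
    obtain ⟨c, hc⟩ := exists_child hi
    exact ⟨_, (adj_dec ho).mpr ⟨i, c, hc, rfl⟩⟩

theorem obsAt_zero {s : X.Pos k} : ObsAt s 0 ↔ X.kind (s 0) = .observation := by
  simp [ObsAt, compKind]

theorem obsAt_ne_zero {s : X.Pos k} {i : Fin (k + 1)} (hi : i ≠ 0) :
    ObsAt s i ↔ X.kind (s i) = .decision := by
  simp only [ObsAt, compKind, hi, if_false]
  cases X.kind (s i) <;> simp [NodeKind.swap]

/-- A move changes component `0` only to a child. -/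
theorem Adj.zero {s t : X.Pos k} (h : Adj s t) (h0 : t 0 ≠ s 0) :
    X.IsChild (s 0) (t 0) ∧ t = update s 0 (t 0) := by
  obtain ⟨i, hc, ht, -⟩ := h
  have : i = 0 := by
    by_contra hi
    exact h0 (ht 0 (Ne.symm hi))
  subst this
  exact ⟨hc, eq_update ht⟩

/-! Policies and the masses of the mediators -/

/-- Probabilities of the moves at the decision points; at the other positions all moves have
weight `1`. -/
structure IsPolicy (P : X.Pos k → X.Pos k → ℝ) : Prop where
  nonneg : ∀ s t, 0 ≤ P s t
  supp : ∀ s t, ¬ Adj s t → P s t = 0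
  obs : ∀ s t, Adj s t → (∃ i, ObsAt s i) → P s t = 1
  dec : ∀ s, (∀ i, ¬ ObsAt s i) → ¬ Final s → ∑ t, P s t = 1

/-- The probabilities, scaled by `μ`, that the mediators' components are consistent with a mixed
strategy. -/
structure IsMass (μ : ℝ) (G : X.Pos k → ℝ) : Prop where
  nonneg : ∀ s, 0 ≤ G s
  le : ∀ s, G s ≤ μ
  root : G (fun _ => 0) = μ
  zero : ∀ s c, G (update s 0 c) = G s
  obs : ∀ s i c, i ≠ 0 → X.kind (s i) = .observation → X.IsChild (s i) c → G (update s i c) = G s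
  dec : ∀ s i, i ≠ 0 → X.kind (s i) = .decision → ∑ c ∈ X.children (s i), G (update s i c) = G s

theorem IsMass.empty : IsMass (X := X) (k := k) 0 (fun _ => 0) := by
  constructor <;> simp

theorem IsMass.add {μ ν : ℝ} {G H : X.Pos k → ℝ} (hG : IsMass μ G) (hH : IsMass ν H) :
    IsMass (μ + ν) (fun s => G s + H s) where
  nonneg s := add_nonneg (hG.nonneg s) (hH.nonneg s)
  le s := add_le_add (hG.le s) (hH.le s)
  root := by rw [hG.root, hH.root]
  zero s c := by rw [hG.zero, hH.zero]
  obs s i c h0 hk hc := by rw [hG.obs s i c h0 hk hc, hH.obs s i c h0 hk hc]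
  dec s i h0 hk := by rw [sum_add_distrib, hG.dec s i h0 hk, hH.dec s i h0 hk]

theorem IsMass.smul {μ : ℝ} {G : X.Pos k → ℝ} (hG : IsMass μ G) {w : ℝ} (hw : 0 ≤ w) :
    IsMass (w * μ) (fun s => w * G s) where
  nonneg s := mul_nonneg hw (hG.nonneg s)
  le s := mul_le_mul_of_nonneg_left (hG.le s) hw
  root := by rw [hG.root]
  zero s c := by rw [hG.zero]
  obs s i c h0 hk hc := by rw [hG.obs s i c h0 hk hc]
  dec s i h0 hk := by rw [← mul_sum, hG.dec s i h0 hk]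

open Classical in
-- All mediators are governed by the same assignment. Mixtures of these indicators thus produce the
-- joint moments E ∏ x[z_i] rather than products of expectations.
theorem isMass_played {a : X.Node → X.Node} (ha : X.IsAssignment a) :
    IsMass (k := k) 1 (fun s => if ∀ i, i ≠ 0 → X.Played a (s i) then 1 else 0) where
  nonneg s := by positivity
  le s := by split_ifs <;> norm_num
  root := by simp [Played.root]
  zero s c := by
    congr 1
    refine propext (forall_congr' fun i => imp_congr_right fun hi => ?_)
    simp [hi]
  obs s i c h0 hk hc := by
    congr 1
    refine propext (forall_congr' fun j => imp_congr_right fun hj => ?_)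
    by_cases hji : j = i
    · subst hji
      simp [hc.played_obs ha hk]
    · simp [hji]
  dec s i h0 hk := by
    by_cases h : ∀ j, j ≠ 0 → j ≠ i → X.Played a (s j)
    · have h1 : ∀ c, (∀ j, j ≠ 0 → X.Played a (update s i c j)) ↔ X.Played a c := by
        intro c
        constructor
        · intro h'; simpa using h' i h0
        · intro hc j hj
          by_cases hji : j = i
          · subst hji; simpa using hc
          · simpa [hji] using h j hj hji
      have h2 : (∀ j, j ≠ 0 → X.Played a (s j)) ↔ X.Played a (s i) := by
        simpa using h1 (s i)
      simp only [h1, h2]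
      exact sum_played_dec ha hk _
    · have h1 : ∀ c, ¬ ∀ j, j ≠ 0 → X.Played a (update s i c j) := by
        intro c h'
        refine h fun j hj hji => ?_
        simpa [hji] using h' j hj
      have h2 : ¬ ∀ j, j ≠ 0 → X.Played a (s j) := by
        simpa using h1 (s i)
      simp [h1, h2]

theorem IsPolicy.sum_first {P : X.Pos k → X.Pos k → ℝ} (hP : IsPolicy P) {s : X.Pos k}
    {i : Fin (k + 1)} (hi : ObsAt s i) (hm : ∀ j, j < i → ¬ ObsAt s j) (f : X.Pos k → ℝ) :
    ∑ t, P s t * f t = ∑ c ∈ X.children (s i), f (update s i c) := by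
  classical
  have h1 : ∀ t, P s t * f t = if Adj s t then f t else 0 := by
    intro t
    split_ifs with h
    · rw [hP.obs s t h ⟨i, hi⟩, one_mul]
    · rw [hP.supp s t h, zero_mul]
  rw [sum_congr rfl fun t _ => h1 t, ← sum_filter]
  have h2 : univ.filter (fun t => Adj s t) = (X.children (s i)).image (update s i) := by
    ext t
    simp only [mem_filter, mem_univ, true_and, mem_image, mem_children, adj_first hi hm]
    exact exists_congr fun c => and_congr_right fun _ => eq_comm
  rw [h2, sum_image fun c _ d _ h => update_injective s i h]

theorem IsPolicy.final {P : X.Pos k → X.Pos k → ℝ} (hP : IsPolicy P) {s : X.Pos k}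
    (hs : Final s) (f : X.Pos k → ℝ) : ∑ t, P s t * f t = 0 :=
  sum_eq_zero fun t _ => by rw [hP.supp s t hs.not_adj, zero_mul]

/-- At a decision position, either component 0 moves, or a mediator moves at an observation point of
X, where the played strategy has no influence. -/
theorem IsMass.adj_dec {μ : ℝ} {G : X.Pos k → ℝ} (hG : IsMass μ G) {s t : X.Pos k}
    (hs : ∀ i, ¬ ObsAt s i) (h : Adj s t) : G t = G s := by
  obtain ⟨i, c, hc, rfl⟩ := (TreeProblem.adj_dec hs).mp h
  by_cases hi : i = 0
  · subst hi; exact hG.zero s c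
  · refine hG.obs s i c hi ?_ hc
    cases hk : X.kind (s i) with
    | terminal => exact absurd ⟨c, hc⟩ ((X.terminal_iff _).mp hk)
    | observation => rfl
    | decision => exact absurd ((obsAt_ne_zero hi).mpr hk) (hs i)

/-- Mass is conserved by a policy: it splits at the mediators' observation points and is constant
along the policy's own moves. Only observation points of component 0 are excluded, since there the
mass is copied to every child. -/
theorem IsMass.sum_policy {μ : ℝ} {G : X.Pos k → ℝ} (hG : IsMass μ G)
    {P : X.Pos k → X.Pos k → ℝ} (hP : IsPolicy P) {s : X.Pos k} (hs : ¬ Final s)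
    (h0 : X.kind (s 0) ≠ .observation) : ∑ t, P s t * G t = G s := by
  by_cases ho : ∃ i, ObsAt s i
  · obtain ⟨i, hi, hm⟩ := exists_first ho
    have hi0 : i ≠ 0 := by
      rintro rfl
      exact h0 (obsAt_zero.mp hi)
    rw [hP.sum_first hi hm, hG.dec s i hi0 ((obsAt_ne_zero hi0).mp hi)]
  · push Not at ho
    have : ∀ t, P s t * G t = P s t * G s := by
      intro t
      by_cases h : Adj s t
      · rw [hG.adj_dec ho h]
      · rw [hP.supp s t h, zero_mul, zero_mul]
    rw [sum_congr rfl fun t _ => this t, ← sum_mul, hP.dec s ho hs, one_mul]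

open Classical in
/-- The values of the positions under a policy. -/
def IsValue (P : X.Pos k → X.Pos k → ℝ) (u : X.Node → ℝ) (G V : X.Pos k → ℝ) : Prop :=
  ∀ s, V s = (if Final s then u (s 0) * G s else 0) + ∑ t, P s t * V t

theorem IsValue.neg {P : X.Pos k → X.Pos k → ℝ} {u : X.Node → ℝ} {G V : X.Pos k → ℝ}
    (h : IsValue P u G V) : IsValue P (-u) G (-V) := by
  classical
  intro s
  have := h s
  simp only [Pi.neg_apply, mul_neg, sum_neg_distrib, neg_mul]
  rw [this, neg_add]
  congr 1
  split_ifs <;> simp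

/-- Backward induction. An observation of component 0 splits F, an observation of a mediator splits
G, and at decision positions G is constant while F does not increase. -/
theorem IsValue.le {μ : ℝ} {G : X.Pos k → ℝ} (hG : IsMass μ G)
    {P : X.Pos k → X.Pos k → ℝ} (hP : IsPolicy P) {u F : X.Node → ℝ} (hF : X.IsUpper u F)
    {V : X.Pos k → ℝ} (hV : IsValue P u G V) (s : X.Pos k) : V s ≤ G s * F (s 0) := by
  induction s using WellFoundedGT.induction with
  | ind s ih =>
  rw [hV s]
  by_cases hf : Final s
  · rw [if_pos hf, hP.final hf, hF.term _ (hf 0), add_zero, mul_comm]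
  rw [if_neg hf, zero_add]
  have ih' : ∀ t, Adj s t → V t ≤ G t * F (t 0) := fun t h => ih t h.lt
  by_cases ho : ∃ i, ObsAt s i
  · obtain ⟨i, hi, hm⟩ := exists_first ho
    rw [hP.sum_first hi hm]
    have hle : ∑ c ∈ X.children (s i), V (update s i c) ≤
        ∑ c ∈ X.children (s i), G (update s i c) * F (update s i c 0) :=
      sum_le_sum fun c hc => ih' _ ((adj_first hi hm).mpr ⟨c, mem_children.mp hc, rfl⟩)
    refine hle.trans (le_of_eq ?_)
    by_cases hi0 : i = 0
    · subst hi0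
      simp only [hG.zero, update_self]
      rw [← mul_sum, hF.obs _ (obsAt_zero.mp hi)]
    · simp only [update_of_ne (Ne.symm hi0)]
      rw [← sum_mul, hG.dec s i hi0 ((obsAt_ne_zero hi0).mp hi)]
  · push Not at ho
    have h1 : ∀ t, P s t * V t ≤ P s t * (G s * F (s 0)) := by
      intro t
      by_cases h : Adj s t
      · refine mul_le_mul_of_nonneg_left ((ih' t h).trans ?_) (hP.nonneg s t)
        rw [hG.adj_dec ho h]
        refine mul_le_mul_of_nonneg_left ?_ (hG.nonneg s)
        by_cases h0 : t 0 = s 0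
        · rw [h0]
        · have hc := (h.zero h0).1
          refine hF.dec _ _ ?_ hc
          cases hk : X.kind (s 0) with
          | terminal => exact absurd ⟨_, hc⟩ ((X.terminal_iff _).mp hk)
          | decision => rfl
          | observation => exact absurd (obsAt_zero.mpr hk) (ho 0)
      · rw [hP.supp s t h, zero_mul, zero_mul]
    refine (sum_le_sum fun t _ => h1 t).trans (le_of_eq ?_)
    rw [← sum_mul, hP.dec s ho hf, one_mul]

/-- The local gains at decision points are bounded. -/
theorem IsValue.abs_sub_le {μ : ℝ} {G : X.Pos k → ℝ} (hG : IsMass μ G) (hμ : μ ≤ 1)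
    {P : X.Pos k → X.Pos k → ℝ} (hP : IsPolicy P) {u : X.Terminal → ℝ} (hu : u ∈ X.utilities)
    {w : X.Node → ℝ} (hw : ∀ z : X.Terminal, w z.1 = u z)
    {V : X.Pos k → ℝ} (hV : IsValue P w G V) {s t : X.Pos k} (hs : ∀ i, ¬ ObsAt s i)
    (h : Adj s t) : |V t - V s| ≤ 2 := by
  obtain ⟨F, F', hF, hF', -, -, hb⟩ := exists_bounds hu hw
  have h1 := fun s => hV.le hG hP hF s
  have h2 := fun s => hV.neg.le hG hP hF' s
  simp only [Pi.neg_apply] at h2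
  have hGs := hG.adj_dec hs h
  have hFt : F (t 0) ≤ F (s 0) ∧ F' (t 0) ≤ F' (s 0) := by
    by_cases h0 : t 0 = s 0
    · rw [h0]; exact ⟨le_rfl, le_rfl⟩
    · have hc := (h.zero h0).1
      have hk : X.kind (s 0) = .decision := by
        cases hk : X.kind (s 0) with
        | terminal => exact absurd ⟨_, hc⟩ ((X.terminal_iff _).mp hk)
        | decision => rfl
        | observation => exact absurd (obsAt_zero.mpr hk) (hs 0)
      exact ⟨hF.dec _ _ hk hc, hF'.dec _ _ hk hc⟩
  have e1 := h1 s
  have e2 := h2 s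
  have e3 := h1 t
  have e4 := h2 t
  rw [hGs] at e3 e4
  have e5 := mul_le_mul_of_nonneg_left hFt.1 (hG.nonneg s)
  have e6 := mul_le_mul_of_nonneg_left hFt.2 (hG.nonneg s)
  have e7 : G s * F (s 0) + G s * F' (s 0) ≤ 2 := by
    rw [← mul_add]
    have := hb (s 0)
    calc G s * (F (s 0) + F' (s 0)) ≤ 1 * 2 :=
          mul_le_mul ((hG.le s).trans hμ) this.2 this.1 zero_le_one
      _ = 2 := by norm_num
  rw [abs_le]
  constructor <;> linarith

/-! The forward flow and the image of a mixed strategy -/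

open Classical in
/-- The probabilities of the positions under a policy. -/
def IsReach (P : X.Pos k → X.Pos k → ℝ) (Q : X.Pos k → ℝ) : Prop :=
  ∀ t, Q t = (if t = (fun _ => 0) then 1 else 0) + ∑ s, P s t * Q s

theorem IsReach.nonneg {P : X.Pos k → X.Pos k → ℝ} (hP : IsPolicy P) {Q : X.Pos k → ℝ}
    (hQ : IsReach P Q) (t : X.Pos k) : 0 ≤ Q t := by
  induction t using WellFoundedLT.induction with
  | ind t ih =>
  rw [hQ t]
  refine add_nonneg (by split_ifs <;> norm_num) (sum_nonneg fun s _ => ?_)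
  by_cases h : Adj s t
  · exact mul_nonneg (hP.nonneg s t) (ih s h.lt)
  · rw [hP.supp s t h, zero_mul]

open Classical in
-- Summation by parts: ∑ Q V is expanded once by the backward equation of V and once by the forward
-- equation of Q.
theorem IsReach.value_root {P : X.Pos k → X.Pos k → ℝ} {Q : X.Pos k → ℝ}
    (hQ : IsReach P Q) {u : X.Node → ℝ} {G V : X.Pos k → ℝ} (hV : IsValue P u G V) :
    V (fun _ => 0) = ∑ s, if Final s then u (s 0) * (Q s * G s) else 0 := by
  have h1 : ∑ s, Q s * V s =
      (∑ s, if Final s then u (s 0) * (Q s * G s) else 0) + ∑ s, ∑ t, Q s * (P s t * V t) := by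
    rw [← sum_add_distrib]
    refine sum_congr rfl fun s _ => ?_
    conv_lhs => rw [hV s]
    rw [mul_add, mul_sum]
    congr 1
    split_ifs <;> ring
  have h2 : ∑ t, Q t * V t = V (fun _ => 0) + ∑ s, ∑ t, Q s * (P s t * V t) := by
    rw [sum_comm]
    have : ∀ t, Q t * V t = (if t = (fun _ => 0) then V t else 0) + ∑ s, Q s * (P s t * V t) := by
      intro t
      conv_lhs => rw [hQ t]
      rw [add_mul, sum_mul]
      congr 1
      · split_ifs <;> simp
      · exact sum_congr rfl fun s _ => by ring
    rw [sum_congr rfl fun t _ => this t, sum_add_distrib]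
    simp
  linarith

open Classical in
/-- The image of a mixed strategy with masses `G` under the deviation given by a policy. -/
noncomputable def imageFlow (P : X.Pos k → X.Pos k → ℝ) (Q G : X.Pos k → ℝ) (v : X.Node) : ℝ :=
  if v = 0 then 1 else ∑ t, ∑ s, if t 0 = v ∧ s 0 ≠ v then P s t * Q s * G t else 0

open Classical in
-- The weight on positions with component 0 at v consists of the weight entering v, which is the
-- image flow, and of the weight moved between such positions by the mediators' components.
theorem IsReach.balance {P : X.Pos k → X.Pos k → ℝ} (hP : IsPolicy P) {Q : X.Pos k → ℝ}
    (hQ : IsReach P Q) {G : X.Pos k → ℝ} (hG : IsMass 1 G) (v : X.Node) :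
    ∑ t : X.Pos k, (if t 0 = v then Q t * G t else 0) = imageFlow P Q G v +
      ∑ t : X.Pos k, ∑ s : X.Pos k, if t 0 = v ∧ s 0 = v then P s t * Q s * G t else 0 := by
  have h1 : ∀ t : X.Pos k, (if t 0 = v then Q t * G t else 0) =
      (if t = (fun _ => 0) then (if v = 0 then 1 else 0) else 0) +
        ∑ s : X.Pos k, ((if t 0 = v ∧ s 0 ≠ v then P s t * Q s * G t else 0) +
          if t 0 = v ∧ s 0 = v then P s t * Q s * G t else 0) := by
    intro t
    by_cases h : t 0 = v
    · conv_lhs => rw [if_pos h, hQ t, add_mul, sum_mul]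
      congr 1
      · by_cases ht : t = fun _ => 0
        · have : v = 0 := by rw [← h, ht]
          rw [if_pos ht, if_pos ht, if_pos this, ht, hG.root, one_mul]
        · simp [ht]
      · refine sum_congr rfl fun s _ => ?_
        by_cases hs : s 0 = v <;> simp [h, hs]
    · have : ¬ (t = (fun _ => 0) ∧ v = 0) := by
        rintro ⟨rfl, rfl⟩; exact h rfl
      have h' : (if t = (fun _ => 0) then (if v = 0 then (1 : ℝ) else 0) else 0) = 0 := by
        by_cases ht : t = (fun _ => 0)
        · rw [if_pos ht, if_neg fun hv => this ⟨ht, hv⟩]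
        · rw [if_neg ht]
      simp [h, h']
  rw [sum_congr rfl fun t _ => h1 t, sum_add_distrib]
  simp only [sum_add_distrib]
  rw [← add_assoc]
  congr 1
  unfold imageFlow
  by_cases hv : v = 0
  · subst hv
    have : ∀ t s : X.Pos k, (if t 0 = 0 ∧ s 0 ≠ 0 then P s t * Q s * G t else 0) = 0 := by
      intro t s
      split_ifs with h
      · rw [hP.supp s t, zero_mul, zero_mul]
        intro hA
        exact (hA.zero (by rw [h.1]; exact Ne.symm h.2)).1.1 h.1
      · rfl
    simp [this]
  · simp [hv]

open Classical in
theorem imageFlow_child {P : X.Pos k → X.Pos k → ℝ} (hP : IsPolicy P) (Q G : X.Pos k → ℝ)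
    {v c : X.Node} (hc : X.IsChild v c) :
    imageFlow P Q G c = ∑ s : X.Pos k, ∑ t : X.Pos k,
      if s 0 = v then (if t 0 = c then P s t * Q s * G t else 0) else 0 := by
  unfold imageFlow
  rw [if_neg hc.1, sum_comm]
  refine sum_congr rfl fun s _ => sum_congr rfl fun t _ => ?_
  by_cases h : Adj s t
  · have : (t 0 = c ∧ s 0 ≠ c) ↔ (s 0 = v ∧ t 0 = c) := by
      constructor
      · rintro ⟨h1, h2⟩
        have := (h.zero (by rw [h1]; exact Ne.symm h2)).1
        rw [h1] at this
        exact ⟨this.2.symm.trans hc.2, h1⟩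
      · rintro ⟨h1, h2⟩
        exact ⟨h2, by rw [h1]; exact hc.lt.ne⟩
    rw [← ite_and]
    simp only [this]
  · simp [hP.supp s t h]

/-- At a decision point of component 0, conservation of mass makes inflow and outflow equal. At an
observation point no moves take place within v, and all the weight there passes to each child. -/
theorem isFlow_imageFlow {P : X.Pos k → X.Pos k → ℝ} (hP : IsPolicy P) {Q : X.Pos k → ℝ}
    (hQ : IsReach P Q) {G : X.Pos k → ℝ} (hG : IsMass 1 G) : X.IsFlow (imageFlow P Q G) where
  nonneg v := by
    unfold imageFlow
    split_ifs
    · norm_num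
    · refine sum_nonneg fun t _ => sum_nonneg fun s _ => ?_
      split_ifs
      · exact mul_nonneg (mul_nonneg (hP.nonneg s t) (hQ.nonneg hP s)) (hG.nonneg t)
      · exact le_rfl
  obs v c hk hc := by
    classical
    have e1 := hQ.balance hP hG v
    -- Component 0 is the first one, so at an observation point it is always the component that
    -- moves.
    have e2 : ∑ t : X.Pos k, ∑ s : X.Pos k,
        (if t 0 = v ∧ s 0 = v then P s t * Q s * G t else 0) = 0 := by
      refine sum_eq_zero fun t _ => sum_eq_zero fun s _ => ?_
      split_ifs with h
      · rw [hP.supp s t, zero_mul, zero_mul]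
        intro hA
        obtain ⟨d, hd, rfl⟩ := (adj_first (i := 0) (obsAt_zero.mpr (by rw [h.2]; exact hk))
          (fun j hj => absurd hj (Fin.not_lt_zero j))).mp hA
        simp only [update_self] at h
        exact hd.lt.ne (by rw [h.1, h.2])
      · rfl
    rw [e2, add_zero] at e1
    rw [← e1, imageFlow_child hP Q G hc]
    refine sum_congr rfl fun s _ => ?_
    by_cases h : s 0 = v
    · have := hP.sum_first (s := s) (i := 0) (obsAt_zero.mpr (by rw [h]; exact hk))
        (fun j hj => absurd hj (Fin.not_lt_zero j)) (fun t => if t 0 = c then Q s * G t else 0)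
      simp only [update_self, hG.zero, h] at this
      rw [sum_ite_eq' (X.children v) c, if_pos (mem_children.mpr hc)] at this
      simp only [h, if_true]
      rw [← this]
      refine sum_congr rfl fun t _ => ?_
      split_ifs <;> ring
    · simp [h]
  dec v hk := by
    classical
    have e1 := hQ.balance hP hG v
    have e2 : ∑ c ∈ X.children v, imageFlow P Q G c =
        ∑ s : X.Pos k, ∑ t : X.Pos k, if s 0 = v ∧ t 0 ≠ v then P s t * Q s * G t else 0 := by
      rw [sum_congr rfl fun c hc => imageFlow_child hP Q G (mem_children.mp hc), sum_comm]
      refine sum_congr rfl fun s _ => ?_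
      rw [sum_comm]
      refine sum_congr rfl fun t _ => ?_
      by_cases h : s 0 = v
      · simp only [h, if_true, true_and]
        rw [sum_ite_eq (X.children v) (t 0)]
        by_cases hA : Adj s t
        · have : t 0 ∈ X.children v ↔ t 0 ≠ v := by
            rw [mem_children]
            constructor
            · intro hc; exact hc.lt.ne'
            · intro ht
              rw [← h] at ht ⊢
              exact (hA.zero ht).1
          simp only [this]
        · simp [hP.supp s t hA]
      · simp [h]
    have e3 : ∑ s : X.Pos k, (if s 0 = v then Q s * G s else 0) =
        ∑ s : X.Pos k, ∑ t : X.Pos k, ((if s 0 = v ∧ t 0 ≠ v then P s t * Q s * G t else 0) +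
          if t 0 = v ∧ s 0 = v then P s t * Q s * G t else 0) := by
      refine sum_congr rfl fun s _ => ?_
      by_cases h : s 0 = v
      · have := hG.sum_policy hP (s := s)
          (fun hf => by have := hf 0; rw [h, hk] at this; cases this) (by rw [h, hk]; simp)
        rw [if_pos h, ← this, mul_sum]
        refine sum_congr rfl fun t _ => ?_
        by_cases ht : t 0 = v <;> simp [h, ht] <;> ring
      · simp [h]
    simp only [sum_add_distrib] at e3
    rw [e2]
    rw [e3, sum_comm (f := fun s t : X.Pos k => if t 0 = v ∧ s 0 = v then P s t * Q s * G t else 0)]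
      at e1
    linarith

open Classical in
-- Once component 0 rests at a leaf, the remaining moves conserve mass, so everything that entered z
-- ends in final positions over z. This identifies the image flow with the terminal sums occurring
-- in the value at the root.
theorem imageFlow_terminal {P : X.Pos k → X.Pos k → ℝ} (hP : IsPolicy P) {Q : X.Pos k → ℝ}
    (hQ : IsReach P Q) {G : X.Pos k → ℝ} (hG : IsMass 1 G) {z : X.Node}
    (hz : X.kind z = .terminal) :
    imageFlow P Q G z = ∑ s : X.Pos k, if Final s ∧ s 0 = z then Q s * G s else 0 := by
  have e1 := hQ.balance hP hG z
  have e3 : ∑ s : X.Pos k, (if s 0 = z then Q s * G s else 0) =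
      (∑ s : X.Pos k, if Final s ∧ s 0 = z then Q s * G s else 0) +
      ∑ s : X.Pos k, ∑ t : X.Pos k, if t 0 = z ∧ s 0 = z then P s t * Q s * G t else 0 := by
    rw [← sum_add_distrib]
    refine sum_congr rfl fun s _ => ?_
    by_cases h : s 0 = z
    · have h1 : ∑ t : X.Pos k, (if t 0 = z ∧ s 0 = z then P s t * Q s * G t else 0) =
          Q s * ∑ t, P s t * G t := by
        rw [mul_sum]
        refine sum_congr rfl fun t _ => ?_
        by_cases hA : Adj s t
        · have : t 0 = z := by
            by_contra ht
            have := (hA.zero (by rw [h]; exact ht)).1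
            rw [h] at this
            exact (X.terminal_iff _).mp hz ⟨_, this⟩
          simp only [this, h, and_self, if_true]
          ring
        · simp [hP.supp s t hA]
      rw [h1]
      by_cases hf : Final s
      · simp [h, hf, hP.final hf]
      · rw [hG.sum_policy hP hf (by rw [h, hz]; simp)]
        simp [h, hf]
    · simp [h]
  rw [e3, sum_comm (f := fun s t : X.Pos k => if t 0 = z ∧ s 0 = z then P s t * Q s * G t else 0)]
    at e1
  linarith

/-! Regret matching -/

open Classical in
/-- The probabilities given by the cumulative regrets `R`. -/
noncomputable def regretPolicy (R : X.Pos k → X.Pos k → ℝ) (s t : X.Pos k) : ℝ :=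
  if Adj s t then
    if ∃ i, ObsAt s i then 1
    else if 0 < ∑ t', (if Adj s t' then R s t' else 0) then
      R s t / ∑ t', (if Adj s t' then R s t' else 0)
    else 1 / ∑ t', (if Adj s t' then 1 else 0)
  else 0

theorem isPolicy_regretPolicy {R : X.Pos k → X.Pos k → ℝ} (hR : ∀ s t, 0 ≤ R s t) :
    IsPolicy (regretPolicy R) where
  nonneg s t := by
    classical
    unfold regretPolicy
    split_ifs with h1 h2 h3
    · norm_num
    · exact div_nonneg (hR s t) h3.le
    · exact div_nonneg zero_le_one (sum_nonneg fun t _ => by split_ifs <;> norm_num)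
    · exact le_rfl
  supp s t h := by simp [regretPolicy, h]
  obs s t h ho := by simp [regretPolicy, h, ho]
  dec s ho hf := by
    classical
    unfold regretPolicy
    have ho' : ¬ ∃ i, ObsAt s i := by push Not; exact ho
    simp only [ho', if_false]
    split_ifs with h
    · rw [← div_self h.ne', sum_div]
      refine sum_congr rfl fun t _ => ?_
      split_ifs <;> simp
    · have hd : (∑ t', (if Adj s t' then (1 : ℝ) else 0)) ≠ 0 := by
        obtain ⟨t, ht⟩ := exists_adj hf
        refine ne_of_gt (sum_pos' (fun t _ => by split_ifs <;> norm_num) ⟨t, mem_univ _, ?_⟩)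
        simp [ht]
      refine Eq.trans ?_ (div_self hd)
      rw [sum_div]
      refine sum_congr rfl fun t _ => ?_
      split_ifs
      · rfl
      · rw [zero_div]

/-- The bound for regret matching: the cumulative regrets are at most `2 √(m T)`. -/
theorem sum_sub_le_of_regretPolicy {R : ℕ → X.Pos k → X.Pos k → ℝ}
    {V : ℕ → X.Pos k → ℝ} {s : X.Pos k} (hs : ∀ i, ¬ ObsAt s i) (hf : ¬ Final s)
    (h0 : ∀ t, R 0 s t = 0)
    (hnext : ∀ τ t, Adj s t → R (τ + 1) s t = max 0 (R τ s t + V τ t - V τ s))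
    (hnn : ∀ τ s t, 0 ≤ R τ s t)
    (hV : ∀ τ, V τ s = ∑ t, regretPolicy (R τ) s t * V τ t)
    (hb : ∀ τ t, Adj s t → |V τ t - V τ s| ≤ 2) (T : ℕ) {t : X.Pos k} (ht : Adj s t) :
    ∑ τ ∈ range T, (V τ t - V τ s) ≤ Real.sqrt (4 * Fintype.card (X.Pos k) * T) := by
  classical
  have ho' : ¬ ∃ i, ObsAt s i := by push Not; exact hs
  -- Blackwell's condition: the gains have mean 0 under the policy, and the regrets are proportional
  -- to it. If their sum is not positive they all vanish.
  have horth : ∀ τ, ∑ t, (if Adj s t then R τ s t * (V τ t - V τ s) else 0) = 0 := by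
    intro τ
    set S := ∑ t', (if Adj s t' then R τ s t' else 0) with hS
    have hP := isPolicy_regretPolicy (hnn τ)
    have h1 : ∑ t, regretPolicy (R τ) s t * (V τ t - V τ s) = 0 := by
      simp only [mul_sub, sum_sub_distrib]
      rw [← hV τ, ← sum_mul, hP.dec s hs hf, one_mul, sub_self]
    by_cases hpos : 0 < S
    · have h2 : ∀ t, (if Adj s t then R τ s t * (V τ t - V τ s) else 0) =
          S * (regretPolicy (R τ) s t * (V τ t - V τ s)) := by
        intro t
        unfold regretPolicy
        by_cases hA : Adj s t
        · simp only [hA, ho', if_true, if_false, ← hS, hpos]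
          field_simp
        · simp [hA]
      rw [sum_congr rfl fun t _ => h2 t, ← mul_sum, h1, mul_zero]
    · have h3 : ∀ t, Adj s t → R τ s t = 0 := by
        intro t hA
        have := single_le_sum (f := fun t' => if Adj s t' then R τ s t' else 0)
          (fun t' _ => by split_ifs; exacts [hnn τ s t', le_rfl]) (mem_univ t)
        simp only [hA, if_true] at this
        exact le_antisymm (this.trans (not_lt.mp hpos)) (hnn τ s t)
      refine sum_eq_zero fun t _ => ?_
      split_ifs with hA
      · rw [h3 t hA, zero_mul]
      · rfl
  -- By orthogonality, and since truncation at 0 does not increase squares, each round adds at most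
  -- 2² per move. The number of moves is bounded crudely by the number of positions.
  have hsq : ∀ T : ℕ, ∑ t, (if Adj s t then R T s t ^ 2 else 0) ≤
      4 * Fintype.card (X.Pos k) * T := by
    intro T
    induction T with
    | zero => simp [h0]
    | succ T ih =>
      have h1 : ∀ t, (if Adj s t then R (T + 1) s t ^ 2 else 0) ≤
          (if Adj s t then R T s t ^ 2 else 0) +
            2 * (if Adj s t then R T s t * (V T t - V T s) else 0) + 4 := by
        intro t
        split_ifs with hA
        · rw [hnext T t hA]
          have h2 := abs_le.mp (hb T t hA)
          have h3 : (V T t - V T s) ^ 2 ≤ 4 := by nlinarith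
          rcases max_cases 0 (R T s t + V T t - V T s) with ⟨h, _⟩ | ⟨h, _⟩
          · rw [h]
            nlinarith [sq_nonneg (R T s t + (V T t - V T s))]
          · rw [h]
            nlinarith
        · norm_num
      refine (sum_le_sum fun t _ => h1 t).trans ?_
      rw [sum_add_distrib, sum_add_distrib, ← mul_sum, horth T]
      simp only [sum_const, card_univ, nsmul_eq_mul]
      push_cast
      linarith
  -- Truncation can only enlarge the recorded regret.
  have hsum : ∀ T : ℕ, ∑ τ ∈ range T, (V τ t - V τ s) ≤ R T s t := by
    intro T
    induction T with
    | zero => simp [h0]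
    | succ T ih =>
      rw [sum_range_succ, hnext T t ht]
      exact le_trans (by linarith) (le_max_right _ _)
  refine (hsum T).trans (Real.le_sqrt_of_sq_le (le_trans ?_ (hsq T)))
  have := single_le_sum (f := fun t' => if Adj s t' then R T s t' ^ 2 else 0)
    (fun t' _ => by split_ifs; exacts [sq_nonneg _, le_rfl]) (mem_univ t)
  simpa [ht] using this

end TreeProblem

/-! Histories of an interleaving -/

namespace Interleaving

open Finset

variable {ι : Type} {P : ι → TreeProblem} {σ : List (State P) → State P}

theorem ObsStep.lt {s t : State P} (ho : IsObs P s) (h : ObsStep P s t) : s < t := by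
  rw [Pi.lt_def]
  obtain ⟨i, hi⟩ := ho
  refine ⟨fun j => ?_, i, ((h i).1 hi).lt⟩
  by_cases hj : (P j).kind (s j) = .observation
  · exact ((h j).1 hj).lt.le
  · exact ((h j).2 hj).ge

theorem DecStep.lt {s t : State P} (h : DecStep P s t) : s < t := by
  rw [Pi.lt_def]
  obtain ⟨i, hi, h⟩ := h
  refine ⟨fun j => ?_, i, hi.lt⟩
  by_cases hj : j = i
  · subst hj; exact hi.lt.le
  · exact (h j hj).ge

/-- States increase along a history, whose latest state is written first. Histories are therefore
repetition-free lists over a finite set, and only finitely many exist. -/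
theorem Reached.nodup (hσ : IsStrategy P σ) {v : List (State P)} (h : Reached P σ v) :
    v.Pairwise (· > ·) := by
  have ext : ∀ {s t : State P} {h : List (State P)}, (s :: h).Pairwise (· > ·) → s < t →
      (t :: s :: h).Pairwise (· > ·) := by
    intro s t h hp hlt
    refine List.pairwise_cons.mpr ⟨fun x hx => ?_, hp⟩
    rcases List.mem_cons.mp hx with rfl | hx
    · exact hlt
    · exact lt_trans ((List.pairwise_cons.mp hp).1 x hx) hlt
  induction h with
  | root => simp
  | obs s t h _ ho hst ih => exact ext ih (hst.lt ho)
  | act s h _ hd ih => exact ext ih (hσ s h hd).lt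

theorem Reached.ne_nil {v : List (State P)} (h : Reached P σ v) : v ≠ [] := by
  cases h <;> simp

theorem reached_singleton {t : State P} : Reached P σ [t] ↔ t = fun _ => 0 := by
  constructor
  · intro h; cases h; rfl
  · rintro rfl; exact .root

variable [Fintype ι] [DecidableEq ι]

theorem finite_reached (hσ : IsStrategy P σ) : {v | Reached P σ v}.Finite := by
  classical
  have : Finite {l : List (State P) // l.Nodup} := inferInstance
  refine Set.Finite.subset (s := {l : List (State P) | l.Nodup}) this ?_
  intro v hv
  exact (Reached.nodup hσ hv).imp fun h => ne_of_gt h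

/-- The current state of a history. -/
def current (v : List (State P)) : State P := v.headD fun _ => 0

open Classical in
/-- The successors of a history under a strategy. -/
noncomputable def next (σ : List (State P) → State P) (v : List (State P)) : Finset (State P) :=
  if IsObs P (current v) then univ.filter (ObsStep P (current v))
  else if IsDec P (current v) then {σ v} else ∅

theorem reached_cons {t : State P} {v : List (State P)} (hv : v ≠ []) :
    Reached P σ (t :: v) ↔ Reached P σ v ∧ t ∈ next σ v := by
  classical
  constructor
  · intro h
    cases h with
    | root => exact absurd rfl hv
    | obs s t h hr ho hst => exact ⟨hr, by simp [next, current, ho, hst]⟩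
    | act s h hr hd => exact ⟨hr, by simp [next, current, hd.1, hd]⟩
  · rintro ⟨hr, ht⟩
    obtain ⟨s, h, rfl⟩ := List.exists_cons_of_ne_nil hv
    unfold next current at ht
    split_ifs at ht with ho hd
    · exact .obs s t h hr ho (by simpa using ht)
    · obtain rfl : t = σ (s :: h) := by simpa using ht
      exact .act s h hr hd
    · simp at ht

/-- The histories that a strategy reaches. -/
noncomputable def histories (hσ : IsStrategy P σ) : Finset (List (State P)) :=
  (finite_reached hσ).toFinset

@[simp] theorem mem_histories (hσ : IsStrategy P σ) {v : List (State P)} :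
    v ∈ histories hσ ↔ Reached P σ v := by
  simp [histories]

/-- A telescoping sum over the histories that a strategy reaches. -/
theorem sum_histories (hσ : IsStrategy P σ) (F : State P → ℝ) :
    ∑ v ∈ histories hσ, (F (current v) - ∑ t ∈ next σ v, F t) = F fun _ => 0 := by
  classical
  set H := histories hσ with hH
  have hroot : [fun _ => 0] ∈ H := by simpa [hH] using Reached.root
  -- Every reached history other than the root arises from exactly one reached history, its tail.
  have h1 : ∑ w ∈ H.erase [fun _ => 0], F (current w) = ∑ v ∈ H, ∑ t ∈ next σ v, F t := by
    rw [← sum_fiberwise_of_maps_to (s := H.erase [fun _ => 0]) (t := H) (g := List.tail)]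
    · refine sum_congr rfl fun v hv => ?_
      have hv' : Reached P σ v := by simpa [hH] using hv
      have : (H.erase [fun _ => 0]).filter (fun w => w.tail = v) =
          (next σ v).image fun t => t :: v := by
        ext w
        simp only [mem_filter, mem_erase, mem_image, hH, mem_histories]
        constructor
        · rintro ⟨⟨_, hw⟩, rfl⟩
          obtain ⟨t, h, rfl⟩ := List.exists_cons_of_ne_nil hw.ne_nil
          exact ⟨t, ((reached_cons hv'.ne_nil).mp hw).2, rfl⟩
        · rintro ⟨t, ht, rfl⟩
          refine ⟨⟨fun h => hv'.ne_nil (List.cons.inj h).2, ?_⟩, rfl⟩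
          exact (reached_cons hv'.ne_nil).mpr ⟨hv', ht⟩
      rw [this, sum_image fun a _ b _ h => (List.cons.inj h).1]
      rfl
    · intro w hw
      simp only [mem_erase, hH, mem_histories] at hw ⊢
      obtain ⟨t, h, rfl⟩ := List.exists_cons_of_ne_nil hw.2.ne_nil
      by_cases hh : h = []
      · subst hh
        exact absurd (by rw [reached_singleton.mp hw.2]) hw.1
      · exact ((reached_cons hh).mp hw.2).1
  rw [sum_sub_distrib, ← h1, ← add_sum_erase _ _ hroot]
  simp [current]

open Classical in
theorem sum_projection (hσ : IsStrategy P σ) (g : State P → ℝ) :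
    ∑ z : ∀ i, (P i).Terminal, projection P σ z * g (fun i => (z i).1) =
      ∑ v ∈ histories hσ,
        if ∀ i, (P i).kind (current v i) = .terminal then g (current v) else 0 := by
  have h1 : ∀ z : ∀ i, (P i).Terminal, projection P σ z =
      ∑ v ∈ histories hσ, if current v = (fun i => (z i).1) then 1 else 0 := by
    intro z
    unfold projection
    have : {v | Reached P σ v ∧ v.head? = some fun i => (z i).1} =
        ((histories hσ).filter fun v => current v = fun i => (z i).1 : Finset _) := by
      ext v
      simp only [Set.mem_ofPred_eq, coe_filter, mem_histories]
      refine and_congr_right fun hv => ?_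
      obtain ⟨t, h, rfl⟩ := List.exists_cons_of_ne_nil hv.ne_nil
      simp [current]
    rw [this, Set.ncard_coe_finset, card_filter]
    push_cast
    rfl
  simp only [h1, sum_mul]
  rw [sum_comm]
  refine sum_congr rfl fun v _ => ?_
  split_ifs with h
  · rw [sum_eq_single (fun i => (⟨current v i, h i⟩ : (P i).Terminal))]
    · simp
    · intro z _ hz
      rw [if_neg, zero_mul]
      intro hc
      exact hz (funext fun i => Subtype.ext (congrFun hc i).symm)
    · simp
  · refine sum_eq_zero fun z _ => ?_
    rw [if_neg, zero_mul]
    intro hc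
    refine h fun i => ?_
    rw [hc]
    exact (z i).2

end Interleaving

/-! ### Competing strategies, measured by potentials on positions -/

namespace TreeProblem

open Function Finset Interleaving

variable {X : TreeProblem} {k : ℕ}

/-- The position of a state. -/
def toPos (s : State (X.mediated k)) : X.Pos k := Fin.cases (s none) fun i => s (some i)

def ofPos (p : X.Pos k) : State (X.mediated k)
  | none => p 0
  | some i => p i.succ

def posEquiv (X : TreeProblem) (k : ℕ) : State (X.mediated k) ≃ X.Pos k where
  toFun := toPos
  invFun := ofPos
  left_inv s := by funext o; cases o <;> rfl
  right_inv p := by funext i; cases i using Fin.cases <;> rfl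

theorem obsAt_toPos_zero {s : State (X.mediated k)} :
    ObsAt (toPos s) 0 ↔ (X.mediated k none).kind (s none) = .observation := by
  unfold ObsAt compKind
  rw [if_pos rfl]
  rfl

theorem obsAt_toPos_succ {s : State (X.mediated k)} {i : Fin k} :
    ObsAt (toPos s) i.succ ↔ (X.mediated k (some i)).kind (s (some i)) = .observation := by
  unfold ObsAt compKind
  rw [if_neg (Fin.succ_ne_zero i)]
  rfl

theorem isObs_iff {s : State (X.mediated k)} :
    IsObs (X.mediated k) s ↔ ∃ i, ObsAt (toPos s) i := by
  constructor
  · rintro ⟨o, ho⟩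
    cases o with
    | none => exact ⟨0, obsAt_toPos_zero.mpr ho⟩
    | some i => exact ⟨i.succ, obsAt_toPos_succ.mpr ho⟩
  · rintro ⟨i, hi⟩
    cases i using Fin.cases with
    | zero => exact ⟨none, obsAt_toPos_zero.mp hi⟩
    | succ i => exact ⟨some i, obsAt_toPos_succ.mp hi⟩

theorem final_iff {s : State (X.mediated k)} :
    (∀ o, (X.mediated k o).kind (s o) = .terminal) ↔ Final (toPos s) := by
  unfold Final
  constructor
  · intro h i
    cases i using Fin.cases with
    | zero => exact h none
    | succ i => exact (NodeKind.swap_eq_terminal _).mp (h (some i))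
  · intro h o
    cases o with
    | none => exact h 0
    | some i => exact (NodeKind.swap_eq_terminal _).mpr (h i.succ)

/-- The simultaneous moves of all components at observation points. -/
def PosObsStep (p q : X.Pos k) : Prop :=
  ∀ i, (ObsAt p i → X.IsChild (p i) (q i)) ∧ (¬ ObsAt p i → q i = p i)

theorem obsStep_iff {s t : State (X.mediated k)} :
    ObsStep (X.mediated k) s t ↔ PosObsStep (toPos s) (toPos t) := by
  constructor
  · intro h i
    cases i using Fin.cases with
    | zero =>
      exact ⟨fun ho => (h none).1 (obsAt_toPos_zero.mp ho),
        fun ho => (h none).2 (mt obsAt_toPos_zero.mpr ho)⟩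
    | succ i =>
      exact ⟨fun ho => (h (some i)).1 (obsAt_toPos_succ.mp ho),
        fun ho => (h (some i)).2 (mt obsAt_toPos_succ.mpr ho)⟩
  · intro h o
    cases o with
    | none =>
      exact ⟨fun ho => (h 0).1 (obsAt_toPos_zero.mpr ho),
        fun ho => (h 0).2 (mt obsAt_toPos_zero.mp ho)⟩
    | some i =>
      exact ⟨fun ho => (h i.succ).1 (obsAt_toPos_succ.mpr ho),
        fun ho => (h i.succ).2 (mt obsAt_toPos_succ.mp ho)⟩

theorem decStep_adj {s t : State (X.mediated k)} (hs : IsDec (X.mediated k) s)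
    (h : DecStep (X.mediated k) s t) : Adj (toPos s) (toPos t) := by
  have hno : ∀ i, ¬ ObsAt (toPos s) i := fun i hi => hs.1 (isObs_iff.mpr ⟨i, hi⟩)
  obtain ⟨o, hc, ht⟩ := h
  cases o with
  | none =>
    refine ⟨0, hc, fun j hj => ?_, .inl hno⟩
    cases j using Fin.cases with
    | zero => exact absurd rfl hj
    | succ j => exact ht (some j) (by simp)
  | some i =>
    refine ⟨i.succ, hc, fun j hj => ?_, .inl hno⟩
    cases j using Fin.cases with
    | zero => exact ht none (by simp)
    | succ j => exact ht (some j) (by rintro h; cases h; exact hj rfl)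

/-- Alternation: a component that has just moved from an observation point is no longer at one, so
moving the components in turn amounts to one simultaneous move. -/
theorem obsAt_update (hX : X.IsStandard) {p : X.Pos k} {i : Fin (k + 1)} (hi : ObsAt p i)
    {c : X.Node} (hc : X.IsChild (p i) c) (j : Fin (k + 1)) :
    ObsAt (update p i c) j ↔ j ≠ i ∧ ObsAt p j := by
  by_cases hj : j = i
  · subst hj
    simp only [ne_eq, not_true, false_and, iff_false]
    have := hX.alternating _ _ hc
    unfold ObsAt compKind at hi ⊢
    simp only [update_self]
    split_ifs at hi ⊢
    · rw [hi] at this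
      rcases this with h | h
      · simp [h]
      · exact h
    · cases h1 : X.kind (p j) <;> cases h2 : X.kind c <;> simp_all [NodeKind.swap]
  · simp [ObsAt, hj]

open Classical in
theorem sum_posObsStep (hX : X.IsStandard) {p : X.Pos k} {i : Fin (k + 1)} (hi : ObsAt p i)
    (F : X.Pos k → ℝ) :
    ∑ q with PosObsStep p q, F q =
      ∑ c ∈ X.children (p i), ∑ q with PosObsStep (update p i c) q, F q := by
  rw [← sum_fiberwise_of_maps_to (t := X.children (p i)) (g := fun q : X.Pos k => q i)]
  · refine sum_congr rfl fun c hc => sum_congr ?_ fun _ _ => rfl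
    rw [mem_children] at hc
    ext q
    simp only [mem_filter, mem_univ, true_and]
    constructor
    · rintro ⟨h, rfl⟩ j
      rw [obsAt_update hX hi hc]
      by_cases hj : j = i
      · subst hj; simp
      · simpa [hj] using h j
    · intro h
      have hqi : q i = c := by
        have := (h i).2 (by rw [obsAt_update hX hi hc]; simp)
        simpa using this
      refine ⟨fun j => ?_, hqi⟩
      by_cases hj : j = i
      · subst hj
        exact ⟨fun _ => by rw [hqi]; exact hc, fun h' => absurd hi h'⟩
      · have := h j
        rw [obsAt_update hX hi hc] at this
        simpa [hj] using this
  · intro q hq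
    simp only [mem_filter, mem_univ, true_and] at hq
    exact mem_children.mpr ((hq i).1 hi)

open Classical in
-- Induction on the number of components at observation points, peeling off the first, transfers an
-- inequality for single moves to simultaneous ones.
theorem sum_posObsStep_le (hX : X.IsStandard) {F : X.Pos k → ℝ}
    (hF : ∀ p i, ObsAt p i → (∀ j, j < i → ¬ ObsAt p j) →
      ∑ c ∈ X.children (p i), F (update p i c) ≤ F p) (p : X.Pos k) :
    ∑ q with PosObsStep p q, F q ≤ F p := by
  induction hn : (univ.filter fun i => ObsAt p i).card using Nat.strong_induction_on generalizing p
    with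
  | _ n ih =>
  by_cases ho : ∃ i, ObsAt p i
  · obtain ⟨i, hi, hm⟩ := exists_first ho
    rw [sum_posObsStep hX hi]
    refine le_trans (sum_le_sum fun c hc => ?_) (hF p i hi hm)
    rw [mem_children] at hc
    refine ih _ ?_ _ rfl
    rw [← hn]
    refine card_lt_card ((ssubset_iff_of_subset fun j hj => ?_).mpr ⟨i, by simpa using hi, ?_⟩)
    · simp only [mem_filter, mem_univ, true_and, obsAt_update hX hi hc] at hj ⊢
      exact hj.2
    · simp [obsAt_update hX hi hc]
  · push Not at ho
    have : univ.filter (fun q => PosObsStep p q) = {p} := by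
      ext q
      simp only [mem_filter, mem_univ, true_and, mem_singleton]
      constructor
      · intro h; funext i; exact (h i).2 (ho i)
      · rintro rfl i; exact ⟨fun h => absurd h (ho i), fun _ => rfl⟩
    rw [this, sum_singleton]

/-- The telescoping sum in terms of positions: `d` bounds the loss at each history. -/
theorem le_sum_histories (hX : X.IsStandard) {σ : List (State (X.mediated k)) → State (X.mediated k)}
    (hσ : IsStrategy (X.mediated k) σ) {F d : X.Pos k → ℝ}
    (hfin : ∀ p, Final p → d p ≤ F p)
    (hobs : ∀ p i, ObsAt p i → (∀ j, j < i → ¬ ObsAt p j) →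
      ∑ c ∈ X.children (p i), F (update p i c) ≤ F p - d p)
    (hd0 : ∀ p, (∃ i, ObsAt p i) → 0 ≤ d p)
    (hdec : ∀ p q, (∀ i, ¬ ObsAt p i) → ¬ Final p → Adj p q → F q ≤ F p - d p) :
    ∑ v ∈ histories hσ, d (toPos (current v)) ≤ F fun _ => 0 := by
  classical
  have h0 : toPos (fun _ => 0 : State (X.mediated k)) = fun _ => 0 := by
    funext i; cases i using Fin.cases <;> rfl
  rw [← h0, ← sum_histories hσ fun s => F (toPos s)]
  refine sum_le_sum fun v _ => ?_
  set s := current v with hs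
  unfold next
  rw [← hs]
  split_ifs with ho hd
  · obtain ⟨i, hi, hm⟩ := exists_first (isObs_iff.mp ho)
    have h2 : ∑ q with PosObsStep (toPos s) q, F q ≤ F (toPos s) - d (toPos s) := by
      rw [sum_posObsStep hX hi]
      refine le_trans (sum_le_sum fun c _ => sum_posObsStep_le hX (fun p i hi hm =>
        (hobs p i hi hm).trans (by linarith [hd0 p ⟨i, hi⟩])) _) (hobs _ i hi hm)
    refine le_trans (le_sub_comm.mp h2) (sub_le_sub_left (le_of_eq ?_) _)
    rw [sum_filter, sum_filter, ← (posEquiv X k).sum_comp]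
    refine sum_congr rfl fun t _ => ?_
    simp only [obsStep_iff]
    rfl
  · rw [sum_singleton]
    obtain ⟨a, h, hv⟩ : ∃ a h, v = a :: h := by
      refine List.exists_cons_of_ne_nil ?_
      rintro rfl
      obtain ⟨hno, o, _⟩ := hd
      have hv := mem_histories hσ |>.mp ‹_›
      exact hv.ne_nil rfl
    have hsa : s = a := by rw [hs, hv]; rfl
    have hA : Adj (toPos s) (toPos (σ v)) := by
      refine decStep_adj hd ?_
      have := hσ a h (hsa ▸ hd)
      rw [hsa, hv]
      exact this
    have := hdec _ _ (fun i hi => hd.1 (isObs_iff.mpr ⟨i, hi⟩)) (fun hf => hf.not_adj hA) hA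
    linarith
  · rw [sum_empty, sub_zero]
    refine hfin _ (final_iff.mp fun o => ?_)
    by_contra hne
    exact hd ⟨ho, o, hne⟩

/-- A strategy reaches each position at most once, so there are few histories. -/
theorem card_histories_le (hX : X.IsStandard)
    {σ : List (State (X.mediated k)) → State (X.mediated k)}
    (hσ : IsStrategy (X.mediated k) σ) :
    ((histories hσ).card : ℝ) ≤ Fintype.card (X.Pos k) := by
  -- `sz` is the number of nodes of a subtree. The potential is the product of the sizes over the
  -- components, which at the root is the number of positions.
  obtain ⟨sz, hsz⟩ := exists_backward (fun (v : X.Node) (F : X.Node → ℝ) =>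
    1 + ∑ c ∈ X.children v, F c) (fun s F G h => by
      rw [sum_congr rfl fun c hc => h c (mem_children.mp hc).lt])
  have h1 : ∀ v, 1 ≤ sz v := by
    intro v
    induction v using WellFoundedGT.induction with
    | ind v ih =>
    rw [hsz v]
    have : 0 ≤ ∑ c ∈ X.children v, sz c :=
      sum_nonneg fun c hc => zero_le_one.trans (ih c (mem_children.mp hc).lt)
    linarith
  have h0 : sz 0 = Fintype.card X.Node := by
    have := sum_children sz
    have h2 : ∑ v, ∑ c ∈ X.children v, sz c = ∑ v, (sz v - 1) :=
      sum_congr rfl fun v _ => by rw [hsz v]; ring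
    rw [h2, sum_sub_distrib, sum_const, nsmul_eq_mul, mul_one] at this
    have : (#(univ : Finset X.Node) : ℝ) = sz 0 := by linarith
    rw [← this]; rfl
  have hupd : ∀ (p : X.Pos k) i c, ∏ j, sz (update p i c j) = sz c * ∏ j ∈ univ.erase i, sz (p j) := by
    intro p i c
    rw [← mul_prod_erase univ _ (mem_univ i), update_self]
    congr 1
    refine prod_congr rfl fun j hj => ?_
    rw [update_of_ne (ne_of_mem_erase hj)]
  have hself : ∀ (p : X.Pos k) i, ∏ j, sz (p j) = sz (p i) * ∏ j ∈ univ.erase i, sz (p j) :=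
    fun p i => (mul_prod_erase univ _ (mem_univ i)).symm
  have hr : ∀ (p : X.Pos k) i, 1 ≤ ∏ j ∈ univ.erase i, sz (p j) := fun p i =>
    prod_induction _ (1 ≤ ·) (fun _ _ => one_le_mul_of_one_le_of_one_le) le_rfl fun j _ => h1 _
  -- Replacing the moving component by all of its children lowers its factor by 1 and the other
  -- factors multiply to at least 1; so each history is paid for with one unit.
  have := le_sum_histories hX hσ (F := fun p => ∏ j, sz (p j)) (d := fun _ => 1)
    (fun p _ => prod_induction _ (1 ≤ ·) (fun _ _ => one_le_mul_of_one_le_of_one_le) le_rfl fun j _ => h1 _)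
    (fun p i _ _ => by
      rw [sum_congr rfl fun c _ => hupd p i c, ← sum_mul, hself p i, hsz (p i)]
      linarith [hr p i])
    (fun _ _ => zero_le_one)
    (fun p q _ _ hA => by
      obtain ⟨i, hc, hq, -⟩ := hA
      rw [eq_update hq]
      rw [hupd p i, hself p i, hsz (p i)]
      have h3 := single_le_sum (f := sz) (fun c _ => zero_le_one.trans (h1 c))
        (mem_children.mpr hc)
      nlinarith [hr p i])
  simpa [h0] using this

/-- The total value of a fixed strategy exceeds that of the policies by at most the sum of the
local regrets. -/
theorem sum_projection_le (hX : X.IsStandard)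
    {σ : List (State (X.mediated k)) → State (X.mediated k)} (hσ : IsStrategy (X.mediated k) σ)
    {P : ℕ → X.Pos k → X.Pos k → ℝ} (hP : ∀ τ, IsPolicy (P τ)) {w : ℕ → X.Node → ℝ}
    {G V : ℕ → X.Pos k → ℝ} (hV : ∀ τ, IsValue (P τ) (w τ) (G τ) (V τ)) {T : ℕ} {B : ℝ}
    (hB : ∀ s t, (∀ i, ¬ ObsAt s i) → ¬ Final s → Adj s t →
      ∑ τ ∈ range T, (V τ t - V τ s) ≤ B) (hB0 : 0 ≤ B) :
    ∑ z : ∀ o, (X.mediated k o).Terminal, projection (X.mediated k) σ z *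
        ∑ τ ∈ range T, w τ (toPos (fun o => (z o).1) 0) * G τ (toPos fun o => (z o).1) ≤
      ∑ τ ∈ range T, V τ (fun _ => 0) + Fintype.card (X.Pos k) * B := by
  classical
  set g : X.Pos k → ℝ := fun p => ∑ τ ∈ range T, w τ (p 0) * G τ p with hg
  have h1 := sum_projection hσ fun s => g (toPos s)
  change ∑ z : ∀ o, (X.mediated k o).Terminal, projection (X.mediated k) σ z *
    g (toPos fun o => (z o).1) ≤ _
  rw [h1]
  have h2 := le_sum_histories hX hσ (F := fun p => ∑ τ ∈ range T, V τ p)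
    -- Payoffs are collected at final positions, observations conserve the value exactly, and a
    -- decision gains at most B over the policies.
    (d := fun p => if Final p then g p else if ∃ i, ObsAt p i then 0 else -B)
    (fun p hf => by
      simp only [hf, if_true, hg]
      refine (sum_congr rfl fun τ _ => ?_).le
      rw [hV τ p, if_pos hf, (hP τ).final hf, add_zero])
    (fun p i hi hm => by
      have hf : ¬ Final p := fun hf => hf.not_obsAt i hi
      have ho : ∃ i, ObsAt p i := ⟨i, hi⟩
      simp only [hf, if_false, ho, if_true, sub_zero]
      rw [sum_comm]
      refine (sum_congr rfl fun τ _ => ?_).le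
      rw [hV τ p, if_neg hf, zero_add, (hP τ).sum_first hi hm])
    (fun p ho => by
      have hf : ¬ Final p := fun hf => by obtain ⟨i, hi⟩ := ho; exact hf.not_obsAt i hi
      simp [hf, ho])
    (fun p q hno hf hA => by
      have ho : ¬ ∃ i, ObsAt p i := by push Not; exact hno
      simp only [hf, ho, if_false]
      have := hB p q hno hf hA
      rw [sum_sub_distrib] at this
      linarith)
  have h3 : ∑ v ∈ histories hσ,
      ((if ∀ o, (X.mediated k o).kind (current v o) = .terminal then g (toPos (current v)) else 0)
        - B) ≤ ∑ τ ∈ range T, V τ fun _ => 0 := by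
    refine le_trans (sum_le_sum fun v _ => ?_) h2
    simp only [final_iff]
    split_ifs <;> linarith
  rw [sum_sub_distrib, sum_const, nsmul_eq_mul] at h3
  have := mul_le_mul_of_nonneg_right (card_histories_le hX hσ) hB0
  linarith

theorem mediatedTerminal_bijective (X : TreeProblem) (k : ℕ) :
    Bijective fun p : X.Terminal × (Fin k → X.Terminal) => X.mediatedTerminal k p.1 p.2 := by
  constructor
  · rintro ⟨z, zs⟩ ⟨z', zs'⟩ h
    have h0 : z = z' := congrFun h none
    have h1 : zs = zs' := by
      funext i
      have : X.toDual (zs i) = X.toDual (zs' i) := congrFun h (some i)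
      have h2 := congrArg Subtype.val this
      exact Subtype.ext h2
    rw [h0, h1]
  · intro f
    refine ⟨(f none, fun i => ⟨(f (some i)).1, (NodeKind.swap_eq_terminal _).mp (f (some i)).2⟩), ?_⟩
    funext o
    cases o <;> rfl

theorem sum_mediatedTerminal (f : (∀ o, (X.mediated k o).Terminal) → ℝ) :
    ∑ z, f z = ∑ z : X.Terminal, ∑ zs : Fin k → X.Terminal, f (X.mediatedTerminal k z zs) := by
  rw [← (mediatedTerminal_bijective X k).sum_comp, Fintype.sum_prod_type]

theorem toPos_mediatedTerminal (z : X.Terminal) (zs : Fin k → X.Terminal) :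
    toPos (fun o => (X.mediatedTerminal k z zs o).1) = Fin.cons z.1 fun i => (zs i).1 := by
  funext i
  cases i using Fin.cases <;> rfl

/-- The gain of a deviation in terms of the masses of a mixed strategy. -/
theorem Mixed.gain_deviation (π : X.Mixed) {u : X.Terminal → ℝ} {w : X.Node → ℝ}
    (hw : ∀ z : X.Terminal, w z.1 = u z) {G : X.Pos k → ℝ}
    (hG : ∀ (z : X.Terminal) (zs : Fin k → X.Terminal), G (Fin.cons z.1 fun i => (zs i).1) =
      ∑ l, π.weight l * ∏ i, (π.strategy l).1 (zs i))
    (q : (∀ o, (X.mediated k o).Terminal) → ℝ) :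
    π.gain u (X.deviation k q) =
      ∑ z : ∀ o, (X.mediated k o).Terminal,
        q z * (w (toPos (fun o => (z o).1) 0) * G (toPos fun o => (z o).1)) -
      ∑ z, u z * ∑ l, π.weight l * (π.strategy l).1 z := by
  rw [sum_mediatedTerminal]
  unfold Mixed.gain pairing deviation
  rw [← sum_sub_distrib]
  refine sum_congr rfl fun z _ => ?_
  simp only [toPos_mediatedTerminal, hG, Fin.cons_zero, hw, Finset.sum_apply, Pi.smul_apply,
    Pi.sub_apply, smul_eq_mul, mul_sub, sum_sub_distrib]
  congr 1
  simp only [mul_sum]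
  rw [sum_comm]
  refine sum_congr rfl fun zs _ => sum_congr rfl fun l _ => by ring

end TreeProblem

/-! Tables of positions in the memory -/

namespace RealRAM

open Finset

namespace Memory

/-- Replace an array. -/
def putN (m : Memory) (A : ℕ) (f : ℕ → ℕ) : Memory :=
  { m with natArr := Function.update m.natArr A f }

def putR (m : Memory) (A : ℕ) (f : ℕ → ℝ) : Memory :=
  { m with realArr := Function.update m.realArr A f }

variable (m : Memory) (A B x : ℕ) (f : ℕ → ℕ) (g : ℕ → ℝ)

@[simp] theorem putN_natVar : (m.putN A f).natVar = m.natVar := rfl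
@[simp] theorem putN_natArr : (m.putN A f).natArr B = if B = A then f else m.natArr B := by
  simp [putN, Function.update_apply]
@[simp] theorem putN_realVar : (m.putN A f).realVar = m.realVar := rfl
@[simp] theorem putN_realArr : (m.putN A f).realArr = m.realArr := rfl
@[simp] theorem putR_natVar : (m.putR A g).natVar = m.natVar := rfl
@[simp] theorem putR_natArr : (m.putR A g).natArr = m.natArr := rfl
@[simp] theorem putR_realVar : (m.putR A g).realVar = m.realVar := rfl
@[simp] theorem putR_realArr : (m.putR A g).realArr B = if B = A then g else m.realArr B := by
  simp [putR, Function.update_apply]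

end Memory

/-! ### Filling arrays by recursion -/

namespace Stmt

/-- Filling an array in ascending order; each entry may depend on the previous ones. -/
theorem den_fillN (x b A : ℕ) (e : Exp .nat) (m : Memory) :
    ∃ f, (count x b (setNA A (.nvar x) e)).den m = (m.setN x (m.natVar b)).putN A f ∧
      ∀ i, i < m.natVar b →
        f i = e.eval ((m.setN x i).putN A fun l => if l < i then f l else m.natArr A l) := by
  have key := den_count (fun j μ => ∃ f, μ = (m.setN x j).putN A f ∧
      (∀ i, j ≤ i → f i = m.natArr A i) ∧ ∀ i, i < j →
        f i = e.eval ((m.setN x i).putN A fun l => if l < i then f l else m.natArr A l))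
    x b (setNA A (.nvar x) e) m
    ⟨m.natArr A, by simp [Memory.putN, Memory.setN], fun _ _ => rfl, fun i hi => by omega⟩ ?_
  · obtain ⟨f, h1, _, h3⟩ := key
    exact ⟨f, h1, h3⟩
  · rintro j hj _ _ ⟨f, rfl, h2, h3⟩
    set v := e.eval ((m.setN x j).putN A f) with hv
    refine ⟨Function.update f j v, ?_, ?_, ?_⟩
    · simp [den, Exp.eval, Memory.setNA, Memory.setN, Memory.putN, writeArr, hv]
    · intro i hi
      rw [Function.update_of_ne (by omega), h2 i (by omega)]
    · intro i hi
      have hfun : (fun l => if l < i then Function.update f j v l else m.natArr A l) =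
          fun l => if l < i then f l else m.natArr A l := by
        funext l
        split_ifs with hl
        · rw [Function.update_of_ne (by omega)]
        · rfl
      rw [hfun]
      by_cases hij : i = j
      · subst hij
        rw [Function.update_self, hv]
        congr 3
        funext l
        split_ifs with hl
        · rfl
        · exact h2 l (by omega)
      · rw [Function.update_of_ne hij]
        exact h3 i (by omega)

theorem den_fillR (x b A : ℕ) (e : Exp .real) (m : Memory) :
    ∃ f, (count x b (setRA A (.nvar x) e)).den m = (m.setN x (m.natVar b)).putR A f ∧
      ∀ i, i < m.natVar b →
        f i = e.eval ((m.setN x i).putR A fun l => if l < i then f l else m.realArr A l) := by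
  have key := den_count (fun j μ => ∃ f, μ = (m.setN x j).putR A f ∧
      (∀ i, j ≤ i → f i = m.realArr A i) ∧ ∀ i, i < j →
        f i = e.eval ((m.setN x i).putR A fun l => if l < i then f l else m.realArr A l))
    x b (setRA A (.nvar x) e) m
    ⟨m.realArr A, by simp [Memory.putR, Memory.setN], fun _ _ => rfl, fun i hi => by omega⟩ ?_
  · obtain ⟨f, h1, _, h3⟩ := key
    exact ⟨f, h1, h3⟩
  · rintro j hj _ _ ⟨f, rfl, h2, h3⟩
    set v := e.eval ((m.setN x j).putR A f) with hv
    refine ⟨Function.update f j v, ?_, ?_, ?_⟩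
    · simp [den, Exp.eval, Memory.setRA, Memory.setN, Memory.putR, writeArr, hv]
    · intro i hi
      rw [Function.update_of_ne (by omega), h2 i (by omega)]
    · intro i hi
      have hfun : (fun l => if l < i then Function.update f j v l else m.realArr A l) =
          fun l => if l < i then f l else m.realArr A l := by
        funext l
        split_ifs with hl
        · rw [Function.update_of_ne (by omega)]
        · rfl
      rw [hfun]
      by_cases hij : i = j
      · subst hij
        rw [Function.update_self, hv]
        congr 3
        funext l
        split_ifs with hl
        · rfl
        · exact h2 l (by omega)
      · rw [Function.update_of_ne hij]
        exact h3 i (by omega)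

end Stmt

/-- The quotient is the number of j with b (j + 1) ≤ e. This replaces the division that the machine
does not offer for natural numbers. -/
theorem count_div (c b e : ℕ) (hb : 0 < b) (he : e / b ≤ c) :
    ∑ j ∈ range c, (if e < b * (j + 1) then 0 else 1) = e / b := by
  have : ∀ j, (if e < b * (j + 1) then 0 else 1) = if j < e / b then 1 else 0 := by
    intro j
    have : e < b * (j + 1) ↔ ¬ j < e / b := by
      rw [not_lt, Nat.lt_iff_add_one_le (m := e), ← Nat.lt_add_one_iff (m := e / b),
        Nat.div_lt_iff_lt_mul hb, mul_comm]
      rfl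
    by_cases h : j < e / b <;> simp [this, h]
  simp only [this]
  rw [← sum_filter, sum_const, smul_eq_mul, mul_one]
  have : (range c).filter (fun j => j < e / b) = range (e / b) := by
    ext j; simp only [mem_filter, mem_range]; omega
  rw [this, card_range]

/-! Abbreviations: variable `0` holds the number `n` of nodes, `3` the number `k + 1` of
components, `4` the number `M = n ^ (k + 1)` of positions, `5` and `6` hold `M ^ 2` and
`M (k + 1)`. -/

/-- Product with a variable. -/
def mulE (b : ℕ) (e : Exp .nat) : Exp .nat := .nsum b 99 e

/-- Quotient by a variable, if it is at most the value of the variable `c`. -/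
def divE (c b : ℕ) (e : Exp .nat) : Exp .nat :=
  .nsum c 98 (.nite (.lt e (mulE b (.nadd (.nvar 98) (.nconst 1)))) (.nconst 0) (.nconst 1))

/-- The index of a pair of positions. -/
def pairE (s t : Exp .nat) : Exp .nat := .nadd (mulE 4 s) t

/-- The component `i` of the position `t`. -/
def compE (t i : Exp .nat) : Exp .nat := .narr 6 (.nadd (mulE 3 t) i)

/-- The component `i` of the position `t` is at an observation point. -/
def obsE (t i : Exp .nat) : Exp .bool :=
  .eq (.narr 1 (compE t i)) (.nite (.eq i (.nconst 0)) (.nconst 1) (.nconst 0))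

theorem eval_mulE (b : ℕ) (e : Exp .nat) (m : Memory) (h : e.readsN 99 = false) :
    Exp.eval (mulE b e) m = m.natVar b * Exp.eval e m := by
  simp [mulE, Exp.eval, Exp.eval_setN e 99 _ h]

theorem eval_divE (c b : ℕ) (e : Exp .nat) (m : Memory) (h : e.readsN 98 = false)
    (hb : 0 < m.natVar b) (he : Exp.eval e m / m.natVar b ≤ m.natVar c) (hb' : b ≠ 98) :
    Exp.eval (divE c b e) m = Exp.eval e m / m.natVar b := by
  rw [← count_div _ _ _ hb he]
  simp only [divE, Exp.eval, Exp.eval_setN e 98 _ h]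
  refine sum_congr rfl fun j _ => ?_
  rw [eval_mulE _ _ _ rfl]
  simp [Exp.eval, hb']

theorem Stmt.den_fillN_entry (x b A : ℕ) (e : Exp .nat) (m : Memory) {i : ℕ}
    (hi : i < m.natVar b) : ((count x b (setNA A (.nvar x) e)).den m).natArr A i =
      e.eval ((m.setN x i).putN A fun l => if l < i then
        ((count x b (setNA A (.nvar x) e)).den m).natArr A l else m.natArr A l) := by
  obtain ⟨f, h1, h2⟩ := den_fillN x b A e m
  rw [h1]
  simpa using h2 i hi

theorem Stmt.den_fillR_entry (x b A : ℕ) (e : Exp .real) (m : Memory) {i : ℕ}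
    (hi : i < m.natVar b) : ((count x b (setRA A (.nvar x) e)).den m).realArr A i =
      e.eval ((m.setN x i).putR A fun l => if l < i then
        ((count x b (setRA A (.nvar x) e)).den m).realArr A l else m.realArr A l) := by
  obtain ⟨f, h1, h2⟩ := den_fillR x b A e m
  rw [h1]
  simpa using h2 i hi

def fillPairFst : Stmt := .count 10 5 (.setNA 3 (.nvar 10) (divE 4 4 (.nvar 10)))

def fillPairSnd : Stmt :=
  .count 10 5 (.setNA 4 (.nvar 10) (.nsub (.nvar 10) (mulE 4 (.narr 3 (.nvar 10)))))

def fillCompPos : Stmt := .count 10 6 (.setNA 5 (.nvar 10) (divE 4 3 (.nvar 10)))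

def fillQuot : Stmt := .count 10 4 (.setNA 12 (.nvar 10) (divE 4 0 (.nvar 10)))

/-- Digit 0 of t in base n is t mod n, and digit i + 1 of t is digit i of t / n, which has already
been stored because its index is smaller. -/
def fillComp : Stmt :=
  .count 10 6 (.setNA 6 (.nvar 10)
    (.nite (.eq (.nsub (.nvar 10) (mulE 3 (.narr 5 (.nvar 10)))) (.nconst 0))
      (.nsub (.narr 5 (.nvar 10)) (mulE 0 (.narr 12 (.narr 5 (.nvar 10)))))
      (.narr 6 (.nadd (mulE 3 (.narr 12 (.narr 5 (.nvar 10))))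
        (.nsub (.nsub (.nvar 10) (mulE 3 (.narr 5 (.nvar 10)))) (.nconst 1))))))

def fillObs : Stmt :=
  .count 10 4 (.setNA 8 (.nvar 10)
    (.nsum 3 30 (.nite (obsE (.nvar 10) (.nvar 30)) (.nconst 1) (.nconst 0))))

def fillFinal : Stmt :=
  .count 10 4 (.setNA 11 (.nvar 10) (.nsum 3 30
    (.nite (.eq (.narr 1 (compE (.nvar 10) (.nvar 30))) (.nconst 2)) (.nconst 0) (.nconst 1))))

/-- The entry counts the components that witness a move: the new node is a child, no other component
changes, and if the position has observation points, the mover is the first of them. Universal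
conditions are expressed as vanishing counts. -/
def fillAdj : Stmt :=
  .count 10 5 (.setNA 7 (.nvar 10) (.nsum 3 30 (.nite
    (.and (.not (.eq (compE (.narr 4 (.nvar 10)) (.nvar 30)) (.nconst 0)))
      (.and (.eq (.narr 0 (compE (.narr 4 (.nvar 10)) (.nvar 30)))
          (compE (.narr 3 (.nvar 10)) (.nvar 30)))
        (.and (.eq (.nsum 3 31 (.nite (.eq (.nvar 31) (.nvar 30)) (.nconst 0)
            (.nite (.eq (compE (.narr 4 (.nvar 10)) (.nvar 31))
              (compE (.narr 3 (.nvar 10)) (.nvar 31))) (.nconst 0) (.nconst 1)))) (.nconst 0))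
          (.not (.and (.lt (.nconst 0) (.narr 8 (.narr 3 (.nvar 10))))
            (.not (.and (obsE (.narr 3 (.nvar 10)) (.nvar 30))
              (.eq (.nsum 3 31 (.nite (.and (.lt (.nvar 31) (.nvar 30))
                (obsE (.narr 3 (.nvar 10)) (.nvar 31))) (.nconst 1) (.nconst 0)))
                (.nconst 0))))))))) (.nconst 1) (.nconst 0))))

def fillTables : Stmt :=
  .seq fillPairFst (.seq fillPairSnd (.seq fillCompPos (.seq fillQuot (.seq fillComp
    (.seq fillObs (.seq fillFinal fillAdj))))))

end RealRAM

/-! ### Numbering of the positions, and correctness of the tables -/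

namespace TreeProblem

open RealRAM Finset

variable {X : TreeProblem} {k : ℕ}

/-- The number of a position. -/
def posCode (s : X.Pos k) : ℕ := finFunctionFinEquiv s

theorem posCode_lt (s : X.Pos k) : posCode s < (X.size + 1) ^ (k + 1) :=
  (finFunctionFinEquiv s).2

theorem posCode_injective : Function.Injective (posCode (X := X) (k := k)) :=
  fun _ _ h => finFunctionFinEquiv.injective (Fin.ext h)

theorem posCode_digit (s : X.Pos k) (i : Fin (k + 1)) :
    posCode s / (X.size + 1) ^ (i : ℕ) % (X.size + 1) = s i := by
  conv_rhs => rw [← finFunctionFinEquiv.symm_apply_apply s]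
  rfl

/-- The numbering is a topological order of the moves, so recursions along moves become fills in
ascending or descending order. -/
theorem posCode_strictMono {s t : X.Pos k} (h : s < t) : posCode s < posCode t := by
  unfold posCode
  rw [finFunctionFinEquiv_apply, finFunctionFinEquiv_apply]
  rw [Pi.lt_def] at h
  obtain ⟨h1, i, hi⟩ := h
  refine sum_lt_sum (fun j _ => Nat.mul_le_mul_right _ (h1 j)) ⟨i, mem_univ _, ?_⟩
  exact Nat.mul_lt_mul_of_pos_right hi (by positivity)

theorem posCode_zero : posCode (fun _ => 0 : X.Pos k) = 0 := by
  unfold posCode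
  rw [finFunctionFinEquiv_apply]
  simp

theorem sum_posCode {M : Type*} [AddCommMonoid M] (f : ℕ → M) :
    ∑ j ∈ range ((X.size + 1) ^ (k + 1)), f j = ∑ s : X.Pos k, f (posCode s) := by
  rw [sum_range]
  exact (finFunctionFinEquiv.sum_comp fun j : Fin ((X.size + 1) ^ (k + 1)) => f j).symm

/-- The memory holds the decision problem and the parameters. -/
structure HoldsInput (X : TreeProblem) (k : ℕ) (m : Memory) : Prop where
  nodes : m.natVar 0 = X.size + 1
  comps : m.natVar 3 = k + 1
  positions : m.natVar 4 = (X.size + 1) ^ (k + 1)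
  pairs : m.natVar 5 = (X.size + 1) ^ (k + 1) * (X.size + 1) ^ (k + 1)
  digits : m.natVar 6 = (k + 1) * (X.size + 1) ^ (k + 1)
  parent : ∀ v : X.Node, m.natArr 0 v = X.parent v
  kind : ∀ v : X.Node, m.natArr 1 v = kindCode (X.kind v)

/-- The memory holds the tables of the positions. -/
structure HoldsTables (X : TreeProblem) (k : ℕ) (m : Memory) : Prop extends HoldsInput X k m where
  comp : ∀ (s : X.Pos k) (i : Fin (k + 1)), m.natArr 6 ((k + 1) * posCode s + (i : ℕ)) = (s i : ℕ)
  obs : ∀ s : X.Pos k, 0 < m.natArr 8 (posCode s) ↔ ∃ i, ObsAt s i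
  final : ∀ s : X.Pos k, m.natArr 11 (posCode s) = 0 ↔ Final s
  adj : ∀ s t : X.Pos k,
    0 < m.natArr 7 ((X.size + 1) ^ (k + 1) * posCode s + posCode t) ↔ Adj s t
  fst : ∀ s t : X.Pos k,
    m.natArr 3 ((X.size + 1) ^ (k + 1) * posCode s + posCode t) = posCode s
  snd : ∀ s t : X.Pos k,
    m.natArr 4 ((X.size + 1) ^ (k + 1) * posCode s + posCode t) = posCode t

theorem kindCode_eq_obs (i : Fin (k + 1)) (v : X.Node) :
    kindCode (X.kind v) = (if (i : ℕ) = 0 then 1 else 0) ↔ X.compKind i v = .observation := by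
  unfold compKind
  by_cases hi : i = 0
  · subst hi
    cases X.kind v <;> simp [kindCode]
  · have : (i : ℕ) ≠ 0 := fun h => hi (Fin.ext h)
    simp only [this, hi, if_false]
    cases X.kind v <;> simp [kindCode, NodeKind.swap]

theorem kindCode_eq_terminal (v : X.Node) :
    kindCode (X.kind v) = 2 ↔ X.kind v = .terminal := by
  cases X.kind v <;> simp [kindCode]

theorem pair_div {M s t : ℕ} (ht : t < M) : (M * s + t) / M = s := by
  rw [Nat.mul_add_div (by omega), Nat.div_eq_of_lt ht, add_zero]

theorem pair_lt {M s t : ℕ} (hs : s < M) (ht : t < M) : M * s + t < M * M := by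
  calc M * s + t < M * s + M := by omega
    _ = M * (s + 1) := by ring
    _ ≤ M * M := Nat.mul_le_mul_left _ hs

theorem HoldsInput.den {m : Memory} (h : HoldsInput X k m) {s : Stmt} (hs : s.ok = true)
    (h0 : s.setsNA 0 = false) (h1 : s.setsNA 1 = false) : HoldsInput X k (s.den m) where
  nodes := by rw [s.den_natVar _ _ (Stmt.setsN_bound hs rfl), h.nodes]
  comps := by rw [s.den_natVar _ _ (Stmt.setsN_bound hs rfl), h.comps]
  positions := by rw [s.den_natVar _ _ (Stmt.setsN_bound hs rfl), h.positions]
  pairs := by rw [s.den_natVar _ _ (Stmt.setsN_bound hs rfl), h.pairs]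
  digits := by rw [s.den_natVar _ _ (Stmt.setsN_bound hs rfl), h.digits]
  parent := by rw [s.den_natArr _ _ h0]; exact h.parent
  kind := by rw [s.den_natArr _ _ h1]; exact h.kind

theorem fillPairFst_entry {m : Memory} (h : HoldsInput X k m) {i : ℕ}
    (hi : i < (X.size + 1) ^ (k + 1) * (X.size + 1) ^ (k + 1)) :
    (fillPairFst.den m).natArr 3 i = i / (X.size + 1) ^ (k + 1) := by
  rw [fillPairFst, Stmt.den_fillN_entry _ _ _ _ _ (by rwa [h.pairs]),
    eval_divE _ _ _ _ rfl (by simp [h.positions]) ?_ (by decide)]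
  · simp [Exp.eval, h.positions]
  · simpa [Exp.eval, h.positions] using (Nat.div_lt_of_lt_mul hi).le

theorem fillPairSnd_entry {m : Memory} (h : HoldsInput X k m)
    (h3 : ∀ i, i < (X.size + 1) ^ (k + 1) * (X.size + 1) ^ (k + 1) →
      m.natArr 3 i = i / (X.size + 1) ^ (k + 1)) {i : ℕ}
    (hi : i < (X.size + 1) ^ (k + 1) * (X.size + 1) ^ (k + 1)) :
    (fillPairSnd.den m).natArr 4 i = i % (X.size + 1) ^ (k + 1) := by
  rw [fillPairSnd, Stmt.den_fillN_entry _ _ _ _ _ (by rwa [h.pairs]), Exp.eval,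
    eval_mulE _ _ _ rfl]
  simp only [Exp.eval, Memory.putN_natVar, Memory.setN_natVar, Memory.putN_natArr, h.positions]
  simp [h3 i hi, Nat.mod_eq_sub_mul_div]

theorem fillCompPos_entry {m : Memory} (h : HoldsInput X k m) {i : ℕ}
    (hi : i < (k + 1) * (X.size + 1) ^ (k + 1)) :
    (fillCompPos.den m).natArr 5 i = i / (k + 1) := by
  rw [fillCompPos, Stmt.den_fillN_entry _ _ _ _ _ (by rwa [h.digits]),
    eval_divE _ _ _ _ rfl (by simp [h.comps]) ?_ (by decide)]
  · simp [Exp.eval, h.comps]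
  · simpa [Exp.eval, h.positions, h.comps] using (Nat.div_lt_of_lt_mul hi).le

theorem fillQuot_entry {m : Memory} (h : HoldsInput X k m) {i : ℕ}
    (hi : i < (X.size + 1) ^ (k + 1)) :
    (fillQuot.den m).natArr 12 i = i / (X.size + 1) := by
  rw [fillQuot, Stmt.den_fillN_entry _ _ _ _ _ (by rwa [h.positions]),
    eval_divE _ _ _ _ rfl (by simp [h.nodes]) ?_ (by decide)]
  · simp [Exp.eval, h.nodes]
  · simpa [Exp.eval, h.positions, h.nodes] using (Nat.div_le_self _ _).trans hi.le

theorem fillComp_entry {m : Memory} (h : HoldsInput X k m)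
    (h5 : ∀ i, i < (k + 1) * (X.size + 1) ^ (k + 1) → m.natArr 5 i = i / (k + 1))
    (h12 : ∀ i, i < (X.size + 1) ^ (k + 1) → m.natArr 12 i = i / (X.size + 1))
    (i : ℕ) (hik : i < k + 1) (t : ℕ) (ht : t < (X.size + 1) ^ (k + 1)) :
    (fillComp.den m).natArr 6 ((k + 1) * t + i) = t / (X.size + 1) ^ i % (X.size + 1) := by
  have hlt : ∀ i t, i < k + 1 → t < (X.size + 1) ^ (k + 1) →
      (k + 1) * t + i < (k + 1) * (X.size + 1) ^ (k + 1) := fun i t hi ht => by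
    calc (k + 1) * t + i < (k + 1) * (t + 1) := by rw [mul_add]; omega
      _ ≤ _ := Nat.mul_le_mul_left _ ht
  have e5 : ((k + 1) * t + i) / (k + 1) = t := pair_div hik
  rw [fillComp, Stmt.den_fillN_entry _ _ _ _ _ (by rw [h.digits]; exact hlt i t hik ht), ← fillComp]
  have e1 : m.natArr 5 ((k + 1) * t + i) = t := by rw [h5 _ (hlt i t hik ht), e5]
  simp [Exp.eval, mulE, h.comps, h.nodes, e1, h12 t ht]
  cases i with
  | zero => simp [Nat.mod_eq_sub_mul_div]
  | succ i =>
    have hdiv : t / (X.size + 1) < (X.size + 1) ^ (k + 1) := (Nat.div_le_self _ _).trans_lt ht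
    -- The entry that is consulted precedes the current one.
    have : (k + 1) * (t / (X.size + 1)) + i < (k + 1) * t + (i + 1) := by
      have := Nat.mul_le_mul_left (k + 1) (Nat.div_le_self t (X.size + 1))
      omega
    simp only [Nat.add_one_ne_zero, if_false, Nat.add_sub_cancel, this, if_true]
    rw [fillComp_entry h h5 h12 i (by omega) _ hdiv, Nat.div_div_eq_div_mul, pow_succ']

theorem ite_pos_iff {p : Prop} [Decidable p] : (0 < if p then 1 else 0) ↔ p := by
  split_ifs <;> simp_all

theorem fillObs_entry {m : Memory} (h : HoldsInput X k m)
    (h6 : ∀ (s : X.Pos k) (i : Fin (k + 1)), m.natArr 6 ((k + 1) * posCode s + (i : ℕ)) = (s i : ℕ))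
    (s : X.Pos k) : 0 < (fillObs.den m).natArr 8 (posCode s) ↔ ∃ i, ObsAt s i := by
  rw [fillObs, Stmt.den_fillN_entry _ _ _ _ _ (by rw [h.positions]; exact posCode_lt s)]
  have hc : ∀ v f, ((m.setN 10 v).putN 8 f).natVar 3 = k + 1 := by simp [h.comps]
  rw [Exp.eval, hc, sum_range]
  rw [sum_pos_iff]
  simp only [mem_univ, true_and]
  refine exists_congr fun i => ?_
  rw [ObsAt, ← kindCode_eq_obs]
  have := h6 s i
  simp [obsE, compE, mulE, Exp.eval, h.comps, this, h.kind]
  exact ite_pos_iff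

theorem fillFinal_entry {m : Memory} (h : HoldsInput X k m)
    (h6 : ∀ (s : X.Pos k) (i : Fin (k + 1)), m.natArr 6 ((k + 1) * posCode s + (i : ℕ)) = (s i : ℕ))
    (s : X.Pos k) : (fillFinal.den m).natArr 11 (posCode s) = 0 ↔ Final s := by
  rw [fillFinal, Stmt.den_fillN_entry _ _ _ _ _ (by rw [h.positions]; exact posCode_lt s)]
  have hc : ∀ v f, ((m.setN 10 v).putN 11 f).natVar 3 = k + 1 := by simp [h.comps]
  rw [Exp.eval, hc, sum_range]
  rw [sum_eq_zero_iff]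
  simp only [mem_univ, true_implies]
  refine forall_congr' fun i => ?_
  rw [← kindCode_eq_terminal]
  have := h6 s i
  simp [compE, mulE, Exp.eval, h.comps, this, h.kind]

theorem fillAdj_entry {m : Memory} (h : HoldsInput X k m)
    (h6 : ∀ (s : X.Pos k) (i : Fin (k + 1)), m.natArr 6 ((k + 1) * posCode s + (i : ℕ)) = (s i : ℕ))
    (h8 : ∀ s : X.Pos k, 0 < m.natArr 8 (posCode s) ↔ ∃ i, ObsAt s i)
    (h3 : ∀ s t : X.Pos k,
      m.natArr 3 ((X.size + 1) ^ (k + 1) * posCode s + posCode t) = posCode s)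
    (h4 : ∀ s t : X.Pos k,
      m.natArr 4 ((X.size + 1) ^ (k + 1) * posCode s + posCode t) = posCode t)
    (s t : X.Pos k) :
    0 < (fillAdj.den m).natArr 7 ((X.size + 1) ^ (k + 1) * posCode s + posCode t) ↔ Adj s t := by
  rw [fillAdj, Stmt.den_fillN_entry _ _ _ _ _
    (by rw [h.pairs]; exact pair_lt (posCode_lt s) (posCode_lt t))]
  have hc : ∀ v f, ((m.setN 10 v).putN 7 f).natVar 3 = k + 1 := by simp [h.comps]
  rw [Exp.eval, hc, sum_range]
  rw [sum_pos_iff]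
  simp only [mem_univ, true_and]
  refine exists_congr fun i => ?_
  have e1 : ∀ j : Fin (k + 1), ObsAt s j ↔
      kindCode (X.kind (s j)) = if (j : ℕ) = 0 then 1 else 0 := fun j => (kindCode_eq_obs _ _).symm
  simp [compE, mulE, obsE, Exp.eval, h.comps, h3, h4, h6, h.kind, h.parent, sum_range]
  rw [ite_pos_iff, h8]
  have e2 : (∀ x, x ≤ k → x < (i : ℕ) →
      ¬ m.natArr 1 (m.natArr 6 ((k + 1) * posCode s + x)) = if x = 0 then 1 else 0) ↔
      ∀ j, j < i → ¬ ObsAt s j := by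
    constructor
    · intro hx j hj
      have := hx j (by omega) hj
      rwa [h6, h.kind, ← e1] at this
    · intro hx x hxk hxi
      have := hx ⟨x, by omega⟩ hxi
      rw [e1] at this
      have h6x := h6 s ⟨x, by omega⟩
      simp only at h6x this
      rwa [h6x, h.kind]
  have e3 := e1 i
  simp only [Fin.val_eq_zero_iff] at e3
  rw [e2, ← e3, IsChild]
  simp only [Fin.val_inj]
  have e4 : (∀ j, ¬ ObsAt s j) ↔ ¬ ∃ j, ObsAt s j := by push Not; rfl
  rw [e4]
  have e5 : (∀ j : Fin (k + 1), ¬ j = i → t j = s j) ↔ ∀ j : Fin (k + 1), j ≠ i → t j = s j := Iff.rfl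
  tauto

theorem holdsTables_fillTables {m : Memory} (h : HoldsInput X k m) :
    HoldsTables X k (fillTables.den m) := by
  have hM : 0 < (X.size + 1) ^ (k + 1) := by positivity
  obtain ⟨m1, e1⟩ : ∃ μ, μ = fillPairFst.den m := ⟨_, rfl⟩
  have H1 : HoldsInput X k m1 := e1 ▸ h.den rfl rfl rfl
  obtain ⟨m2, e2⟩ : ∃ μ, μ = fillPairSnd.den m1 := ⟨_, rfl⟩
  have H2 : HoldsInput X k m2 := e2 ▸ H1.den rfl rfl rfl
  obtain ⟨m3, e3⟩ : ∃ μ, μ = fillCompPos.den m2 := ⟨_, rfl⟩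
  have H3 : HoldsInput X k m3 := e3 ▸ H2.den rfl rfl rfl
  obtain ⟨m4, e4⟩ : ∃ μ, μ = fillQuot.den m3 := ⟨_, rfl⟩
  have H4 : HoldsInput X k m4 := e4 ▸ H3.den rfl rfl rfl
  obtain ⟨m5, e5⟩ : ∃ μ, μ = fillComp.den m4 := ⟨_, rfl⟩
  have H5 : HoldsInput X k m5 := e5 ▸ H4.den rfl rfl rfl
  obtain ⟨m6, e6⟩ : ∃ μ, μ = fillObs.den m5 := ⟨_, rfl⟩
  have H6 : HoldsInput X k m6 := e6 ▸ H5.den rfl rfl rfl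
  obtain ⟨m7, e7⟩ : ∃ μ, μ = fillFinal.den m6 := ⟨_, rfl⟩
  have H7 : HoldsInput X k m7 := e7 ▸ H6.den rfl rfl rfl
  have hden : fillTables.den m = fillAdj.den m7 := by
    rw [e7, e6, e5, e4, e3, e2, e1]; rfl
  rw [hden]
  have a3 : m1.natArr 3 = m7.natArr 3 := by
    rw [e7, Stmt.den_natArr _ _ _ rfl, e6, Stmt.den_natArr _ _ _ rfl, e5,
      Stmt.den_natArr _ _ _ rfl, e4, Stmt.den_natArr _ _ _ rfl, e3, Stmt.den_natArr _ _ _ rfl, e2,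
      Stmt.den_natArr _ _ _ rfl]
  have a4 : m2.natArr 4 = m7.natArr 4 := by
    rw [e7, Stmt.den_natArr _ _ _ rfl, e6, Stmt.den_natArr _ _ _ rfl, e5,
      Stmt.den_natArr _ _ _ rfl, e4, Stmt.den_natArr _ _ _ rfl, e3, Stmt.den_natArr _ _ _ rfl]
  have a6 : m5.natArr 6 = m7.natArr 6 := by
    rw [e7, Stmt.den_natArr _ _ _ rfl, e6, Stmt.den_natArr _ _ _ rfl]
  have h6' : ∀ (s : X.Pos k) (i : Fin (k + 1)),
      m5.natArr 6 ((k + 1) * posCode s + (i : ℕ)) = (s i : ℕ) := by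
    intro s i
    rw [e5, fillComp_entry H4 ?_ ?_ i i.2 _ (posCode_lt s), posCode_digit]
    · intro j hj
      rw [e4, Stmt.den_natArr _ _ _ rfl, e3, fillCompPos_entry H2 hj]
    · intro j hj
      rw [e4, fillQuot_entry H3 hj]
  have h6 : ∀ (s : X.Pos k) (i : Fin (k + 1)),
      m7.natArr 6 ((k + 1) * posCode s + (i : ℕ)) = (s i : ℕ) := a6 ▸ h6'
  have h8 : ∀ s : X.Pos k, 0 < m7.natArr 8 (posCode s) ↔ ∃ i, ObsAt s i := by
    intro s
    rw [e7, Stmt.den_natArr _ _ _ rfl, e6, fillObs_entry H5 h6']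
  have h11 : ∀ s : X.Pos k, m7.natArr 11 (posCode s) = 0 ↔ Final s := by
    intro s
    rw [e7, fillFinal_entry H6]
    rw [e6, Stmt.den_natArr _ _ _ rfl]
    exact h6'
  have h3' : ∀ i, i < (X.size + 1) ^ (k + 1) * (X.size + 1) ^ (k + 1) →
      m1.natArr 3 i = i / (X.size + 1) ^ (k + 1) := fun i hi => e1 ▸ fillPairFst_entry h hi
  have h3 : ∀ s t : X.Pos k,
      m7.natArr 3 ((X.size + 1) ^ (k + 1) * posCode s + posCode t) = posCode s := by
    intro s t
    rw [← a3, h3' _ (pair_lt (posCode_lt s) (posCode_lt t)), pair_div (posCode_lt t)]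
  have h4 : ∀ s t : X.Pos k,
      m7.natArr 4 ((X.size + 1) ^ (k + 1) * posCode s + posCode t) = posCode t := by
    intro s t
    rw [← a4, e2, fillPairSnd_entry H1 h3' (pair_lt (posCode_lt s) (posCode_lt t)),
      Nat.mul_add_mod, Nat.mod_eq_of_lt (posCode_lt t)]
  exact
    { toHoldsInput := H7.den rfl rfl rfl
      comp := by rw [Stmt.den_natArr _ _ _ rfl]; exact h6
      obs := by rw [Stmt.den_natArr _ _ _ rfl]; exact h8
      final := by rw [Stmt.den_natArr _ _ _ rfl]; exact h11
      adj := fun s t => fillAdj_entry H7 h6 h8 h3 h4 s t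
      fst := by rw [Stmt.den_natArr _ _ _ rfl]; exact h3
      snd := by rw [Stmt.den_natArr _ _ _ rfl]; exact h4 }

end TreeProblem

/-! The policy, the reach probabilities and the initial flow -/

namespace RealRAM

def orE (p q : Exp .bool) : Exp .bool := .not (.and (.not p) (.not q))

def fillRegretSum : Stmt :=
  .count 10 4 (.setRA 3 (.nvar 10) (.rsum 4 30
    (.rite (.lt (.nconst 0) (.narr 7 (pairE (.nvar 10) (.nvar 30))))
      (.rarr 2 (pairE (.nvar 10) (.nvar 30))) (.rconst 0))))

def fillDegree : Stmt :=
  .count 10 4 (.setRA 4 (.nvar 10) (.rsum 4 30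
    (.rite (.lt (.nconst 0) (.narr 7 (pairE (.nvar 10) (.nvar 30)))) (.rconst 1) (.rconst 0))))

def fillPolicy : Stmt :=
  .count 10 5 (.setRA 5 (.nvar 10) (.rite (.lt (.nconst 0) (.narr 7 (.nvar 10)))
    (.rite (.lt (.nconst 0) (.narr 8 (.narr 3 (.nvar 10)))) (.rconst 1)
      (.rite (.rlt (.rconst 0) (.rarr 3 (.narr 3 (.nvar 10))))
        (.rdiv (.rarr 2 (.nvar 10)) (.rarr 3 (.narr 3 (.nvar 10))))
        (.rdiv (.rconst 1) (.rarr 4 (.narr 3 (.nvar 10)))))) (.rconst 0)))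

/-- A forward pass in ascending order. The guard on the numbers admits only entries that are already
computed, and it drops no moves. -/
def fillReach : Stmt :=
  .count 10 4 (.setRA 6 (.nvar 10) (.radd
    (.rite (.eq (.nvar 10) (.nconst 0)) (.rconst 1) (.rconst 0))
    (.rsum 4 30 (.rite (.lt (.nvar 30) (.nvar 10))
      (.rmul (.rarr 5 (pairE (.nvar 30) (.nvar 10))) (.rarr 6 (.nvar 30))) (.rconst 0)))))

def computePolicy : Stmt := .seq fillRegretSum (.seq fillDegree (.seq fillPolicy fillReach))

/-- Some sibling has a higher flow, or the same flow and a smaller number. -/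
def beatenE (v : Exp .nat) : Exp .bool :=
  .lt (.nconst 0) (.nsum 0 30 (.nite (.and (.not (.eq (.nvar 30) (.nconst 0)))
    (.and (.eq (.narr 0 (.nvar 30)) (.narr 0 v)) (orE (.rlt (.rarr 9 v) (.rarr 9 (.nvar 30)))
      (.and (.not (.rlt (.rarr 9 (.nvar 30)) (.rarr 9 v))) (.lt (.nvar 30) v)))))
    (.nconst 1) (.nconst 0)))

/-- Parents come first in the numbering, so one pass suffices: a node is played if its parent is
played and the node is not beaten below a decision point. -/
def fillPlayed : Stmt :=
  .count 10 0 (.setNA 9 (.nvar 10) (.nite (.eq (.nvar 10) (.nconst 0)) (.nconst 1)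
    (.nite (.and (.eq (.narr 9 (.narr 0 (.nvar 10))) (.nconst 1))
      (.not (.and (.eq (.narr 1 (.narr 0 (.nvar 10))) (.nconst 0)) (beatenE (.nvar 10)))))
      (.nconst 1) (.nconst 0))))

def fillZero (b A : ℕ) : Stmt := .count 10 b (.setRA A (.nvar 10) (.rconst 0))

def playedToFlow : Stmt :=
  .count 10 0 (.setRA 9 (.nvar 10)
    (.rite (.eq (.narr 9 (.nvar 10)) (.nconst 1)) (.rconst 1) (.rconst 0)))

/-- The search for the minimum starts at the root, which is always played. -/
def minPlayed : Stmt :=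
  .seq (.setR 2 (.rarr 9 (.nconst 0))) (.count 10 0 (.setR 2
    (.rite (.and (.eq (.narr 9 (.nvar 10)) (.nconst 1)) (.rlt (.rarr 9 (.nvar 10)) (.rvar 2)))
      (.rarr 9 (.nvar 10)) (.rvar 2))))

end RealRAM

/-! ### Correctness of the policy, the reach probabilities and the extraction -/

namespace TreeProblem

open RealRAM Finset

variable {X : TreeProblem} {k : ℕ}

def pairArr (m : Memory) (A : ℕ) (s t : X.Pos k) : ℝ :=
  m.realArr A ((X.size + 1) ^ (k + 1) * posCode s + posCode t)

def posArr (m : Memory) (A : ℕ) (s : X.Pos k) : ℝ := m.realArr A (posCode s)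

def nodeArr (m : Memory) (A : ℕ) (v : X.Node) : ℝ := m.realArr A v

theorem HoldsTables.den {m : Memory} (h : HoldsTables X k m) {s : Stmt} (hs : s.ok = true)
    (h0 : s.setsNA 0 = false) (h1 : s.setsNA 1 = false) (h3 : s.setsNA 3 = false)
    (h4 : s.setsNA 4 = false) (h6 : s.setsNA 6 = false) (h7 : s.setsNA 7 = false)
    (h8 : s.setsNA 8 = false) (h11 : s.setsNA 11 = false) : HoldsTables X k (s.den m) where
  toHoldsInput := h.toHoldsInput.den hs h0 h1
  comp := by rw [s.den_natArr _ _ h6]; exact h.comp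
  obs := by rw [s.den_natArr _ _ h8]; exact h.obs
  final := by rw [s.den_natArr _ _ h11]; exact h.final
  adj := by rw [s.den_natArr _ _ h7]; exact h.adj
  fst := by rw [s.den_natArr _ _ h3]; exact h.fst
  snd := by rw [s.den_natArr _ _ h4]; exact h.snd

open Classical in
theorem fillRegretSum_entry {m : Memory} (h : HoldsTables X k m) (s : X.Pos k) :
    posArr (fillRegretSum.den m) 3 s = ∑ t, if Adj s t then pairArr m 2 s t else 0 := by
  rw [posArr, fillRegretSum, Stmt.den_fillR_entry _ _ _ _ _
    (by rw [h.positions]; exact posCode_lt s)]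
  have hc : ∀ v f, ((m.setN 10 v).putR 3 f).natVar 4 = (X.size + 1) ^ (k + 1) := by
    simp [h.positions]
  rw [Exp.eval, hc, sum_posCode (X := X)]
  refine sum_congr rfl fun t _ => ?_
  simp [Exp.eval, pairE, mulE, h.positions, h.adj, pairArr]

open Classical in
theorem fillDegree_entry {m : Memory} (h : HoldsTables X k m) (s : X.Pos k) :
    posArr (fillDegree.den m) 4 s = ∑ t, if Adj s t then 1 else 0 := by
  rw [posArr, fillDegree, Stmt.den_fillR_entry _ _ _ _ _
    (by rw [h.positions]; exact posCode_lt s)]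
  have hc : ∀ v f, ((m.setN 10 v).putR 4 f).natVar 4 = (X.size + 1) ^ (k + 1) := by
    simp [h.positions]
  rw [Exp.eval, hc, sum_posCode (X := X)]
  refine sum_congr rfl fun t _ => ?_
  simp [Exp.eval, pairE, mulE, h.positions, h.adj]

open Classical in
theorem fillPolicy_entry {m : Memory} (h : HoldsTables X k m)
    (h3 : ∀ s : X.Pos k, posArr m 3 s = ∑ t, if Adj s t then pairArr m 2 s t else 0)
    (h4 : ∀ s : X.Pos k, posArr m 4 s = ∑ t, if Adj s t then 1 else 0) (s t : X.Pos k) :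
    pairArr (fillPolicy.den m) 5 s t = regretPolicy (pairArr m 2) s t := by
  rw [pairArr, fillPolicy, Stmt.den_fillR_entry _ _ _ _ _
    (by rw [h.pairs]; exact pair_lt (posCode_lt s) (posCode_lt t))]
  rw [regretPolicy, ← h3, ← h4]
  simp only [Exp.eval, Memory.putR_natArr, Memory.setN_natArr, Memory.setN_natVar, if_true,
    Memory.putR_natVar, h.adj, h.fst, h.obs, Memory.putR_realArr, Memory.setN_realArr]
  simp [pairArr, posArr]

theorem fillReach_isReach {m : Memory} (h : HoldsTables X k m) {P : X.Pos k → X.Pos k → ℝ}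
    (hP : IsPolicy P) (h5 : ∀ s t, pairArr m 5 s t = P s t) :
    IsReach P (posArr (fillReach.den m) 6) := by
  classical
  intro t
  rw [posArr, fillReach, Stmt.den_fillR_entry _ _ _ _ _
    (by rw [h.positions]; exact posCode_lt t), ← fillReach]
  have hc : ∀ v f, ((m.setN 10 v).putR 6 f).natVar 4 = (X.size + 1) ^ (k + 1) := by
    simp [h.positions]
  rw [Exp.eval]
  congr 1
  · have : posCode t = 0 ↔ t = fun _ => 0 := by
      rw [← posCode_injective.eq_iff (b := fun _ => 0), posCode_zero]
    simp [Exp.eval, this]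
  · rw [Exp.eval, hc, sum_posCode (X := X)]
    refine sum_congr rfl fun s _ => ?_
    by_cases hst : posCode s < posCode t
    · have := h5 s t
      rw [pairArr] at this
      simp [Exp.eval, pairE, mulE, h.positions, hst, this, posArr]
    -- Pairs excluded by the guard are not moves, and the policy vanishes on them.
    · have : ¬ Adj s t := fun ha => hst (posCode_strictMono ha.lt)
      simp [Exp.eval, hst, hP.supp s t this]

theorem computePolicy_spec {m : Memory} (h : HoldsTables X k m)
    (hR : ∀ s t : X.Pos k, 0 ≤ pairArr m 2 s t) :
    (∀ s t : X.Pos k, pairArr (computePolicy.den m) 5 s t = regretPolicy (pairArr m 2) s t) ∧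
      IsReach (regretPolicy (pairArr m 2)) (posArr (X := X) (k := k) (computePolicy.den m) 6) := by
  obtain ⟨m1, e1⟩ : ∃ μ, μ = fillRegretSum.den m := ⟨_, rfl⟩
  have H1 : HoldsTables X k m1 := e1 ▸ h.den rfl rfl rfl rfl rfl rfl rfl rfl rfl
  obtain ⟨m2, e2⟩ : ∃ μ, μ = fillDegree.den m1 := ⟨_, rfl⟩
  have H2 : HoldsTables X k m2 := e2 ▸ H1.den rfl rfl rfl rfl rfl rfl rfl rfl rfl
  obtain ⟨m3, e3⟩ : ∃ μ, μ = fillPolicy.den m2 := ⟨_, rfl⟩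
  have H3 : HoldsTables X k m3 := e3 ▸ H2.den rfl rfl rfl rfl rfl rfl rfl rfl rfl
  have hden : computePolicy.den m = fillReach.den m3 := by rw [e3, e2, e1]; rfl
  have a2 : pairArr (X := X) (k := k) m2 2 = pairArr m 2 := by
    unfold pairArr
    rw [e2, Stmt.den_realArr _ _ _ rfl, e1, Stmt.den_realArr _ _ _ rfl]
  have h5 : ∀ s t : X.Pos k, pairArr m3 5 s t = regretPolicy (pairArr m 2) s t := by
    intro s t
    rw [e3, fillPolicy_entry H2, a2]
    · intro s
      rw [a2, ← fillRegretSum_entry h, ← e1]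
      unfold posArr
      rw [e2, Stmt.den_realArr _ _ _ rfl]
    · intro s
      rw [e2, fillDegree_entry H1]
  rw [hden]
  refine ⟨fun s t => ?_, fillReach_isReach H3 (isPolicy_regretPolicy hR) h5⟩
  rw [← h5, pairArr, pairArr, Stmt.den_realArr _ _ _ rfl]

theorem eval_beatenE {m : Memory} (h : HoldsInput X k m) (v : X.Node) (x : ℕ) (hx : x ≠ 30)
    (hv : m.natVar x = v) :
    (beatenE (.nvar x)).eval m ↔ X.Beaten (nodeArr m 9) v := by
  rw [beatenE, Exp.eval, Exp.eval, Exp.eval, h.nodes, sum_range, sum_pos_iff, Beaten]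
  simp only [mem_univ, true_and]
  refine exists_congr fun d => ?_
  rw [Exp.eval]
  classical
  refine Iff.trans ite_pos_iff ?_
  simp only [Exp.eval, orE, Memory.setN_natVar, hx, hv, h.parent, nodeArr, Memory.setN_natArr,
    Memory.setN_realArr, if_true, if_false, Fin.val_inj, Fin.val_fin_lt]
  rw [show ((d : ℕ) = 0) = (d = 0) by simp]
  tauto

open Classical in
theorem fillPlayed_spec {m : Memory} (h : HoldsInput X k m) :
    ∃ a, X.IsAssignment a ∧
      (∀ j c, X.kind j = .decision → X.IsChild j c → nodeArr m 9 c ≤ nodeArr m 9 (a j)) ∧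
      ∀ v : X.Node, (fillPlayed.den m).natArr 9 v = if X.Played a v then 1 else 0 := by
  obtain ⟨a, ha, hb⟩ := X.exists_assignment (nodeArr m 9)
  refine ⟨a, ha, fun j c hj hc => (hb j c hj hc).1, fun v => ?_⟩
  induction v using WellFoundedLT.induction with
  | ind v ih =>
  rw [fillPlayed, Stmt.den_fillN_entry _ _ _ _ _ (by rw [h.nodes]; exact v.2), ← fillPlayed]
  have H : ∀ f, HoldsInput X k ((m.setN 10 v).putN 9 f) := fun f =>
    ⟨by simp [h.nodes], by simp [h.comps], by simp [h.positions], by simp [h.pairs],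
      by simp [h.digits], by simp [h.parent], by simp [h.kind]⟩
  by_cases hv : v = 0
  · subst hv
    simp [Exp.eval, Played.root]
  · have hc : X.IsChild (X.parent v) v := ⟨hv, rfl⟩
    have hlt := X.parent_lt v hv
    have hterm : X.kind (X.parent v) ≠ .terminal := fun ht =>
      (X.terminal_iff _).mp ht ⟨v, hc⟩
    have key : X.Played a v ↔ X.Played a (X.parent v) ∧
        ¬ (X.kind (X.parent v) = .decision ∧ X.Beaten (nodeArr m 9) v) := by
      rcases hk : X.kind (X.parent v) with _ | _ | _
      · rw [hc.played_dec ha hk, ← ((hb _ _ hk hc).2)]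
        simp
      · rw [hc.played_obs ha hk]
        simp
      · exact absurd hk hterm
    have hkc : ∀ κ : NodeKind, kindCode κ = 0 ↔ κ = .decision := by
      intro κ; cases κ <;> simp [kindCode]
    have hB : ∀ f, (beatenE (.nvar 10)).eval ((m.setN 10 v).putN 9 f) ↔
        X.Beaten (nodeArr m 9) v := by
      intro f
      rw [eval_beatenE (H f) v 10 (by decide) (by simp)]
      rfl
    have hltN : (X.parent v : ℕ) < v := hlt
    by_cases hq : X.Played a (X.parent v)
    · simp only [hq, true_and] at key
      simp [Exp.eval, hv, h.parent, h.kind, hltN, ih _ hlt, hB, hkc, hq, key]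
    · simp only [hq, false_and, iff_false] at key
      simp [Exp.eval, hv, h.parent, h.kind, hltN, ih _ hlt, hq, key]

open Classical in
theorem minPlayed_spec {m : Memory} (h : HoldsInput X k m) {a : X.Node → X.Node}
    (h9 : ∀ v : X.Node, m.natArr 9 v = if X.Played a v then 1 else 0) :
    (∃ v, X.Played a v ∧ (minPlayed.den m).realVar 2 = nodeArr m 9 v) ∧
      ∀ v, X.Played a v → (minPlayed.den m).realVar 2 ≤ nodeArr m 9 v := by
  have key := Stmt.den_count (fun j μ => μ.natVar 0 = m.natVar 0 ∧ μ.natArr = m.natArr ∧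
      μ.realArr = m.realArr ∧ (∃ v, X.Played a v ∧ μ.realVar 2 = nodeArr m 9 v) ∧
      ∀ v : X.Node, (v : ℕ) < j → X.Played a v → μ.realVar 2 ≤ nodeArr m 9 v) 10 0
    (.setR 2 (.rite (.and (.eq (.narr 9 (.nvar 10)) (.nconst 1))
      (.rlt (.rarr 9 (.nvar 10)) (.rvar 2))) (.rarr 9 (.nvar 10)) (.rvar 2)))
    ((Stmt.setR 2 (.rarr 9 (.nconst 0))).den m) ?_ ?_
  · obtain ⟨-, -, -, h1, h2⟩ := key
    refine ⟨h1, fun v hv => h2 v ?_ hv⟩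
    rw [Stmt.den_natVar _ _ _ rfl, h.nodes]
    exact v.2
  · exact ⟨by simp [Stmt.den], rfl, rfl, ⟨0, .root, by simp [Stmt.den, Exp.eval, nodeArr]⟩,
      fun v hv => absurd hv (by omega)⟩
  · rintro j hj μ hμ ⟨h0, h1, h2, ⟨v, hv, hv'⟩, h4⟩
    rw [Stmt.den_natVar _ _ _ rfl, h.nodes] at hj
    have ej := h9 ⟨j, hj⟩
    simp only at ej
    refine ⟨by simp [Stmt.den, h0], by simp [Stmt.den, h1], by simp [Stmt.den, h2], ?_, ?_⟩
    · by_cases hc : X.Played a ⟨j, hj⟩ ∧ m.realArr 9 j < μ.realVar 2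
      · exact ⟨⟨j, hj⟩, hc.1, by simp [Stmt.den, Exp.eval, hμ, h1, h2, ej, hc.1, hc.2, nodeArr]⟩
      · refine ⟨v, hv, ?_⟩
        rw [← hv']
        simp [Stmt.den, Exp.eval, hμ, h1, h2, ej]
        intro h5 h6
        exact absurd ⟨h5, h6⟩ hc
    · intro d hd hpd
      by_cases hc : X.Played a ⟨j, hj⟩ ∧ m.realArr 9 j < μ.realVar 2
      · have : ((Stmt.setR 2 (.rite (.and (.eq (.narr 9 (.nvar 10)) (.nconst 1))
          (.rlt (.rarr 9 (.nvar 10)) (.rvar 2))) (.rarr 9 (.nvar 10)) (.rvar 2))).den μ).realVar 2 =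
            m.realArr 9 j := by
          simp [Stmt.den, Exp.eval, hμ, h1, h2, ej, hc.1, hc.2]
        rw [Memory.setN_realVar, this]
        by_cases hdj : (d : ℕ) = j
        · rw [nodeArr, hdj]
        · exact hc.2.le.trans (h4 d (by omega) hpd)
      · have : ((Stmt.setR 2 (.rite (.and (.eq (.narr 9 (.nvar 10)) (.nconst 1))
          (.rlt (.rarr 9 (.nvar 10)) (.rvar 2))) (.rarr 9 (.nvar 10)) (.rvar 2))).den μ).realVar 2 =
            μ.realVar 2 := by
          simp [Stmt.den, Exp.eval, hμ, h1, h2, ej]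
          intro h5 h6
          exact absurd ⟨h5, h6⟩ hc
        rw [Memory.setN_realVar, this]
        by_cases hdj : (d : ℕ) = j
        · obtain rfl : d = ⟨j, hj⟩ := Fin.ext hdj
          exact not_lt.mp fun hlt => hc ⟨hpd, hlt⟩
        · exact h4 d (by omega) hpd

theorem fillZero_spec (b A : ℕ) (m : Memory) {i : ℕ} (hi : i < m.natVar b) :
    ((fillZero b A).den m).realArr A i = 0 := by
  rw [fillZero, Stmt.den_fillR_entry _ _ _ _ _ hi]
  simp [Exp.eval]

open Classical in
theorem playedToFlow_spec {m : Memory} (h : HoldsInput X k m) {a : X.Node → X.Node}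
    (h9 : ∀ v : X.Node, m.natArr 9 v = if X.Played a v then 1 else 0) (v : X.Node) :
    nodeArr (playedToFlow.den m) 9 v = if X.Played a v then 1 else 0 := by
  rw [nodeArr, playedToFlow, Stmt.den_fillR_entry _ _ _ _ _ (by rw [h.nodes]; exact v.2)]
  simp [Exp.eval, h9]

end TreeProblem

/-! Splitting a flow into pure strategies -/

namespace RealRAM

/-- The row of a strategy in the displayed list. -/
def writeRow : Stmt := .count 10 0 (.setNA 2 (.nadd (.nvar 14) (.nvar 10)) (.narr 9 (.nvar 10)))

/-- Real variable 2 is the weight of the strategy within the current flow, and real variable 1 is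
the weight δ of that flow in the average. -/
def writeWeight : Stmt := .setRA 1 (.nvar 2) (.rmul (.rvar 2) (.rvar 1))

def subtractPlayed : Stmt :=
  .count 10 0 (.setRA 9 (.nvar 10) (.rsub (.rarr 9 (.nvar 10))
    (.rite (.eq (.narr 9 (.nvar 10)) (.nconst 1)) (.rvar 2) (.rconst 0))))

/-- The played nodes include the mediators' components of the position. -/
def consistentE (t : Exp .nat) : Exp .bool :=
  .eq (.nsum 3 30 (.nite (.and (.lt (.nconst 0) (.nvar 30))
    (.not (.eq (.narr 9 (compE t (.nvar 30))) (.nconst 1)))) (.nconst 1) (.nconst 0))) (.nconst 0)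

def addMass (A : ℕ) (e : Exp .real) : Stmt :=
  .count 10 4 (.setRA A (.nvar 10)
    (.radd (.rarr A (.nvar 10)) (.rite (consistentE (.nvar 10)) e (.rconst 0))))

def nextRow : Stmt :=
  .seq (.setN 14 (.nadd (.nvar 14) (.nvar 0))) (.setN 2 (.nadd (.nvar 2) (.nconst 1)))

/-- One greedy peeling step. Real array 7 collects the masses of the current flow, and real array 8
those of the whole weighted list. -/
def extractStrategy : Stmt :=
  .seq fillPlayed (.seq minPlayed (.seq writeRow (.seq writeWeight (.seq subtractPlayed
    (.seq (addMass 7 (.rvar 2)) (.seq (addMass 8 (.rmul (.rvar 2) (.rvar 1))) nextRow))))))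

theorem writeRow_spec (m : Memory) (i : ℕ) :
    (writeRow.den m).natArr 2 i = if m.natVar 14 ≤ i ∧ i < m.natVar 14 + m.natVar 0 then
      m.natArr 9 (i - m.natVar 14) else m.natArr 2 i := by
  have key := Stmt.den_count (fun j μ => μ.natVar 14 = m.natVar 14 ∧ μ.natArr 9 = m.natArr 9 ∧
    ∀ i, μ.natArr 2 i = if m.natVar 14 ≤ i ∧ i < m.natVar 14 + j then
      m.natArr 9 (i - m.natVar 14) else m.natArr 2 i) 10 0
    (.setNA 2 (.nadd (.nvar 14) (.nvar 10)) (.narr 9 (.nvar 10))) m ?_ ?_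
  · exact key.2.2 i
  · refine ⟨by simp, by simp, fun i => ?_⟩
    rw [if_neg (by omega)]
    simp
  · rintro j hj μ hμ ⟨h1, h2, h3⟩
    refine ⟨by simp [Stmt.den, h1], by funext; simp [Stmt.den, h2], fun i => ?_⟩
    simp only [Stmt.den, Exp.eval, h1, h2, hμ, Memory.setN_natArr, Memory.setNA_natArr, true_and, h3]
    by_cases hi : i = m.natVar 14 + j
    · subst hi; simp
    · rw [if_neg hi]
      have : (m.natVar 14 ≤ i ∧ i < m.natVar 14 + j) ↔
        (m.natVar 14 ≤ i ∧ i < m.natVar 14 + (j + 1)) := by omega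
      simp only [this]

end RealRAM

/-! ### Correctness of one peeling step -/

namespace TreeProblem

open RealRAM Finset

variable {X : TreeProblem} {k : ℕ}

open Classical in
theorem subtractPlayed_spec {m : Memory} (h : HoldsInput X k m) {a : X.Node → X.Node}
    (h9 : ∀ v : X.Node, m.natArr 9 v = if X.Played a v then 1 else 0) (v : X.Node) :
    nodeArr (subtractPlayed.den m) 9 v =
      nodeArr m 9 v - if X.Played a v then m.realVar 2 else 0 := by
  rw [nodeArr, subtractPlayed, Stmt.den_fillR_entry _ _ _ _ _ (by rw [h.nodes]; exact v.2)]
  simp [Exp.eval, h9, nodeArr]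

open Classical in
theorem addMass_spec {m : Memory} (h : HoldsTables X k m) {a : X.Node → X.Node}
    (h9 : ∀ v : X.Node, m.natArr 9 v = if X.Played a v then 1 else 0) (A : ℕ) (e : Exp .real)
    (w : ℝ) (he : ∀ x f, e.eval ((m.setN 10 x).putR A f) = w) (s : X.Pos k) :
    posArr ((addMass A e).den m) A s =
      posArr m A s + if ∀ i, i ≠ 0 → X.Played a (s i) then w else 0 := by
  rw [posArr, addMass, Stmt.den_fillR_entry _ _ _ _ _ (by rw [h.positions]; exact posCode_lt s)]
  have hE : ∀ f, (consistentE (.nvar 10)).eval ((m.setN 10 (posCode s)).putR A f) ↔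
      ∀ i, i ≠ 0 → X.Played a (s i) := by
    intro f
    have hc : ((m.setN 10 (posCode s)).putR A f).natVar 3 = k + 1 := by simp [h.comps]
    change Finset.sum (range (((m.setN 10 (posCode s)).putR A f).natVar 3)) _ = 0 ↔ _
    rw [hc, sum_range]
    refine sum_eq_zero_iff.trans ?_
    simp only [mem_univ, true_implies]
    refine forall_congr' fun i => ?_
    simp [Exp.eval, compE, mulE, h.comps, h.comp, h9, Nat.pos_iff_ne_zero]
  simp [Exp.eval, hE, he, posArr]

/-- The list of strategies that has been written. -/
structure HoldsRows (X : TreeProblem) (m : Memory) : Prop where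
  offset : m.natVar 14 = m.natVar 2 * (X.size + 1)
  weight : ∀ j, j < m.natVar 2 → 0 ≤ m.realArr 1 j
  row : ∀ j, j < m.natVar 2 → ∃ a, X.IsAssignment a ∧ ∀ v : X.Node,
    (X.Played a v → m.natArr 2 (j * (X.size + 1) + v) = 1) ∧
      (¬ X.Played a v → m.natArr 2 (j * (X.size + 1) + v) = 0)

/-- Like `rowMass`, this is read off from the displayed rows, and so ties the internal arrays to the
mixed strategy that is actually played. At the root it is the total weight. -/
def rowFlow (X : TreeProblem) (m : Memory) (v : X.Node) : ℝ :=
  ∑ j ∈ range (m.natVar 2), m.realArr 1 j * m.natArr 2 (j * (X.size + 1) + v)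

open Classical in
noncomputable def rowMass (m : Memory) (s : X.Pos k) : ℝ :=
  ∑ j ∈ range (m.natVar 2), m.realArr 1 j *
    if ∀ i, i ≠ 0 → m.natArr 2 (j * (X.size + 1) + s i) = 1 then 1 else 0

open Classical in
theorem extractStrategy_spec {m : Memory} (h : HoldsTables X k m) (hr : HoldsRows X m)
    (hY : X.IsFlow (nodeArr m 9)) (h1 : 0 ≤ m.realVar 1) :
    ∃ a v₀, X.IsAssignment a ∧ X.Played a v₀ ∧
      (∀ j c, X.kind j = .decision → X.IsChild j c → nodeArr m 9 c ≤ nodeArr m 9 (a j)) ∧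
      (∀ v, X.Played a v → nodeArr m 9 v₀ ≤ nodeArr m 9 v) ∧
      (∀ v, nodeArr (extractStrategy.den m) 9 v =
        nodeArr m 9 v - if X.Played a v then nodeArr m 9 v₀ else 0) ∧
      (∀ s : X.Pos k, posArr (extractStrategy.den m) 7 s =
        posArr m 7 s + if ∀ i, i ≠ 0 → X.Played a (s i) then nodeArr m 9 v₀ else 0) ∧
      (∀ s : X.Pos k, posArr (extractStrategy.den m) 8 s = posArr m 8 s +
        if ∀ i, i ≠ 0 → X.Played a (s i) then nodeArr m 9 v₀ * m.realVar 1 else 0) ∧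
      HoldsRows X (extractStrategy.den m) ∧
      (∀ v, rowFlow X (extractStrategy.den m) v =
        rowFlow X m v + if X.Played a v then nodeArr m 9 v₀ * m.realVar 1 else 0) ∧
      ∀ s : X.Pos k, rowMass (extractStrategy.den m) s = rowMass m s +
        if ∀ i, i ≠ 0 → X.Played a (s i) then nodeArr m 9 v₀ * m.realVar 1 else 0 := by
  obtain ⟨m1, e1⟩ : ∃ μ, μ = Stmt.den fillPlayed m := ⟨_, rfl⟩
  have H1 : HoldsTables X k m1 := e1 ▸ h.den rfl rfl rfl rfl rfl rfl rfl rfl rfl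
  obtain ⟨m2, e2⟩ : ∃ μ, μ = Stmt.den minPlayed m1 := ⟨_, rfl⟩
  have H2 : HoldsTables X k m2 := e2 ▸ H1.den rfl rfl rfl rfl rfl rfl rfl rfl rfl
  obtain ⟨m3, e3⟩ : ∃ μ, μ = Stmt.den writeRow m2 := ⟨_, rfl⟩
  have H3 : HoldsTables X k m3 := e3 ▸ H2.den rfl rfl rfl rfl rfl rfl rfl rfl rfl
  obtain ⟨m4, e4⟩ : ∃ μ, μ = Stmt.den writeWeight m3 := ⟨_, rfl⟩
  have H4 : HoldsTables X k m4 := e4 ▸ H3.den rfl rfl rfl rfl rfl rfl rfl rfl rfl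
  obtain ⟨m5, e5⟩ : ∃ μ, μ = Stmt.den subtractPlayed m4 := ⟨_, rfl⟩
  have H5 : HoldsTables X k m5 := e5 ▸ H4.den rfl rfl rfl rfl rfl rfl rfl rfl rfl
  obtain ⟨m6, e6⟩ : ∃ μ, μ = Stmt.den (addMass 7 (.rvar 2)) m5 := ⟨_, rfl⟩
  have H6 : HoldsTables X k m6 := e6 ▸ H5.den rfl rfl rfl rfl rfl rfl rfl rfl rfl
  obtain ⟨m7, e7⟩ : ∃ μ, μ = Stmt.den (addMass 8 (.rmul (.rvar 2) (.rvar 1))) m6 := ⟨_, rfl⟩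
  have H7 : HoldsTables X k m7 := e7 ▸ H6.den rfl rfl rfl rfl rfl rfl rfl rfl rfl
  obtain ⟨m8, e8⟩ : ∃ μ, μ = Stmt.den nextRow m7 := ⟨_, rfl⟩
  have H8 : HoldsTables X k m8 := e8 ▸ H7.den rfl rfl rfl rfl rfl rfl rfl rfl rfl
  have hden : extractStrategy.den m = m8 := by rw [e8, e7, e6, e5, e4, e3, e2, e1]; rfl
  rw [hden]
  obtain ⟨a, ha, hmax, h9⟩ := fillPlayed_spec h.toHoldsInput
  rw [← e1] at h9
  have c9 : m2.natArr 9 = m1.natArr 9 := by rw [e2, Stmt.den_natArr _ _ _ rfl]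
  have c9' : m4.natArr 9 = m1.natArr 9 := by rw [e4, Stmt.den_natArr _ _ _ rfl, e3, Stmt.den_natArr _ _ _ rfl, e2, Stmt.den_natArr _ _ _ rfl]
  have c9b : m5.natArr 9 = m1.natArr 9 := by rw [e5, Stmt.den_natArr _ _ _ rfl, e4, Stmt.den_natArr _ _ _ rfl, e3, Stmt.den_natArr _ _ _ rfl, e2, Stmt.den_natArr _ _ _ rfl]
  have c9c : m6.natArr 9 = m1.natArr 9 := by rw [e6, Stmt.den_natArr _ _ _ rfl, e5, Stmt.den_natArr _ _ _ rfl, e4, Stmt.den_natArr _ _ _ rfl, e3, Stmt.den_natArr _ _ _ rfl, e2, Stmt.den_natArr _ _ _ rfl]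
  have cY : m1.realArr 9 = m.realArr 9 := by rw [e1, Stmt.den_realArr _ _ _ rfl]
  have cY' : m4.realArr 9 = m.realArr 9 := by rw [e4, Stmt.den_realArr _ _ _ rfl, e3, Stmt.den_realArr _ _ _ rfl, e2, Stmt.den_realArr _ _ _ rfl, e1, Stmt.den_realArr _ _ _ rfl]
  have cYb : m8.realArr 9 = m5.realArr 9 := by rw [e8, Stmt.den_realArr _ _ _ rfl, e7, Stmt.den_realArr _ _ _ rfl, e6, Stmt.den_realArr _ _ _ rfl]
  have w4 : m4.realVar 2 = m2.realVar 2 := by rw [e4, Stmt.den_realVar _ _ _ rfl, e3, Stmt.den_realVar _ _ _ rfl]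
  have w3 : m3.realVar 2 = m2.realVar 2 := by rw [e3, Stmt.den_realVar _ _ _ rfl]
  have w5 : m5.realVar 2 = m2.realVar 2 := by rw [e5, Stmt.den_realVar _ _ _ rfl, e4, Stmt.den_realVar _ _ _ rfl, e3, Stmt.den_realVar _ _ _ rfl]
  have w6 : m6.realVar 2 = m2.realVar 2 := by rw [e6, Stmt.den_realVar _ _ _ rfl, e5, Stmt.den_realVar _ _ _ rfl, e4, Stmt.den_realVar _ _ _ rfl, e3, Stmt.den_realVar _ _ _ rfl]
  have l3 : m3.realVar 1 = m.realVar 1 := by rw [e3, Stmt.den_realVar _ _ _ rfl, e2, Stmt.den_realVar _ _ _ rfl, e1, Stmt.den_realVar _ _ _ rfl]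
  have l6 : m6.realVar 1 = m.realVar 1 := by rw [e6, Stmt.den_realVar _ _ _ rfl, e5, Stmt.den_realVar _ _ _ rfl, e4, Stmt.den_realVar _ _ _ rfl, e3, Stmt.den_realVar _ _ _ rfl, e2, Stmt.den_realVar _ _ _ rfl, e1, Stmt.den_realVar _ _ _ rfl]
  have g5 : m5.realArr 7 = m.realArr 7 := by rw [e5, Stmt.den_realArr _ _ _ rfl, e4, Stmt.den_realArr _ _ _ rfl, e3, Stmt.den_realArr _ _ _ rfl, e2, Stmt.den_realArr _ _ _ rfl, e1, Stmt.den_realArr _ _ _ rfl]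
  have g8 : m8.realArr 7 = m6.realArr 7 := by rw [e8, Stmt.den_realArr _ _ _ rfl, e7, Stmt.den_realArr _ _ _ rfl]
  have t6 : m6.realArr 8 = m.realArr 8 := by rw [e6, Stmt.den_realArr _ _ _ rfl, e5, Stmt.den_realArr _ _ _ rfl, e4, Stmt.den_realArr _ _ _ rfl, e3, Stmt.den_realArr _ _ _ rfl, e2, Stmt.den_realArr _ _ _ rfl, e1, Stmt.den_realArr _ _ _ rfl]
  have t8 : m8.realArr 8 = m7.realArr 8 := by rw [e8, Stmt.den_realArr _ _ _ rfl]
  have r2 : m2.natArr 2 = m.natArr 2 := by rw [e2, Stmt.den_natArr _ _ _ rfl, e1, Stmt.den_natArr _ _ _ rfl]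
  have r8 : m8.natArr 2 = m3.natArr 2 := by rw [e8, Stmt.den_natArr _ _ _ rfl, e7, Stmt.den_natArr _ _ _ rfl, e6, Stmt.den_natArr _ _ _ rfl, e5, Stmt.den_natArr _ _ _ rfl, e4, Stmt.den_natArr _ _ _ rfl]
  have x3 : m3.realArr 1 = m.realArr 1 := by rw [e3, Stmt.den_realArr _ _ _ rfl, e2, Stmt.den_realArr _ _ _ rfl, e1, Stmt.den_realArr _ _ _ rfl]
  have x8 : m8.realArr 1 = m4.realArr 1 := by rw [e8, Stmt.den_realArr _ _ _ rfl, e7, Stmt.den_realArr _ _ _ rfl, e6, Stmt.den_realArr _ _ _ rfl, e5, Stmt.den_realArr _ _ _ rfl]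
  have n2 : m3.natVar 2 = m.natVar 2 := by rw [e3, Stmt.den_natVar _ _ _ rfl, e2, Stmt.den_natVar _ _ _ rfl, e1, Stmt.den_natVar _ _ _ rfl]
  have n7 : m7.natVar 2 = m.natVar 2 := by rw [e7, Stmt.den_natVar _ _ _ rfl, e6, Stmt.den_natVar _ _ _ rfl, e5, Stmt.den_natVar _ _ _ rfl, e4, Stmt.den_natVar _ _ _ rfl, e3, Stmt.den_natVar _ _ _ rfl, e2, Stmt.den_natVar _ _ _ rfl, e1, Stmt.den_natVar _ _ _ rfl]
  have o2 : m2.natVar 14 = m.natVar 14 := by rw [e2, Stmt.den_natVar _ _ _ rfl, e1, Stmt.den_natVar _ _ _ rfl]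
  have o7 : m7.natVar 14 = m.natVar 14 := by rw [e7, Stmt.den_natVar _ _ _ rfl, e6, Stmt.den_natVar _ _ _ rfl, e5, Stmt.den_natVar _ _ _ rfl, e4, Stmt.den_natVar _ _ _ rfl, e3, Stmt.den_natVar _ _ _ rfl, e2, Stmt.den_natVar _ _ _ rfl, e1, Stmt.den_natVar _ _ _ rfl]
  have nY : nodeArr (X := X) m1 9 = nodeArr m 9 := by unfold nodeArr; rw [cY]
  obtain ⟨⟨v₀, hv₀, hw⟩, hmin⟩ := minPlayed_spec H1.toHoldsInput h9
  rw [← e2, nY] at hw hmin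
  rw [hw] at hmin
  have hw0 : 0 ≤ nodeArr m 9 v₀ := hY.nonneg v₀
  have N8 : m8.natVar 2 = m.natVar 2 + 1 := by
    rw [← n7, e8]; simp [nextRow, Stmt.den, Exp.eval]
  have O8 : m8.natVar 14 = m.natVar 14 + (X.size + 1) := by
    rw [← o7, ← H7.nodes, e8]; simp [nextRow, Stmt.den, Exp.eval]
  have X8 : ∀ j, m8.realArr 1 j =
      if j = m.natVar 2 then nodeArr m 9 v₀ * m.realVar 1 else m.realArr 1 j := by
    intro j
    rw [x8, e4]
    simp [writeWeight, Stmt.den, Exp.eval, n2, x3, w3, hw, l3]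
  have R8 : ∀ i, m8.natArr 2 i = if m.natVar 14 ≤ i ∧ i < m.natVar 14 + (X.size + 1) then
      m1.natArr 9 (i - m.natVar 14) else m.natArr 2 i := by
    intro i
    rw [r8, e3, writeRow_spec, o2, H2.nodes, c9, r2]
  -- Each row occupies n consecutive places, so writing a new row leaves the earlier ones intact.
  have Rold : ∀ j, j < m.natVar 2 → ∀ v : X.Node,
      m8.natArr 2 (j * (X.size + 1) + v) = m.natArr 2 (j * (X.size + 1) + v) := by
    intro j hj v
    rw [R8, if_neg]
    rw [hr.offset]
    have := Nat.mul_le_mul_right (X.size + 1) (Nat.succ_le_of_lt hj)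
    have hv := v.2
    rw [Nat.succ_mul] at this
    omega
  have Rnew : ∀ v : X.Node, m8.natArr 2 (m.natVar 2 * (X.size + 1) + v) =
      if X.Played a v then 1 else 0 := by
    intro v
    rw [R8, hr.offset, if_pos ⟨by omega, by have := v.2; omega⟩, Nat.add_sub_cancel_left, h9]
  refine ⟨a, v₀, ha, hv₀, hmax, hmin, ?_, ?_, ?_, ⟨?_, ?_, ?_⟩, ?_, ?_⟩
  · intro v
    have := subtractPlayed_spec H4.toHoldsInput (a := a) (by rw [c9']; exact h9) v
    rw [← e5, nodeArr, nodeArr, cY', w4, hw] at this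
    rw [nodeArr, cYb, this]
    rfl
  · intro s
    have := addMass_spec H5 (a := a) (by rw [c9b]; exact h9) 7 (.rvar 2) (nodeArr m 9 v₀)
      (fun x f => by simp [Exp.eval, w5, hw]) s
    rw [← e6, posArr, posArr, g5] at this
    rw [posArr, g8, this]
    rfl
  · intro s
    have := addMass_spec H6 (a := a) (by rw [c9c]; exact h9) 8 (.rmul (.rvar 2) (.rvar 1))
      (nodeArr m 9 v₀ * m.realVar 1) (fun x f => by simp [Exp.eval, w6, hw, l6]) s
    rw [← e7, posArr, posArr, t6] at this
    rw [posArr, t8, this]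
    rfl
  · rw [O8, N8, hr.offset]; ring
  · intro j hj
    rw [X8]
    split_ifs with hjr
    · exact mul_nonneg hw0 h1
    · exact hr.weight j (by omega)
  · intro j hj
    by_cases hjr : j = m.natVar 2
    · subst hjr
      exact ⟨a, ha, fun v => ⟨fun hv => by rw [Rnew, if_pos hv], fun hv => by rw [Rnew, if_neg hv]⟩⟩
    · obtain ⟨b, hb, hb'⟩ := hr.row j (by omega)
      exact ⟨b, hb, fun v => by rw [Rold j (by omega)]; exact hb' v⟩
  · intro v
    rw [rowFlow, N8, sum_range_succ, rowFlow]
    congr 1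
    · refine sum_congr rfl fun j hj => ?_
      rw [mem_range] at hj
      rw [Rold j hj, X8, if_neg (by omega)]
    · rw [X8, if_pos rfl, Rnew]
      split_ifs <;> simp
  · intro s
    rw [rowMass, N8, sum_range_succ, rowMass]
    congr 1
    · refine sum_congr rfl fun j hj => ?_
      rw [mem_range] at hj
      simp only [Rold j hj]
      rw [X8, if_neg (by omega)]
    · rw [X8, if_pos rfl]
      simp only [Rnew]
      have : (∀ i, i ≠ 0 → (if X.Played a (s i) then 1 else 0) = 1) ↔
        ∀ i, i ≠ 0 → X.Played a (s i) := forall_congr' fun i => by simp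
      rw [mul_ite, mul_one, mul_zero]
      exact if_congr this rfl rfl

end TreeProblem

/-! The computation of an approximate fixed point -/

namespace RealRAM

/-- As many rounds as there are nodes exhaust the flow, since each of them kills an entry;
superfluous rounds append rows of weight 0. -/
def splitFlow : Stmt := .seq (fillZero 4 7) (.count 13 0 extractStrategy)

/-- The flow of the image under the deviation. -/
def imageOfFlow : Stmt :=
  .count 10 0 (.setRA 9 (.nvar 10) (.rite (.eq (.nvar 10) (.nconst 0)) (.rconst 1)
    (.rsum 4 30 (.rsum 4 31 (.rite
      (.and (.eq (compE (.nvar 30) (.nconst 0)) (.nvar 10))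
        (.not (.eq (compE (.nvar 31) (.nconst 0)) (.nvar 10))))
      (.rmul (.rmul (.rarr 5 (pairE (.nvar 31) (.nvar 30))) (.rarr 6 (.nvar 31)))
        (.rarr 7 (.nvar 30))) (.rconst 0))))))

def iterateFlow : Stmt := .seq splitFlow imageOfFlow

end RealRAM

/-! ### Correctness of the splitting and of the image -/

namespace TreeProblem

open RealRAM Finset

variable {X : TreeProblem} {k : ℕ}

open Classical in
theorem splitFlow_spec {m : Memory} (h : HoldsTables X k m) (hr : HoldsRows X m)
    (hY : X.IsFlow (nodeArr m 9)) (h1 : 0 ≤ m.realVar 1)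
    (hG : ∀ s : X.Pos k, rowMass m s = posArr m 8 s) :
    HoldsRows X (splitFlow.den m) ∧
      IsMass (nodeArr m 9 (0 : X.Node)) (posArr (X := X) (k := k) (splitFlow.den m) 7) ∧
      (∀ s : X.Pos k, posArr (splitFlow.den m) 8 s =
        posArr m 8 s + m.realVar 1 * posArr (splitFlow.den m) 7 s) ∧
      (∀ v, rowFlow X (splitFlow.den m) v = rowFlow X m v + m.realVar 1 * nodeArr m 9 v) ∧
      ∀ s : X.Pos k, rowMass (splitFlow.den m) s = posArr (splitFlow.den m) 8 s := by
  obtain ⟨m0, e0⟩ : ∃ μ, μ = (fillZero 4 7).den m := ⟨_, rfl⟩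
  have H0 : HoldsTables X k m0 := e0 ▸ h.den rfl rfl rfl rfl rfl rfl rfl rfl rfl
  have y0 : m0.realArr 9 = m.realArr 9 := by rw [e0, Stmt.den_realArr _ _ _ rfl]
  have t0 : m0.realArr 8 = m.realArr 8 := by rw [e0, Stmt.den_realArr _ _ _ rfl]
  have w0 : m0.realArr 1 = m.realArr 1 := by rw [e0, Stmt.den_realArr _ _ _ rfl]
  have r0 : m0.natArr 2 = m.natArr 2 := by rw [e0, Stmt.den_natArr _ _ _ rfl]
  have n0 : m0.natVar 2 = m.natVar 2 := by rw [e0, Stmt.den_natVar _ _ _ rfl]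
  have o0 : m0.natVar 14 = m.natVar 14 := by rw [e0, Stmt.den_natVar _ _ _ rfl]
  have l0 : m0.realVar 1 = m.realVar 1 := by rw [e0, Stmt.den_realVar _ _ _ rfl]
  have hz : ∀ s : X.Pos k, posArr m0 7 s = 0 := by
    intro s
    rw [e0]
    exact fillZero_spec 4 7 m (by rw [h.positions]; exact posCode_lt s)
  have key := Stmt.den_count (fun j μ => HoldsTables X k μ ∧ HoldsRows X μ ∧
      μ.realVar 1 = m.realVar 1 ∧ X.IsFlow (nodeArr μ 9) ∧
      (nodeArr μ 9 (0 : X.Node) = 0 ∨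
        (univ.filter fun v : X.Node => nodeArr μ 9 v ≠ 0).card ≤ X.size + 1 - j) ∧
      IsMass (nodeArr m 9 (0 : X.Node) - nodeArr μ 9 (0 : X.Node))
        (posArr (X := X) (k := k) μ 7) ∧
      (∀ s : X.Pos k, posArr μ 8 s = posArr m 8 s + m.realVar 1 * posArr μ 7 s) ∧
      (∀ v, rowFlow X μ v = rowFlow X m v + m.realVar 1 * (nodeArr m 9 v - nodeArr μ 9 v)) ∧
      ∀ s : X.Pos k, rowMass μ s = posArr μ 8 s) 13 0 extractStrategy m0 ?_ ?_
  · rw [H0.nodes] at key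
    obtain ⟨-, k1, -, k3, k4, k5, k6, k7, k8⟩ := key
    have hden : splitFlow.den m = (Stmt.count 13 0 extractStrategy).den m0 := by rw [e0]; rfl
    rw [hden]
    -- After n rounds the remaining support has no entries, so the flow at the root is used up in
    -- either case of the invariant.
    have hzero : nodeArr ((Stmt.count 13 0 extractStrategy).den m0) 9 (0 : X.Node) = 0 := by
      rcases k4 with k4 | k4
      · exact k4
      · by_contra hne
        rw [Nat.sub_self, Nat.le_zero, card_eq_zero, filter_eq_empty_iff] at k4
        exact k4 (mem_univ 0) hne
    rw [hzero, sub_zero] at k5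
    refine ⟨k1, k5, k6, fun v => ?_, k8⟩
    rw [k7, k3.eq_zero hzero, sub_zero]
  · refine ⟨⟨⟨H0.nodes, H0.comps, H0.positions, H0.pairs, H0.digits, H0.parent, H0.kind⟩, H0.comp,
      H0.obs, H0.final, H0.adj, H0.fst, H0.snd⟩, ⟨?_, ?_, ?_⟩, l0, ?_, ?_, ?_, ?_, ?_, ?_⟩
    · simp [n0, o0, hr.offset]
    · intro j hj
      rw [Memory.setN_realArr, w0]
      exact hr.weight j (by simpa [n0] using hj)
    · intro j hj
      rw [Memory.setN_natArr, r0]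
      exact hr.row j (by simpa [n0] using hj)
    · have : nodeArr (X := X) (m0.setN 13 0) 9 = nodeArr m 9 := by
        unfold nodeArr; rw [Memory.setN_realArr, y0]
      rw [this]
      exact hY
    · right
      exact (card_le_univ _).trans (by simp)
    · have : posArr (X := X) (k := k) (m0.setN 13 0) 7 = fun _ => 0 := funext hz
      rw [this]
      have : nodeArr (m0.setN 13 0) 9 (0 : X.Node) = nodeArr m 9 (0 : X.Node) := by
        unfold nodeArr; rw [Memory.setN_realArr, y0]
      rw [this, sub_self]
      exact .empty
    · intro s
      have : posArr (m0.setN 13 0) 7 s = 0 := hz s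
      rw [this, mul_zero, add_zero, posArr, posArr, Memory.setN_realArr, t0]
    · intro v
      have : nodeArr (m0.setN 13 0) 9 v = nodeArr m 9 v := by
        unfold nodeArr; rw [Memory.setN_realArr, y0]
      rw [this, sub_self, mul_zero, add_zero]
      simp [rowFlow, n0, w0, r0]
    · intro s
      have : posArr (m0.setN 13 0) 8 s = posArr m 8 s := by
        unfold posArr; rw [Memory.setN_realArr, t0]
      rw [this, ← hG s]
      simp [rowMass, n0, w0, r0]
  · rintro j hj μ - ⟨hT, hR, hl, hF, hc, hM, hA, hB, hC⟩
    rw [H0.nodes] at hj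
    obtain ⟨a, v₀, ha, hv₀, hmax, hmin, i1, i2, i3, i4, i5, i6⟩ :=
      extractStrategy_spec hT hR hF (hl ▸ h1)
    have hT' : HoldsTables X k (extractStrategy.den μ) :=
      hT.den rfl rfl rfl rfl rfl rfl rfl rfl rfl
    have hN : nodeArr (X := X) ((extractStrategy.den μ).setN 13 (j + 1)) 9 =
        fun v => nodeArr μ 9 v - if X.Played a v then nodeArr μ 9 v₀ else 0 := funext i1
    have hsub : X.size + 1 - j = X.size + 1 - (j + 1) + 1 := by omega
    refine ⟨⟨⟨hT'.nodes, hT'.comps, hT'.positions, hT'.pairs, hT'.digits, hT'.parent, hT'.kind⟩,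
      hT'.comp, hT'.obs, hT'.final, hT'.adj, hT'.fst, hT'.snd⟩, ⟨i4.1, i4.2, i4.3⟩, ?_, ?_, ?_, ?_,
      ?_, ?_, ?_⟩
    · rw [← hl]
      exact Stmt.den_realVar extractStrategy μ 1 rfl
    · rw [hN]
      exact hF.sub_played ha hmin
    · rw [hsub] at hc
      rw [hN]
      exact hF.card_support hmax hv₀ hc
    · have hP : posArr (X := X) (k := k) ((extractStrategy.den μ).setN 13 (j + 1)) 7 = fun s =>
          posArr μ 7 s + nodeArr μ 9 v₀ * if ∀ i, i ≠ 0 → X.Played a (s i) then 1 else 0 := by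
        funext s
        rw [mul_ite, mul_one, mul_zero]
        exact i2 s
      rw [hP, hN]
      have := hM.add ((isMass_played (k := k) ha).smul (hF.nonneg v₀))
      simp only [Played.root, if_true]
      convert this using 1
      ring
    · intro s
      have e2 := i2 s
      have e3 := i3 s
      have e4 := hA s
      rw [hl] at e3
      change posArr (extractStrategy.den μ) 8 s =
        posArr m 8 s + m.realVar 1 * posArr (extractStrategy.den μ) 7 s
      rw [e3, e2, e4]
      split_ifs <;> ring
    · intro v
      have e2 := i5 v
      have e3 := i1 v
      rw [hl] at e2
      change rowFlow X (extractStrategy.den μ) v =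
        rowFlow X m v + m.realVar 1 * (nodeArr m 9 v - nodeArr (extractStrategy.den μ) 9 v)
      rw [e2, e3, hB v]
      split_ifs <;> ring
    · intro s
      have e2 := i6 s
      have e3 := i3 s
      change rowMass (extractStrategy.den μ) s = posArr (extractStrategy.den μ) 8 s
      rw [e2, e3, hC s]

theorem imageOfFlow_spec {m : Memory} (h : HoldsTables X k m) (v : X.Node) :
    nodeArr (imageOfFlow.den m) 9 v =
      imageFlow (pairArr (X := X) (k := k) m 5) (posArr m 6) (posArr m 7) v := by
  classical
  rw [nodeArr, imageOfFlow, Stmt.den_fillR_entry _ _ _ _ _ (by rw [h.nodes]; exact v.2), imageFlow,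
    Exp.eval]
  by_cases hv : v = 0
  · subst hv
    simp [Exp.eval]
  · have hv' : (v : ℕ) ≠ 0 := fun h => hv (Fin.ext h)
    have hc : ∀ x f, ((m.setN 10 x).putR 9 f).natVar 4 = (X.size + 1) ^ (k + 1) := by
      simp [h.positions]
    have hc' : ∀ x f y, (((m.setN 10 x).putR 9 f).setN 30 y).natVar 4 =
        (X.size + 1) ^ (k + 1) := by simp [h.positions]
    have hd : ∀ s : X.Pos k, m.natArr 6 ((k + 1) * posCode s) = (s 0 : ℕ) := fun s => h.comp s 0
    rw [if_neg hv, if_neg (by simpa [Exp.eval] using hv), Exp.eval, hc, sum_posCode (X := X)]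
    refine sum_congr rfl fun t _ => ?_
    rw [Exp.eval, hc', sum_posCode (X := X)]
    refine sum_congr rfl fun s _ => ?_
    have e : ((s 0 : ℕ) = v) = (s 0 = v) := by rw [Fin.ext_iff]
    have e' : ((t 0 : ℕ) = v) = (t 0 = v) := by rw [Fin.ext_iff]
    simp [Exp.eval, compE, pairE, mulE, h.comps, h.positions, hd, posArr, pairArr, e, e']

end TreeProblem

/-! The displayed strategy and the values of the positions -/

namespace RealRAM

/-- With the zero flow all siblings tie, so the extraction returns the assignment of least children;
its indicator is the initial unit flow. The displayed list is emptied. -/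
def startFlow : Stmt :=
  .seq (fillZero 0 9) (.seq fillPlayed (.seq playedToFlow (.seq (fillZero 4 8)
    (.seq (.setN 2 (.nconst 0)) (.setN 14 (.nconst 0))))))

def prepare : Stmt := .seq fillTables (.seq computePolicy startFlow)

/-- The place of a position in the table of the values, which is stored in descending order. -/
def placeE (s : Exp .nat) : Exp .nat := .nsub (.nsub (.nvar 4) (.nconst 1)) s

/-- The backward recursion: storage in descending order puts the successors of a position before it.
-/
def fillValue : Stmt :=
  .count 10 4 (.setRA 10 (.nvar 10) (.radd
    (.rite (.eq (.narr 11 (placeE (.nvar 10))) (.nconst 0))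
      (.rmul (.rarr 0 (compE (placeE (.nvar 10)) (.nconst 0))) (.rarr 8 (placeE (.nvar 10))))
      (.rconst 0))
    (.rsum 4 30 (.rite (.lt (placeE (.nvar 10)) (.nvar 30))
      (.rmul (.rarr 5 (pairE (placeE (.nvar 10)) (.nvar 30))) (.rarr 10 (placeE (.nvar 30))))
      (.rconst 0)))))

def regretE : Exp .real :=
  .rsub (.radd (.rarr 2 (.nvar 10)) (.rarr 10 (placeE (.narr 4 (.nvar 10)))))
    (.rarr 10 (placeE (.narr 3 (.nvar 10))))

/-- The update works in place because each entry uses only its own old value and the table of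
values. Pairs that are not moves are updated too, but the policy ignores them. -/
def fillRegret : Stmt :=
  .count 10 5 (.setRA 2 (.nvar 10) (.rite (.rlt (.rconst 0) regretE) regretE (.rconst 0)))

def learn : Stmt := .seq fillValue fillRegret

end RealRAM

/-! ### The invariant of the fixed-point iteration, and the update of the regrets -/

namespace TreeProblem

open RealRAM Finset

variable {X : TreeProblem} {k : ℕ}

open Classical in
/-- The state of the computation of the fixed point after `l` iterations with weight `δ`. -/
structure IsIterate (P : X.Pos k → X.Pos k → ℝ) (Q : X.Pos k → ℝ) (δ : ℝ) (l : ℕ) (m : Memory) :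
    Prop where
  tables : HoldsTables X k m
  rows : HoldsRows X m
  step : m.realVar 1 = δ
  policy : pairArr m 5 = P
  reach : posArr m 6 = Q
  flow : X.IsFlow (nodeArr m 9)
  unit : nodeArr m 9 (0 : X.Node) = 1
  mass : IsMass (l * δ) (posArr (X := X) (k := k) m 8)
  rowMass : ∀ s : X.Pos k, rowMass m s = posArr m 8 s
  total : rowFlow X m 0 = l * δ
  -- The telescoped defect: on leaves, the image of the accumulated mixture exceeds the mixture
  -- itself by δ times the current flow minus the initial flow y.
  fixed : ∃ y : X.Node → ℝ, X.IsFlow y ∧ y 0 = 1 ∧ ∀ z, X.kind z = .terminal →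
    ∑ s : X.Pos k, (if Final s ∧ s 0 = z then Q s * posArr m 8 s else 0) =
      rowFlow X m z + δ * (nodeArr m 9 z - y z)

/-- The list gains δ times the old flow and its image gains δ times the new flow, because the new
flow is by construction the image of the mixture just split off. -/
theorem IsIterate.next {P : X.Pos k → X.Pos k → ℝ} {Q : X.Pos k → ℝ} {δ : ℝ} {l : ℕ} {m : Memory}
    (h : IsIterate P Q δ l m) (hP : IsPolicy P) (hQ : IsReach P Q) (hδ : 0 ≤ δ) :
    IsIterate P Q δ (l + 1) (iterateFlow.den m) := by
  classical
  obtain ⟨i1, i2, i3, i4, i5⟩ := splitFlow_spec h.tables h.rows h.flow (h.step ▸ hδ) h.rowMass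
  rw [h.unit] at i2
  rw [h.step] at i3 i4
  obtain ⟨m1, e1⟩ : ∃ μ, μ = splitFlow.den m := ⟨_, rfl⟩
  have hden : iterateFlow.den m = imageOfFlow.den m1 := by rw [e1]; rfl
  rw [← e1] at i1 i2 i3 i4 i5
  have T1 : HoldsTables X k m1 := e1 ▸ h.tables.den rfl rfl rfl rfl rfl rfl rfl rfl rfl
  have p1 : pairArr (X := X) (k := k) m1 5 = P := by
    rw [← h.policy]; unfold pairArr; rw [e1, Stmt.den_realArr _ _ _ rfl]
  have q1 : posArr (X := X) (k := k) m1 6 = Q := by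
    rw [← h.reach]; unfold posArr; rw [e1, Stmt.den_realArr _ _ _ rfl]
  have l1 : m1.realVar 1 = δ := by rw [← h.step, e1, Stmt.den_realVar _ _ _ rfl]
  obtain ⟨m2, e2⟩ : ∃ μ, μ = imageOfFlow.den m1 := ⟨_, rfl⟩
  rw [hden, ← e2]
  have y2 : nodeArr (X := X) m2 9 = imageFlow P Q (posArr m1 7) := by
    funext v
    rw [e2, imageOfFlow_spec T1, p1, q1]
  have g2 : posArr (X := X) (k := k) m2 8 = posArr m1 8 := by
    unfold posArr; rw [e2, Stmt.den_realArr _ _ _ rfl]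
  have n2 : m2.natVar 2 = m1.natVar 2 := by rw [e2, Stmt.den_natVar _ _ _ rfl]
  have r2 : m2.natArr 2 = m1.natArr 2 := by rw [e2, Stmt.den_natArr _ _ _ rfl]
  have w2 : m2.realArr 1 = m1.realArr 1 := by rw [e2, Stmt.den_realArr _ _ _ rfl]
  have f2 : rowFlow X m2 = rowFlow X m1 := by unfold rowFlow; rw [n2, r2, w2]
  have c2 : TreeProblem.rowMass (X := X) (k := k) m2 = TreeProblem.rowMass m1 := by
    unfold TreeProblem.rowMass; rw [n2, r2, w2]
  have hG : IsMass (δ * 1) fun s => δ * posArr m1 7 s := i2.smul hδ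
  have e8 : posArr (X := X) (k := k) m1 8 = fun s => posArr m 8 s + δ * posArr m1 7 s :=
    funext i3
  constructor
  · exact e2 ▸ T1.den rfl rfl rfl rfl rfl rfl rfl rfl rfl
  · refine ⟨?_, ?_, ?_⟩
    · rw [n2, ← i1.offset, e2, Stmt.den_natVar _ _ _ rfl]
    · rw [n2, w2]; exact i1.weight
    · rw [n2, r2]; exact i1.row
  · rw [← l1, e2, Stmt.den_realVar _ _ _ rfl]
  · rw [← p1]; unfold pairArr; rw [e2, Stmt.den_realArr _ _ _ rfl]
  · rw [← q1]; unfold posArr; rw [e2, Stmt.den_realArr _ _ _ rfl]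
  · rw [y2]
    exact isFlow_imageFlow hP hQ i2
  · rw [y2, imageFlow, if_pos rfl]
  · rw [g2, e8]
    have := h.mass.add hG
    convert this using 1
    push_cast
    ring
  · rw [c2, g2]; exact i5
  · rw [f2, i4, h.total, h.unit]
    push_cast
    ring
  · obtain ⟨y, hy, hy0, hfix⟩ := h.fixed
    refine ⟨y, hy, hy0, fun z hz => ?_⟩
    rw [g2, f2, i4, y2, imageFlow_terminal hP hQ i2 hz, e8]
    have := hfix z hz
    calc ∑ s : X.Pos k, (if Final s ∧ s 0 = z then Q s * (posArr m 8 s + δ * posArr m1 7 s) else 0)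
        = ∑ s : X.Pos k, (if Final s ∧ s 0 = z then Q s * posArr m 8 s else 0) +
          δ * ∑ s : X.Pos k, (if Final s ∧ s 0 = z then Q s * posArr m1 7 s else 0) := by
          rw [mul_sum, ← sum_add_distrib]
          refine sum_congr rfl fun s _ => ?_
          split_ifs <;> ring
      _ = _ := by rw [this]; ring

theorem isIterate_prepare {m : Memory} (h : HoldsInput X k m)
    (hR : ∀ s t : X.Pos k, 0 ≤ pairArr m 2 s t) :
    ∃ Q : X.Pos k → ℝ, IsReach (regretPolicy (pairArr m 2)) Q ∧
      IsIterate (regretPolicy (pairArr m 2)) Q (m.realVar 1) 0 (prepare.den m) := by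
  classical
  obtain ⟨m1, e1⟩ : ∃ μ, μ = fillTables.den m := ⟨_, rfl⟩
  have H1 : HoldsTables X k m1 := e1 ▸ holdsTables_fillTables h
  have r1 : pairArr (X := X) (k := k) m1 2 = pairArr m 2 := by
    unfold pairArr; rw [e1, Stmt.den_realArr _ _ _ rfl]
  obtain ⟨j1, j2⟩ := computePolicy_spec H1 (r1 ▸ hR)
  rw [r1] at j1 j2
  obtain ⟨m2, e2⟩ : ∃ μ, μ = computePolicy.den m1 := ⟨_, rfl⟩
  rw [← e2] at j1 j2
  have H2 : HoldsTables X k m2 := e2 ▸ H1.den rfl rfl rfl rfl rfl rfl rfl rfl rfl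
  obtain ⟨m3, e3⟩ : ∃ μ, μ = (fillZero 0 9).den m2 := ⟨_, rfl⟩
  have H3 : HoldsTables X k m3 := e3 ▸ H2.den rfl rfl rfl rfl rfl rfl rfl rfl rfl
  obtain ⟨m4, e4⟩ : ∃ μ, μ = fillPlayed.den m3 := ⟨_, rfl⟩
  have H4 : HoldsTables X k m4 := e4 ▸ H3.den rfl rfl rfl rfl rfl rfl rfl rfl rfl
  obtain ⟨m5, e5⟩ : ∃ μ, μ = playedToFlow.den m4 := ⟨_, rfl⟩
  have H5 : HoldsTables X k m5 := e5 ▸ H4.den rfl rfl rfl rfl rfl rfl rfl rfl rfl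
  obtain ⟨m6, e6⟩ : ∃ μ, μ = (fillZero 4 8).den m5 := ⟨_, rfl⟩
  have H6 : HoldsTables X k m6 := e6 ▸ H5.den rfl rfl rfl rfl rfl rfl rfl rfl rfl
  obtain ⟨m7, e7⟩ : ∃ μ, μ = (Stmt.seq (.setN 2 (.nconst 0)) (.setN 14 (.nconst 0))).den m6 :=
    ⟨_, rfl⟩
  have H7 : HoldsTables X k m7 := e7 ▸ H6.den rfl rfl rfl rfl rfl rfl rfl rfl rfl
  have hden : prepare.den m = m7 := by rw [e7, e6, e5, e4, e3, e2, e1]; rfl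
  rw [hden]
  obtain ⟨a, ha, -, h9⟩ := fillPlayed_spec H3.toHoldsInput
  rw [← e4] at h9
  have p7 : m7.realArr 5 = m2.realArr 5 := by
    rw [e7, Stmt.den_realArr _ _ _ rfl, e6, Stmt.den_realArr _ _ _ rfl, e5,
      Stmt.den_realArr _ _ _ rfl, e4, Stmt.den_realArr _ _ _ rfl, e3, Stmt.den_realArr _ _ _ rfl]
  have q7 : m7.realArr 6 = m2.realArr 6 := by
    rw [e7, Stmt.den_realArr _ _ _ rfl, e6, Stmt.den_realArr _ _ _ rfl, e5,
      Stmt.den_realArr _ _ _ rfl, e4, Stmt.den_realArr _ _ _ rfl, e3, Stmt.den_realArr _ _ _ rfl]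
  have y7 : m7.realArr 9 = m5.realArr 9 := by
    rw [e7, Stmt.den_realArr _ _ _ rfl, e6, Stmt.den_realArr _ _ _ rfl]
  have t7 : m7.realArr 8 = m6.realArr 8 := by rw [e7, Stmt.den_realArr _ _ _ rfl]
  have l7 : m7.realVar 1 = m.realVar 1 := by
    rw [e7, Stmt.den_realVar _ _ _ rfl, e6, Stmt.den_realVar _ _ _ rfl, e5,
      Stmt.den_realVar _ _ _ rfl, e4, Stmt.den_realVar _ _ _ rfl, e3, Stmt.den_realVar _ _ _ rfl,
      e2, Stmt.den_realVar _ _ _ rfl, e1, Stmt.den_realVar _ _ _ rfl]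
  have n7 : m7.natVar 2 = 0 := by rw [e7]; simp [Stmt.den, Exp.eval]
  have o7 : m7.natVar 14 = 0 := by rw [e7]; simp [Stmt.den, Exp.eval]
  have g7 : posArr (X := X) (k := k) m7 8 = fun _ => 0 := by
    funext s
    rw [posArr, t7, e6]
    exact fillZero_spec 4 8 m5 (by rw [H5.positions]; exact posCode_lt s)
  have f7 : nodeArr (X := X) m7 9 = fun v => if X.Played a v then 1 else 0 := by
    funext v
    rw [nodeArr, y7, e5]
    exact playedToFlow_spec H4.toHoldsInput h9 v
  have hrf : ∀ v, rowFlow X m7 v = 0 := fun v => by simp [rowFlow, n7]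
  refine ⟨posArr m7 6, ?_, H7, ⟨by simp [n7, o7], by simp [n7], by simp [n7]⟩, l7, ?_, rfl, ?_, ?_,
    ?_, ?_, ?_, ?_⟩
  · unfold posArr at j2 ⊢
    rwa [q7]
  · funext s t
    rw [← j1, pairArr, pairArr, p7]
  · rw [f7]; exact isFlow_played ha
  · rw [f7]; simp [Played.root]
  · rw [g7, Nat.cast_zero, zero_mul]; exact .empty
  · intro s
    rw [g7]
    simp [TreeProblem.rowMass, n7]
  · simp [hrf]
  · refine ⟨nodeArr m7 9, ?_, ?_, fun z _ => ?_⟩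
    · rw [f7]; exact isFlow_played ha
    · rw [f7]; simp [Played.root]
    · rw [g7, hrf]
      simp

/-- The displayed mixed strategy. -/
theorem IsIterate.exists_mixed {P : X.Pos k → X.Pos k → ℝ} {Q : X.Pos k → ℝ} {δ : ℝ} {l : ℕ}
    {m : Memory} (h : IsIterate P Q δ l m) (hl : l * δ = 1) : ∃ π : X.Mixed, X.Displays m π ∧
      (∀ (z : X.Terminal) (zs : Fin k → X.Terminal),
        posArr m 8 (Fin.cons z.1 fun i => (zs i).1 : X.Pos k) =
          ∑ j, π.weight j * ∏ i, (π.strategy j).1 (zs i)) ∧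
      ∀ z : X.Terminal, ∑ j, π.weight j * (π.strategy j).1 z = rowFlow X m z.1 := by
  classical
  choose! A hA hA' using h.rows.row
  have hrow : ∀ j, j < m.natVar 2 → ∀ v : X.Node, m.natArr 2 (j * (X.size + 1) + v) =
      if X.Played (A j) v then 1 else 0 := by
    intro j hj v
    split_ifs with hv
    · exact (hA' j hj v).1 hv
    · exact (hA' j hj v).2 hv
  refine ⟨⟨m.natVar 2, fun j => m.realArr 1 j, fun j => ⟨X.treeForm (A j), A j, hA j j.2, rfl⟩,
    fun j => h.rows.weight j j.2, ?_⟩, ⟨rfl, fun _ => rfl, fun j z => ?_⟩, fun z zs => ?_,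
    fun z => ?_⟩
  · rw [← hl, ← h.total, rowFlow, sum_range]
    refine sum_congr rfl fun j _ => ?_
    rw [hrow j j.2, if_pos .root]
    simp
  · rw [hrow j j.2]
    simp [treeForm]
  · rw [← h.rowMass, TreeProblem.rowMass, sum_range]
    refine sum_congr rfl fun j _ => ?_
    congr 1
    simp only [hrow j j.2, treeForm]
    rw [prod_ite_zero]
    simp only [prod_const_one]
    refine if_congr ?_ rfl rfl
    rw [Fin.forall_fin_succ]
    simp
  · refine Eq.trans ?_ (sum_range _).symm
    refine sum_congr rfl fun j _ => ?_
    simp [hrow j j.2, treeForm]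

/-- The value of the root approximates the value of the displayed strategy. -/
theorem IsIterate.value_root_le {P : X.Pos k → X.Pos k → ℝ} {Q : X.Pos k → ℝ} {δ : ℝ} {l : ℕ}
    {m : Memory} (h : IsIterate P Q δ l m) (hQ : IsReach P Q) (hδ : 0 ≤ δ)
    {u : X.Terminal → ℝ} (hu : u ∈ X.utilities) {w : X.Node → ℝ}
    (hw : ∀ z : X.Terminal, w z.1 = u z) {V : X.Pos k → ℝ} (hV : IsValue P w (posArr m 8) V) :
    V (fun _ => 0) ≤ ∑ z : X.Terminal, u z * rowFlow X m z.1 + 2 * δ := by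
  classical
  obtain ⟨y, hy, hy0, hfix⟩ := h.fixed
  have e1 : V (fun _ => 0) = ∑ z : X.Terminal,
      u z * ∑ s : X.Pos k, (if Final s ∧ s 0 = z.1 then Q s * posArr m 8 s else 0) := by
    rw [hQ.value_root hV]
    simp only [mul_sum]
    rw [sum_comm]
    refine sum_congr rfl fun s _ => ?_
    by_cases hf : Final s
    · rw [if_pos hf, sum_eq_single ⟨s 0, hf 0⟩]
      · simp [hf, ← hw]
      · intro z _ hz
        have : ¬ s 0 = z.1 := fun h => hz (Subtype.ext h.symm)
        simp [this]
      · simp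
    · simp [hf]
  -- Both flows in the telescoped defect are unit flows with values in [-1, 1], so the defect costs
  -- at most 2δ.
  have e2 := abs_le.mp (abs_value_le_one hu h.flow h.unit)
  have e3 := abs_le.mp (abs_value_le_one hu hy hy0)
  have e4 : V (fun _ => 0) = ∑ z : X.Terminal, u z * rowFlow X m z.1 +
      δ * (∑ z : X.Terminal, u z * nodeArr m 9 z.1 - ∑ z : X.Terminal, u z * y z.1) := by
    rw [e1, ← sum_sub_distrib, mul_sum, ← sum_add_distrib]
    refine sum_congr rfl fun z _ => ?_
    rw [hfix z.1 z.2]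
    ring
  rw [e4]
  nlinarith

def value (X : TreeProblem) (k : ℕ) (m : Memory) (s : X.Pos k) : ℝ :=
  m.realArr 10 ((X.size + 1) ^ (k + 1) - 1 - posCode s)

theorem fillValue_isValue {m : Memory} (h : HoldsTables X k m) {P : X.Pos k → X.Pos k → ℝ}
    (hP : IsPolicy P) (h5 : pairArr m 5 = P) :
    IsValue P (nodeArr m 0) (posArr m 8) (value X k (fillValue.den m)) := by
  classical
  intro s
  have hs := posCode_lt s
  have hlt : (X.size + 1) ^ (k + 1) - 1 - posCode s < (X.size + 1) ^ (k + 1) := by omega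
  have hinv : (X.size + 1) ^ (k + 1) - 1 - ((X.size + 1) ^ (k + 1) - 1 - posCode s) =
    posCode s := by omega
  have hd : m.natArr 6 ((k + 1) * posCode s) = (s 0 : ℕ) := h.comp s 0
  rw [value, fillValue, Stmt.den_fillR_entry _ _ _ _ _ (by rw [h.positions]; exact hlt),
    ← fillValue, Exp.eval]
  congr 1
  · simp [Exp.eval, placeE, compE, mulE, h.positions, h.comps, hinv, hd, h.final, nodeArr, posArr]
  · have hc : ∀ x f, ((m.setN 10 x).putR 10 f).natVar 4 = (X.size + 1) ^ (k + 1) := by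
      simp [h.positions]
    rw [Exp.eval, hc, sum_posCode (X := X)]
    refine sum_congr rfl fun t _ => ?_
    by_cases hst : posCode s < posCode t
    · have ht := posCode_lt t
      have hlt' : (X.size + 1) ^ (k + 1) - 1 - posCode t <
        (X.size + 1) ^ (k + 1) - 1 - posCode s := by omega
      simp [Exp.eval, placeE, pairE, mulE, h.positions, hinv, hst, hlt', ← h5, pairArr, value]
    · have : ¬ Adj s t := fun ha => hst (posCode_strictMono ha.lt)
      simp [Exp.eval, placeE, h.positions, hinv, hst, hP.supp s t this]

theorem fillRegret_entry {m : Memory} (h : HoldsTables X k m) (s t : X.Pos k) :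
    pairArr (fillRegret.den m) 2 s t =
      max 0 (pairArr m 2 s t + value X k m t - value X k m s) := by
  rw [pairArr, fillRegret, Stmt.den_fillR_entry _ _ _ _ _
    (by rw [h.pairs]; exact pair_lt (posCode_lt s) (posCode_lt t))]
  have key : ∀ x : ℝ, (if 0 < x then x else 0) = max 0 x := by
    intro x
    split_ifs with hx
    · exact (max_eq_right hx.le).symm
    · exact (max_eq_left (not_lt.mp hx)).symm
  rw [← key]
  simp [Exp.eval, regretE, placeE, h.positions, h.fst, h.snd, pairArr, value]

theorem learn_spec {m : Memory} (h : HoldsTables X k m) {P : X.Pos k → X.Pos k → ℝ}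
    (hP : IsPolicy P) (h5 : pairArr m 5 = P) :
    ∃ V, IsValue P (nodeArr m 0) (posArr m 8) V ∧
      ∀ s t : X.Pos k, pairArr (learn.den m) 2 s t = max 0 (pairArr m 2 s t + V t - V s) := by
  refine ⟨_, fillValue_isValue h hP h5, fun s t => ?_⟩
  have h1 : HoldsTables X k (fillValue.den m) := h.den rfl rfl rfl rfl rfl rfl rfl rfl rfl
  have := fillRegret_entry h1 s t
  have e : pairArr (fillValue.den m) 2 s t = pairArr m 2 s t := by
    rw [pairArr, pairArr, Stmt.den_realArr _ _ _ rfl]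
  rw [e] at this
  exact this

end TreeProblem

/-! The programs of the learner -/

namespace RealRAM

open Memory

/-- From every memory that agrees with `m` on the ordinary variables, the program reaches a memory
that agrees with `m'` in at most `K` steps. -/
def Runs (p : Program) (m m' : Memory) (K : ℕ) : Prop :=
  ∀ μ, Agree 0 m μ → ∃ μ' c, Exec p μ μ' c ∧ Agree 0 m' μ' ∧ c ≤ K

theorem Runs.seq {p q : Program} {m₁ m₂ m₃ : Memory} {K L : ℕ} (h : Runs p m₁ m₂ K)
    (h' : Runs q m₂ m₃ L) : Runs (.seq p q) m₁ m₃ (K + L) := by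
  intro μ hμ
  obtain ⟨μ₁, c, h1, a1, k1⟩ := h μ hμ
  obtain ⟨μ₂, d, h2, a2, k2⟩ := h' μ₁ a1
  exact ⟨μ₂, _, .seq h1 h2, a2, by omega⟩

theorem Runs.mono {p : Program} {m m' : Memory} {K L : ℕ} (h : Runs p m m' K) (hKL : K ≤ L) :
    Runs p m m' L := by
  intro μ hμ
  obtain ⟨μ₁, c, h1, a1, k1⟩ := h μ hμ
  exact ⟨μ₁, c, h1, a1, k1.trans hKL⟩

theorem Runs.code {s : Stmt} (hs : s.ok = true) {W : ℕ} {m : Memory}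
    (hW : ∀ b, isBound b = true → m.natVar b ≤ W) : Runs s.code m (s.den m) (s.cost W) :=
  fun μ hμ => s.code_spec hs W m μ hμ hW

theorem Runs.setNat {m : Memory} (x : ℕ) (e : NatExp) {v : ℕ}
    (he : ∀ μ, Agree 0 m μ → e.eval μ = v) : Runs (.setNat x e) m (m.setN x v) (e.cost + 1) := by
  intro μ hμ
  refine ⟨_, _, exec_setN _ _ _, ?_, le_rfl⟩
  rw [he μ hμ]
  exact hμ.setN x v

theorem Runs.setReal {m : Memory} (x : ℕ) (e : RealExp) {v : ℝ}
    (he : ∀ μ, Agree 0 m μ → e.eval μ = v) : Runs (.setReal x e) m (m.setR x v) (e.cost + 1) := by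
  intro μ hμ
  refine ⟨_, _, exec_setR _ _ _, ?_, le_rfl⟩
  rw [he μ hμ]
  exact hμ.setR x v

theorem Runs.loop {t : Test} {p : Program} (g : ℕ → Memory) (N K : ℕ)
    (ht : ∀ j, j < N → ∀ μ, Agree 0 (g j) μ → t.holds μ)
    (hstep : ∀ j, j < N → Runs p (g j) (g (j + 1)) K)
    (hend : ∀ μ, Agree 0 (g N) μ → ¬ t.holds μ) :
    Runs (.loop t p) (g 0) (g N) (N * (t.cost + K) + t.cost) := by
  intro μ hμ
  exact exec_loop (fun j ν => Agree 0 (g j) ν) N K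
    (fun j hj ν hν => ⟨ht j hj ν hν, by
      obtain ⟨μ', c, h1, h2, h3⟩ := hstep j hj ν hν
      exact ⟨μ', c, h1, h3, h2⟩⟩) hend hμ

def powStmt : Stmt :=
  .seq (.setN 20 (.nconst 1)) (.count 10 3 (.setN 20 (mulE 0 (.nvar 20))))

/-- The bounds of the sums and loops. -/
def setup : Program :=
  -- Statements may not assign bound variables, so the powers and products are computed in variable
  -- 20 and copied by plain instructions.
  .seq (.setNat 3 (.add (.var 1) (.const 1))) (.seq powStmt.code (.seq (.setNat 4 (.var 20))
    (.seq (Stmt.setN 20 (mulE 4 (.nvar 4))).code (.seq (.setNat 5 (.var 20))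
      (.seq (Stmt.setN 20 (mulE 3 (.nvar 4))).code (.setNat 6 (.var 20)))))))

/-- The number of iterations. -/
def chooseLength : Program :=
  -- Without rounding, ⌈4/ε⌉ is found by adding ε until the sum reaches 4. The count is kept both as
  -- a real, to divide by, and as a natural number, to bound the loop.
  .seq (.setReal 3 (.const 0)) (.seq (.setReal 4 (.const 0)) (.seq (.setNat 11 (.const 0))
    (.seq (.loop (.realLt (.var 3) (.const 4)) (.seq (.setReal 3 (.add (.var 3) (.var 0)))
      (.seq (.setReal 4 (.add (.var 4) (.const 1))) (.setNat 11 (.add (.var 11) (.const 1))))))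
      (.setReal 1 (.div (.const 1) (.var 4))))))

def iterateLoop : Program :=
  .seq (.setNat 12 (.const 0)) (.loop (.natLt (.var 12) (.var 11))
    (.seq iterateFlow.code (.setNat 12 (.add (.var 12) (.const 1)))))

def nextProgram : Program :=
  .seq setup (.seq chooseLength (.seq prepare.code iterateLoop))

def observeProgram : Program := learn.code

theorem powStmt_spec (m : Memory) : (powStmt.den m).natVar 20 = m.natVar 0 ^ m.natVar 3 := by
  have := Stmt.den_count (fun j μ => μ.natVar 0 = m.natVar 0 ∧ μ.natVar 20 = m.natVar 0 ^ j)
    10 3 (.setN 20 (mulE 0 (.nvar 20))) ((Stmt.setN 20 (.nconst 1)).den m)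
    (by simp [Stmt.den, Exp.eval]) (by
      rintro j - μ - ⟨h1, h2⟩
      simp [Stmt.den, Exp.eval, mulE, h1, h2, pow_succ'])
  have e : ((Stmt.setN 20 (.nconst 1)).den m).natVar 3 = m.natVar 3 := by simp [Stmt.den]
  rw [e] at this
  exact this.2

end RealRAM

/-! ### Preparation of a round: bounds and number of iterations -/

namespace TreeProblem

open RealRAM Finset Memory

variable {X : TreeProblem} {k : ℕ}

/-- The memory at the beginning of a round. -/
structure IsReady (X : TreeProblem) (k : ℕ) (ε : ℝ) (m : Memory) : Prop where
  nodes : m.natVar 0 = X.size + 1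
  mediators : m.natVar 1 = k
  accuracy : m.realVar 0 = ε
  bound : ∀ b, isBound b = true → m.natVar b ≤ (X.size + 1) ^ (k + 1) * (X.size + 1) ^ (k + 1)
  parent : ∀ v : X.Node, m.natArr 0 v = X.parent v
  kind : ∀ v : X.Node, m.natArr 1 v = kindCode (X.kind v)
  regret : ∀ s t : X.Pos k, 0 ≤ pairArr m 2 s t

theorem add_one_le_pow {n k : ℕ} (hn : 2 ≤ n) : k + 1 ≤ n ^ (k + 1) :=
  (Nat.lt_pow_self hn).le

theorem isBound_iff {b : ℕ} : isBound b = true ↔ b = 0 ∨ b = 3 ∨ b = 4 ∨ b = 5 ∨ b = 6 := by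
  simp [isBound, or_assoc]

theorem HoldsInput.bound {m : Memory} (h : HoldsInput X k m) (hn : 2 ≤ X.size + 1) (b : ℕ)
    (hb : isBound b = true) :
    m.natVar b ≤ (X.size + 1) ^ (k + 1) * (X.size + 1) ^ (k + 1) := by
  have hM : 0 < (X.size + 1) ^ (k + 1) := by positivity
  have h1 : X.size + 1 ≤ (X.size + 1) ^ (k + 1) := Nat.le_self_pow (by omega) _
  have h2 := add_one_le_pow (k := k) hn
  have h3 : (X.size + 1) ^ (k + 1) ≤ (X.size + 1) ^ (k + 1) * (X.size + 1) ^ (k + 1) :=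
    Nat.le_mul_of_pos_left _ hM
  rcases isBound_iff.mp hb with rfl | rfl | rfl | rfl | rfl
  · rw [h.nodes]; omega
  · rw [h.comps]; omega
  · rw [h.positions]; exact h3
  · rw [h.pairs]
  · rw [h.digits]; exact Nat.mul_le_mul_right _ h2

def setupCost (W : ℕ) : ℕ :=
  powStmt.cost W + (Stmt.setN 20 (mulE 4 (.nvar 4))).cost W +
    (Stmt.setN 20 (mulE 3 (.nvar 4))).cost W + 20

/-- The setup is repeated in each round. Before the first one most bounds are still 0, which is why
`IsReady` only asks them to be at most M². -/
theorem runs_setup {ε : ℝ} {m : Memory} (h : IsReady X k ε m) (hn : 2 ≤ X.size + 1) :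
    ∃ m', Runs setup m m' (setupCost ((X.size + 1) ^ (k + 1) * (X.size + 1) ^ (k + 1))) ∧
      HoldsInput X k m' ∧ m'.natVar 1 = k ∧ m'.realVar = m.realVar ∧ m'.realArr = m.realArr := by
  obtain ⟨M, hM⟩ : ∃ M, M = (X.size + 1) ^ (k + 1) := ⟨_, rfl⟩
  have hM0 : 0 < M := by rw [hM]; positivity
  have hk : k + 1 ≤ M := hM ▸ add_one_le_pow hn
  have hMM : M ≤ M * M := Nat.le_mul_of_pos_left _ hM0
  have hb := h.bound
  rw [← hM] at hb ⊢
  have r1 : Runs (.setNat 3 (.add (.var 1) (.const 1))) m (m.setN 3 (k + 1)) 4 :=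
    Runs.setNat 3 _ fun μ hμ => by simp [NatExp.eval, hμ.natVar, h.mediators]
  obtain ⟨m1, e1⟩ : ∃ μ, μ = m.setN 3 (k + 1) := ⟨_, rfl⟩
  rw [← e1] at r1
  have b1 : ∀ b, isBound b = true → m1.natVar b ≤ M * M := by
    intro b hb'
    rw [e1, Memory.setN_natVar]
    split_ifs
    · omega
    · exact hb b hb'
  obtain ⟨m2, e2⟩ : ∃ μ, μ = powStmt.den m1 := ⟨_, rfl⟩
  have r2 : Runs powStmt.code m1 m2 (powStmt.cost (M * M)) := e2 ▸ Runs.code rfl b1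
  have v2 : m2.natVar 20 = M := by
    rw [e2, powStmt_spec, e1, hM]; simp [h.nodes]
  have b2 : ∀ b, isBound b = true → m2.natVar b ≤ M * M := by
    intro b hb'
    rw [e2, Stmt.den_natVar _ _ _ (Stmt.setsN_bound rfl hb')]
    exact b1 b hb'
  have r3 : Runs (.setNat 4 (.var 20)) m2 (m2.setN 4 M) 2 :=
    Runs.setNat 4 _ fun μ hμ => by simp [NatExp.eval, hμ.natVar, v2]
  obtain ⟨m3, e3⟩ : ∃ μ, μ = m2.setN 4 M := ⟨_, rfl⟩
  rw [← e3] at r3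
  have b3 : ∀ b, isBound b = true → m3.natVar b ≤ M * M := by
    intro b hb'
    rw [e3, Memory.setN_natVar]
    split_ifs
    · exact hMM
    · exact b2 b hb'
  obtain ⟨m4, e4⟩ : ∃ μ, μ = (Stmt.setN 20 (mulE 4 (.nvar 4))).den m3 := ⟨_, rfl⟩
  have r4 : Runs (Stmt.setN 20 (mulE 4 (.nvar 4))).code m3 m4 _ := e4 ▸ Runs.code rfl b3
  have v4 : m4.natVar 20 = M * M := by
    rw [e4, e3]; simp [Stmt.den, Exp.eval, mulE]
  have b4 : ∀ b, isBound b = true → m4.natVar b ≤ M * M := by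
    intro b hb'
    rw [e4, Stmt.den_natVar _ _ _ (Stmt.setsN_bound rfl hb')]
    exact b3 b hb'
  have r5 : Runs (.setNat 5 (.var 20)) m4 (m4.setN 5 (M * M)) 2 :=
    Runs.setNat 5 _ fun μ hμ => by simp [NatExp.eval, hμ.natVar, v4]
  obtain ⟨m5, e5⟩ : ∃ μ, μ = m4.setN 5 (M * M) := ⟨_, rfl⟩
  rw [← e5] at r5
  have b5 : ∀ b, isBound b = true → m5.natVar b ≤ M * M := by
    intro b hb'
    rw [e5, Memory.setN_natVar]
    split_ifs
    · exact le_rfl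
    · exact b4 b hb'
  have w2 : m2.natVar 3 = k + 1 := by
    rw [e2, Stmt.den_natVar _ _ _ rfl, e1]; simp
  obtain ⟨m6, e6⟩ : ∃ μ, μ = (Stmt.setN 20 (mulE 3 (.nvar 4))).den m5 := ⟨_, rfl⟩
  have r6 : Runs (Stmt.setN 20 (mulE 3 (.nvar 4))).code m5 m6 _ := e6 ▸ Runs.code rfl b5
  have v6 : m6.natVar 20 = (k + 1) * M := by
    rw [e6, e5, e4, e3]; simp [Stmt.den, Exp.eval, mulE, w2]
  have r7 : Runs (.setNat 6 (.var 20)) m6 (m6.setN 6 ((k + 1) * M)) 2 :=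
    Runs.setNat 6 _ fun μ hμ => by simp [NatExp.eval, hμ.natVar, v6]
  refine ⟨_, (r1.seq (r2.seq (r3.seq (r4.seq (r5.seq (r6.seq r7)))))).mono ?_, ?_, ?_, ?_, ?_⟩
  · unfold setupCost; omega
  · have n2 : m2.natVar 0 = X.size + 1 := by
      rw [e2, Stmt.den_natVar _ _ _ rfl, e1]; simp [h.nodes]
    have a2 : m2.natArr = m.natArr := by
      funext B
      rw [e2, Stmt.den_natArr _ _ _ rfl, e1]; rfl
    constructor
    · rw [e6, e5, e4, e3]; simp [Stmt.den, n2]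
    · rw [e6, e5, e4, e3]; simp [Stmt.den, w2]
    · rw [e6, e5, e4, e3]; simp [Stmt.den, hM]
    · rw [e6, e5, e4, e3]; simp [Stmt.den, hM]
    · simp [hM]
    · rw [e6, e5, e4, e3]; simp [Stmt.den, a2, h.parent]
    · rw [e6, e5, e4, e3]; simp [Stmt.den, a2, h.kind]
  · have n2 : m2.natVar 1 = k := by
      rw [e2, Stmt.den_natVar _ _ _ rfl, e1]; simp [h.mediators]
    rw [e6, e5, e4, e3]; simp [Stmt.den, n2]
  · have a2 : m2.realVar = m.realVar := by
      funext B
      rw [e2, Stmt.den_realVar _ _ _ rfl, e1]; rfl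
    rw [e6, e5, e4, e3]; simpa [Stmt.den] using a2
  · have a2 : m2.realArr = m.realArr := by
      funext B
      rw [e2, Stmt.den_realArr _ _ _ rfl, e1]; rfl
    rw [e6, e5, e4, e3]; simpa [Stmt.den] using a2

/-- The number of iterations. -/
noncomputable def length (ε : ℝ) : ℕ := ⌈4 / ε⌉₊

/-- With δ = 1/L, the fixed-point error 2δ takes half of the allowed regret. The condition ε ≤ 2
absorbs the rounding in L into 6/ε. -/
theorem length_spec {ε : ℝ} (hε : 0 < ε) (hε2 : ε ≤ 2) :
    0 < length ε ∧ (length ε : ℝ) ≤ 6 / ε ∧ 2 * (1 / (length ε : ℝ)) ≤ ε / 2 := by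
  have h1 : 4 / ε ≤ (length ε : ℝ) := Nat.le_ceil _
  have h0 : 0 < 4 / ε := by positivity
  have h2 : (0 : ℝ) < length ε := h0.trans_le h1
  refine ⟨by exact_mod_cast h2, ?_, ?_⟩
  · have := (Nat.ceil_lt_add_one h0.le).le
    have h3 : (1 : ℝ) ≤ 2 / ε := by rw [le_div_iff₀ hε]; linarith
    have : (length ε : ℝ) ≤ 4 / ε + 1 := this
    calc (length ε : ℝ) ≤ 4 / ε + 2 / ε := by linarith
      _ = 6 / ε := by ring
  · rw [mul_one_div, div_le_iff₀ h2]
    rw [div_le_iff₀ hε] at h1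
    linarith

theorem runs_chooseLength {ε : ℝ} (hε : 0 < ε) {m : Memory} (h0 : m.realVar 0 = ε) :
    ∃ m', Runs chooseLength m m' (length ε * 15 + 20) ∧
      m'.natVar 11 = length ε ∧ m'.realVar 1 = 1 / length ε ∧ m'.realVar 0 = ε ∧
      m'.natArr = m.natArr ∧ m'.realArr = m.realArr ∧
      ∀ x, x ≠ 11 → m'.natVar x = m.natVar x := by
  set g : ℕ → Memory := fun j => ((m.setR 3 (j * ε)).setR 4 j).setN 11 j with hg
  have r1 : Runs (.setReal 3 (.const 0)) m (m.setR 3 0) 2 :=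
    Runs.setReal 3 _ fun μ hμ => by simp [RealExp.eval]
  have r2 : Runs (.setReal 4 (.const 0)) (m.setR 3 0) ((m.setR 3 0).setR 4 0) 2 :=
    Runs.setReal 4 _ fun μ hμ => by simp [RealExp.eval]
  have r3 : Runs (.setNat 11 (.const 0)) ((m.setR 3 0).setR 4 0) (g 0) 2 := by
    have : g 0 = ((m.setR 3 0).setR 4 0).setN 11 0 := by simp [hg]
    rw [this]
    exact Runs.setNat 11 _ fun μ hμ => by simp [NatExp.eval]
  have r4 := Runs.loop (t := .realLt (.var 3) (.const 4))
    (p := .seq (.setReal 3 (.add (.var 3) (.var 0)))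
      (.seq (.setReal 4 (.add (.var 4) (.const 1))) (.setNat 11 (.add (.var 11) (.const 1)))))
    g (length ε) 12 ?_ ?_ ?_
  · have r5 : Runs (.setReal 1 (.div (.const 1) (.var 4))) (g (length ε))
        ((g (length ε)).setR 1 (1 / length ε)) 4 :=
      Runs.setReal 1 _ fun μ hμ => by simp [RealExp.eval, hμ.realVar, hg]
    refine ⟨_, (r1.seq (r2.seq (r3.seq (r4.seq r5)))).mono ?_, ?_, ?_, ?_, rfl, rfl, ?_⟩
    · simp only [Test.cost, RealExp.cost]; omega
    · simp [hg]
    · simp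
    · simp [hg, h0]
    · intro x hx
      simp [hg, hx]
  · intro j hj μ hμ
    simp only [Test.holds, RealExp.eval, hμ.realVar 3 (by norm_num)]
    have := Nat.lt_ceil.mp hj
    rw [lt_div_iff₀ hε] at this
    simpa [hg] using this
  · intro j hj
    have s1 : Runs (.setReal 3 (.add (.var 3) (.var 0))) (g j) ((g j).setR 3 ((j + 1 : ℕ) * ε)) 4 :=
      Runs.setReal 3 _ fun μ hμ => by
        simp [RealExp.eval, hμ.realVar, hg, h0]; ring
    have s2 : Runs (.setReal 4 (.add (.var 4) (.const 1))) ((g j).setR 3 ((j + 1 : ℕ) * ε))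
        (((g j).setR 3 ((j + 1 : ℕ) * ε)).setR 4 (j + 1 : ℕ)) 4 :=
      Runs.setReal 4 _ fun μ hμ => by simp [RealExp.eval, hμ.realVar, hg]
    have s3 : Runs (.setNat 11 (.add (.var 11) (.const 1)))
        (((g j).setR 3 ((j + 1 : ℕ) * ε)).setR 4 (j + 1 : ℕ)) (g (j + 1)) 4 := by
      have : g (j + 1) = (((g j).setR 3 ((j + 1 : ℕ) * ε)).setR 4 (j + 1 : ℕ)).setN 11 (j + 1) := by
        simp only [hg, Memory.setN, Memory.setR]
        congr 1
        · simp
        · funext x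
          by_cases h4 : x = 4 <;> by_cases h3 : x = 3 <;> simp [h3, h4]
      rw [this]
      exact Runs.setNat 11 _ fun μ hμ => by simp [NatExp.eval, hμ.natVar, hg]
    exact s1.seq (s2.seq s3)
  · intro μ hμ
    simp only [Test.holds, RealExp.eval, hμ.realVar 3 (by norm_num)]
    have := Nat.le_ceil (4 / ε)
    rw [div_le_iff₀ hε] at this
    simpa [hg, length] using this

end TreeProblem

/-! The learner -/

namespace RealRAM

/-- A bound on the number of steps of a round, to be multiplied by the number of iterations. -/
def roundCost (W : ℕ) : ℕ :=
  powStmt.cost W + (Stmt.setN 20 (mulE 4 (.nvar 4))).cost W +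
    (Stmt.setN 20 (mulE 3 (.nvar 4))).cost W + prepare.cost W + iterateFlow.cost W +
    learn.cost W + 100

theorem polyBounded_roundCost : PolyBounded roundCost :=
  ((((((powStmt.polyBounded_cost.add (Stmt.polyBounded_cost _)).add (Stmt.polyBounded_cost _)).add
    (Stmt.polyBounded_cost _)).add (Stmt.polyBounded_cost _)).add
    (Stmt.polyBounded_cost _)).add (.const _))

end RealRAM

/-! ### One round of the learner -/

namespace TreeProblem

open RealRAM Finset Memory

variable {X : TreeProblem} {k : ℕ}

theorem runs_iterateLoop {m : Memory} {P : X.Pos k → X.Pos k → ℝ} {Q : X.Pos k → ℝ} {δ ε : ℝ}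
    (h : IsIterate P Q δ 0 m) (hP : IsPolicy P) (hQ : IsReach P Q) (hδ : 0 ≤ δ)
    (hn : 2 ≤ X.size + 1) (h1 : m.natVar 1 = k) (h0 : m.realVar 0 = ε) :
    ∃ m', Runs iterateLoop m m' (m.natVar 11 * (iterateFlow.cost
        ((X.size + 1) ^ (k + 1) * (X.size + 1) ^ (k + 1)) + 7) + 5) ∧
      IsIterate P Q δ (m.natVar 11) m' ∧ m'.natVar 1 = k ∧ m'.realVar 0 = ε ∧
      m'.realArr 2 = m.realArr 2 := by
  -- The ideal memories after j iterations; counter 12 and bound 11 are not touched by the body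
  -- `iterateFlow`.
  set g : ℕ → Memory := fun j => Nat.rec (m.setN 12 0)
    (fun j μ => (iterateFlow.den μ).setN 12 (j + 1)) j with hg
  have hset : ∀ {l : ℕ} {μ : Memory} (v : ℕ), IsIterate P Q δ l μ →
      IsIterate P Q δ l (μ.setN 12 v) := fun v h =>
    ⟨⟨⟨h.tables.nodes, h.tables.comps, h.tables.positions, h.tables.pairs, h.tables.digits,
      h.tables.parent, h.tables.kind⟩, h.tables.comp, h.tables.obs, h.tables.final, h.tables.adj,
      h.tables.fst, h.tables.snd⟩, ⟨h.rows.offset, h.rows.weight, h.rows.row⟩, h.step, h.policy,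
      h.reach, h.flow, h.unit, h.mass, h.rowMass, h.total, h.fixed⟩
  have hI : ∀ j, IsIterate P Q δ j (g j) ∧ (g j).natVar 12 = j ∧
      (g j).natVar 11 = m.natVar 11 ∧ (g j).natVar 1 = k ∧ (g j).realVar 0 = ε ∧
      (g j).realArr 2 = m.realArr 2 := by
    intro j
    induction j with
    | zero => exact ⟨hset 0 h, by simp [hg], by simp [hg], by simp [hg, h1], by simp [hg, h0],
        by simp [hg]⟩
    | succ j ih =>
      obtain ⟨i1, -, i3, i4, i5, i6⟩ := ih
      have e : g (j + 1) = (iterateFlow.den (g j)).setN 12 (j + 1) := rfl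
      rw [e]
      refine ⟨hset _ (i1.next hP hQ hδ), by simp, ?_, ?_, ?_, ?_⟩
      · rw [setN_natVar, if_neg (by decide), Stmt.den_natVar _ _ _ rfl, i3]
      · rw [setN_natVar, if_neg (by decide), Stmt.den_natVar _ _ _ rfl, i4]
      · rw [setN_realVar, Stmt.den_realVar _ _ _ rfl, i5]
      · rw [setN_realArr, Stmt.den_realArr _ _ _ rfl, i6]
  have r1 : Runs (.setNat 12 (.const 0)) m (g 0) 2 :=
    Runs.setNat 12 _ fun μ hμ => by simp [NatExp.eval]
  have r2 := Runs.loop (t := .natLt (.var 12) (.var 11))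
    (p := .seq iterateFlow.code (.setNat 12 (.add (.var 12) (.const 1)))) g (m.natVar 11)
    (iterateFlow.cost ((X.size + 1) ^ (k + 1) * (X.size + 1) ^ (k + 1)) + 4) ?_ ?_ ?_
  · obtain ⟨i1, -, -, i4, i5, i6⟩ := hI (m.natVar 11)
    refine ⟨_, (r1.seq r2).mono ?_, i1, i4, i5, i6⟩
    simp only [Test.cost, NatExp.cost]
    rw [show 1 + 1 + 1 + (iterateFlow.cost ((X.size + 1) ^ (k + 1) * (X.size + 1) ^ (k + 1)) + 4) =
      iterateFlow.cost ((X.size + 1) ^ (k + 1) * (X.size + 1) ^ (k + 1)) + 7 by ring]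
    omega
  · intro j hj μ hμ
    obtain ⟨-, i2, i3, -⟩ := hI j
    simp only [Test.holds, NatExp.eval, hμ.natVar 12 (by norm_num), hμ.natVar 11 (by norm_num),
      i2, i3]
    exact hj
  · intro j hj
    obtain ⟨i1, i2, -⟩ := hI j
    refine (Runs.code rfl (i1.tables.bound hn)).seq (Runs.setNat 12 _ fun μ hμ => ?_)
    simp only [NatExp.eval]
    rw [hμ.natVar 12 (by norm_num), Stmt.den_natVar _ _ _ rfl, i2]
  · intro μ hμ
    obtain ⟨-, i2, i3, -⟩ := hI (m.natVar 11)
    simp only [Test.holds, NatExp.eval, hμ.natVar 12 (by norm_num), hμ.natVar 11 (by norm_num),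
      i2, i3]
    exact lt_irrefl _

theorem runs_nextProgram {ε : ℝ} (hε : 0 < ε) {m : Memory} (h : IsReady X k ε m)
    (hn : 2 ≤ X.size + 1) :
    ∃ m' K, Runs nextProgram m m' K ∧
      K + learn.cost ((X.size + 1) ^ (k + 1) * (X.size + 1) ^ (k + 1)) ≤ (length ε + 1) *
        roundCost ((X.size + 1) ^ (k + 1) * (X.size + 1) ^ (k + 1)) ∧
      m'.natVar 1 = k ∧ m'.realVar 0 = ε ∧
      pairArr (X := X) (k := k) m' 2 = pairArr m 2 ∧
      ∃ Q : X.Pos k → ℝ, IsReach (regretPolicy (pairArr m 2)) Q ∧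
        IsIterate (regretPolicy (pairArr m 2)) Q (1 / length ε) (length ε) m' := by
  obtain ⟨m1, r1, H1, k1, v1, a1⟩ := runs_setup h hn
  obtain ⟨m2, r2, l2, s2, v2, a2, b2, c2⟩ :=
    runs_chooseLength hε (m := m1) (by rw [v1]; exact h.accuracy)
  have H2 : HoldsInput X k m2 :=
    ⟨by rw [c2 _ (by decide), H1.nodes], by rw [c2 _ (by decide), H1.comps],
      by rw [c2 _ (by decide), H1.positions], by rw [c2 _ (by decide), H1.pairs],
      by rw [c2 _ (by decide), H1.digits], by rw [a2]; exact H1.parent, by rw [a2]; exact H1.kind⟩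
  have e2 : pairArr (X := X) (k := k) m2 2 = pairArr m 2 := by
    unfold pairArr; rw [b2, a1]
  obtain ⟨Q, hQ, hI⟩ := isIterate_prepare H2 (by rw [e2]; exact h.regret)
  rw [e2, s2] at hI
  rw [e2] at hQ
  have r3 := Runs.code (s := prepare) rfl (H2.bound hn)
  obtain ⟨m4, r4, hI4, k4, v4, a4⟩ := runs_iterateLoop (ε := ε) hI (isPolicy_regretPolicy h.regret)
    hQ (by positivity) hn
    (by rw [Stmt.den_natVar _ _ _ rfl, c2 _ (by decide), k1])
    (by rw [Stmt.den_realVar _ _ _ rfl, v2])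
  have l3 : (prepare.den m2).natVar 11 = length ε := by rw [Stmt.den_natVar _ _ _ rfl, l2]
  rw [l3] at r4 hI4
  refine ⟨m4, _, r1.seq (r2.seq (r3.seq r4)), ?_, k4, v4, ?_, Q, hQ, hI4⟩
  · unfold roundCost setupCost
    generalize (X.size + 1) ^ (k + 1) * (X.size + 1) ^ (k + 1) = W
    -- The work done once per round is charged as if it were done in every iteration, which leaves
    -- this slack.
    have : 0 ≤ length ε * (powStmt.cost W + (Stmt.setN 20 (mulE 4 (.nvar 4))).cost W +
        (Stmt.setN 20 (mulE 3 (.nvar 4))).cost W + prepare.cost W + learn.cost W) := Nat.zero_le _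
    nlinarith
  · rw [← e2]
    unfold pairArr
    rw [a4, Stmt.den_realArr _ _ _ rfl]

/-- A utility vector, extended to all nodes. -/
def extend (u : X.Terminal → ℝ) (v : X.Node) : ℝ :=
  if h : X.kind v = .terminal then u ⟨v, h⟩ else 0

theorem extend_terminal (u : X.Terminal → ℝ) (z : X.Terminal) : extend u z.1 = u z := by
  simp [extend, z.2]

theorem nodeArr_revealUtility (u : X.Terminal → ℝ) (m : Memory) :
    nodeArr (X.revealUtility u m) 0 = extend u := by
  funext v
  have hv : ((v : ℕ) < X.size + 1) := v.2
  by_cases h : X.kind v = .terminal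
  · have hv' : (v : ℕ) ≤ X.size := Nat.lt_succ_iff.mp hv
    simp [nodeArr, revealUtility, extend, h, hv']
  · simp [nodeArr, revealUtility, extend, h]

theorem agree_revealUtility (u : X.Terminal → ℝ) {m m' : Memory} (h : Agree 0 m m') :
    Agree 0 (X.revealUtility u m) (X.revealUtility u m') := by
  refine ⟨h.natVar, h.natArr, h.realVar, fun A i => ?_⟩
  simp only [revealUtility, Function.update_apply]
  split_ifs
  · rfl
  · exact h.realArr A i

theorem Displays.congr {m m' : Memory} {π : X.Mixed} (hπ : X.Displays m π) (h : Agree 0 m m') :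
    X.Displays m' π := by
  refine ⟨by rw [h.natVar 2 (by norm_num)]; exact hπ.1, fun l => by rw [h.realArr]; exact hπ.2.1 l,
    fun l z => by rw [h.natArr]; exact hπ.2.2 l z⟩

theorem IsReady.congr {ε : ℝ} {m m' : Memory} (hr : IsReady X k ε m) (h : Agree 0 m m') :
    IsReady X k ε m' where
  nodes := by rw [h.natVar 0 (by norm_num)]; exact hr.nodes
  mediators := by rw [h.natVar 1 (by norm_num)]; exact hr.mediators
  accuracy := by rw [h.realVar 0 (by norm_num)]; exact hr.accuracy
  bound b hb := by
    rw [h.natVar b (by have := Exp.isBound_lt hb; omega)]; exact hr.bound b hb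
  parent v := by rw [h.natArr]; exact hr.parent v
  kind v := by rw [h.natArr]; exact hr.kind v
  regret s t := by rw [pairArr, h.realArr]; exact hr.regret s t

theorem isReady_startMemory (X : TreeProblem) (k : ℕ) (ε : ℝ) :
    IsReady X k ε (X.startMemory k ε) where
  nodes := rfl
  mediators := rfl
  accuracy := by simp [startMemory]
  bound b hb := by
    have h1 : X.size + 1 ≤ (X.size + 1) ^ (k + 1) := Nat.le_self_pow (by omega) _
    have h3 : (X.size + 1) ^ (k + 1) ≤ (X.size + 1) ^ (k + 1) * (X.size + 1) ^ (k + 1) :=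
      Nat.le_mul_of_pos_left _ (by positivity)
    rcases isBound_iff.mp hb with rfl | rfl | rfl | rfl | rfl
    · exact h1.trans h3
    all_goals exact Nat.zero_le _
  parent v := by
    have := v.2
    simp [startMemory]
    omega
  kind v := by
    have := v.2
    simp [startMemory]
    omega
  regret s t := le_rfl

/-- A round of the learner. -/
theorem exists_round {ε : ℝ} (hε : 0 < ε) (hε2 : ε ≤ 2) (hn : 2 ≤ X.size + 1) {m : Memory}
    (h : IsReady X k ε m) {u : X.Terminal → ℝ} (hu : u ∈ X.utilities) :
    ∃ (m' m'' : Memory) (π : X.Mixed) (G V : X.Pos k → ℝ),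
      (X.Displays m' π ∧ ∃ c d : ℕ, Exec nextProgram m m' c ∧
        Exec observeProgram (X.revealUtility u m') m'' d ∧ c + d ≤ (length ε + 1) *
          roundCost ((X.size + 1) ^ (k + 1) * (X.size + 1) ^ (k + 1))) ∧
      IsReady X k ε m'' ∧ IsMass 1 G ∧
      (∀ (z : X.Terminal) (zs : Fin k → X.Terminal), G (Fin.cons z.1 fun i => (zs i).1) =
        ∑ l, π.weight l * ∏ i, (π.strategy l).1 (zs i)) ∧
      IsValue (regretPolicy (pairArr m 2)) (extend u) G V ∧
      V (fun _ => 0) ≤ ∑ z, u z * ∑ l, π.weight l * (π.strategy l).1 z + ε / 2 ∧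
      ∀ s t : X.Pos k, pairArr m'' 2 s t = max 0 (pairArr m 2 s t + V t - V s) := by
  obtain ⟨m1, K, r1, hK, k1, v1, p1, Q, hQ, hI⟩ := runs_nextProgram hε h hn
  obtain ⟨hL0, hL1, hL2⟩ := length_spec hε hε2
  have hL0' : (length ε : ℝ) ≠ 0 := by exact_mod_cast hL0.ne'
  have hP := isPolicy_regretPolicy h.regret
  have hLδ : (length ε : ℝ) * (1 / length ε) = 1 := mul_one_div_cancel hL0'
  obtain ⟨π, hπ, hG, hmean⟩ := hI.exists_mixed hLδ
  obtain ⟨m', c, x1, a1, hc⟩ := r1 m (Agree.refl 0 m)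
  obtain ⟨m2, e2⟩ : ∃ μ, μ = X.revealUtility u m1 := ⟨_, rfl⟩
  have T1 := hI.tables
  have T2 : HoldsTables X k m2 := by
    subst e2
    exact ⟨⟨T1.nodes, T1.comps, T1.positions, T1.pairs, T1.digits, T1.parent, T1.kind⟩, T1.comp,
      T1.obs, T1.final, T1.adj, T1.fst, T1.snd⟩
  have q2 : pairArr (X := X) (k := k) m2 5 = regretPolicy (pairArr m 2) := by
    rw [← hI.policy, e2]
    funext s t
    simp [pairArr, revealUtility]
  have g2 : posArr (X := X) (k := k) m2 8 = posArr m1 8 := by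
    rw [e2]
    funext s
    simp [posArr, revealUtility]
  have p2 : pairArr (X := X) (k := k) m2 2 = pairArr m 2 := by
    rw [← p1, e2]
    funext s t
    simp [pairArr, revealUtility]
  obtain ⟨V, hV, hR⟩ := learn_spec T2 hP q2
  rw [g2, e2, nodeArr_revealUtility] at hV
  rw [p2] at hR
  obtain ⟨m'', d, x2, a2, hd⟩ := Runs.code (s := learn) rfl (T2.bound hn) _
    (e2 ▸ agree_revealUtility u a1 : Agree 0 m2 (X.revealUtility u m'))
  have T3 : HoldsTables X k (learn.den m2) := T2.den rfl rfl rfl rfl rfl rfl rfl rfl rfl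
  have ready : IsReady X k ε (learn.den m2) := by
    refine ⟨T3.nodes, ?_, ?_, T3.bound hn, T3.parent, T3.kind, fun s t => ?_⟩
    · rw [Stmt.den_natVar _ _ _ rfl, e2]; exact k1
    · rw [Stmt.den_realVar _ _ _ rfl, e2]; exact v1
    · rw [hR]; exact le_max_left _ _
  have hroot := hI.value_root_le hQ (by positivity) hu (extend_terminal u) hV
  refine ⟨m', m'', π, posArr m1 8, V, ⟨hπ.congr a1, c, d, x1, x2, by omega⟩, ready.congr a2, ?_, hG,
    hV, ?_, fun s t => ?_⟩
  · have := hI.mass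
    rwa [hLδ] at this
  · simp only [hmean]
    linarith
  · rw [← hR, pairArr, pairArr, a2.realArr]

end TreeProblem

/-! The regret of the learner -/

namespace TreeProblem

open RealRAM Finset

variable {X : TreeProblem} {k : ℕ}

/-- The bound for regret minimization at the positions with approximate fixed points. -/
theorem regretAtMost_of_rounds (hX : X.IsStandard) {ε : ℝ} (hε : 0 < ε)
    {u : ℕ → X.Terminal → ℝ} (hu : ∀ t, u t ∈ X.utilities) {π : ℕ → X.Mixed}
    {G V : ℕ → X.Pos k → ℝ} {R : ℕ → X.Pos k → X.Pos k → ℝ} (hR0 : ∀ s t, R 0 s t = 0)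
    (hR : ∀ τ s t, R (τ + 1) s t = max 0 (R τ s t + V τ t - V τ s)) (hG : ∀ τ, IsMass 1 (G τ))
    (hGπ : ∀ τ (z : X.Terminal) (zs : Fin k → X.Terminal), G τ (Fin.cons z.1 fun i => (zs i).1) =
      ∑ l, (π τ).weight l * ∏ i, ((π τ).strategy l).1 (zs i))
    (hV : ∀ τ, IsValue (regretPolicy (R τ)) (extend (u τ)) (G τ) (V τ))
    (hroot : ∀ τ, V τ (fun _ => 0) ≤
      ∑ z, u τ z * ∑ l, (π τ).weight l * ((π τ).strategy l).1 z + ε / 2)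
    {T : ℕ} (hT0 : 0 < T)
    (hT : 16 * ((X.size + 1 : ℝ) ^ (k + 1)) ^ 3 / ε ^ 2 ≤ T) :
    X.RegretAtMost (X.mediatorDeviations k) u π T ε := by
  classical
  have hnn : ∀ τ s t, 0 ≤ R τ s t := by
    intro τ s t
    cases τ with
    | zero => exact (hR0 s t).ge
    | succ τ => rw [hR]; exact le_max_left _ _
  have hP := fun τ => isPolicy_regretPolicy (hnn τ)
  obtain ⟨M, hM⟩ : ∃ M : ℝ, M = (X.size + 1 : ℝ) ^ (k + 1) := ⟨_, rfl⟩
  have hcard : (Fintype.card (X.Pos k) : ℝ) = M := by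
    rw [hM]
    simp [Fintype.card_pi]
  have hM0 : 0 < M := by rw [hM]; positivity
  have hTpos : (0 : ℝ) < T := by exact_mod_cast hT0
  rw [← hM, div_le_iff₀ (by positivity)] at hT
  -- This is the origin of 16 M³/ε²: squaring gives 4 M³ T ≤ T² ε²/4. The other half of Tε pays for
  -- the fixed-point errors.
  have hsqrt : M * Real.sqrt (4 * M * T) ≤ T * (ε / 2) := by
    have : Real.sqrt (4 * M * T) ≤ T * (ε / 2) / M := by
      refine (Real.sqrt_le_left (by positivity)).mpr ?_
      rw [div_pow, le_div_iff₀ (by positivity)]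
      nlinarith
    rw [le_div_iff₀ hM0] at this
    linarith
  have hpure : ∀ q ∈ Interleaving.reducedStrategies (X.mediated k),
      ∑ τ ∈ range T, (π τ).gain (u τ) (X.deviation k q) ≤ T * ε := by
    rintro q ⟨σ, hσ, rfl⟩
    have h1 := sum_projection_le hX hσ hP hV (T := T) (B := Real.sqrt (4 * M * T))
      (fun s t hs hf hst => by
        have := sum_sub_le_of_regretPolicy hs hf (hR0 s) (fun τ t _ => hR τ s t) hnn (V := V)
          (fun τ => by
            have := hV τ s
            rwa [if_neg hf, zero_add] at this)
          (fun τ t ht => (hV τ).abs_sub_le (hG τ) le_rfl (hP τ) (hu τ) (extend_terminal (u τ)) hs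
            ht) T hst
        rwa [hcard] at this) (Real.sqrt_nonneg _)
    rw [hcard] at h1
    have h2 : ∑ τ ∈ range T, V τ (fun _ => 0) ≤
        ∑ τ ∈ range T, ∑ z, u τ z * ∑ l, (π τ).weight l * ((π τ).strategy l).1 z + T * (ε / 2) := by
      refine (sum_le_sum fun τ _ => hroot τ).trans_eq ?_
      rw [sum_add_distrib, sum_const, card_range, nsmul_eq_mul]
    simp only [Mixed.gain_deviation _ (extend_terminal (u _)) (hGπ _)]
    rw [sum_sub_distrib, sum_comm]
    simp only [← mul_sum]
    linarith
  rintro φ ⟨q, hq, rfl⟩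
  -- The total gain is affine in q, so a bound for pure reduced strategies passes to their convex
  -- hull.
  have hconv : Convex ℝ {q : (∀ o, (X.mediated k o).Terminal) → ℝ |
      ∑ τ ∈ range T, (π τ).gain (u τ) (X.deviation k q) ≤ T * ε} := by
    simp only [Mixed.gain_deviation _ (extend_terminal (u _)) (hGπ _), sum_sub_distrib,
      sub_le_iff_le_add]
    refine convex_halfSpace_le (f := fun q : (∀ o, (X.mediated k o).Terminal) → ℝ =>
      ∑ τ ∈ range T, ∑ z : ∀ o, (X.mediated k o).Terminal, q z *
        (extend (u τ) (toPos (fun o => (z o).1) 0) * G τ (toPos fun o => (z o).1))) ?_ _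
    constructor
    · intro p q
      simp only [Pi.add_apply, add_mul, sum_add_distrib]
    · intro c q
      simp only [Pi.smul_apply, smul_eq_mul, mul_assoc, ← mul_sum]
  have := convexHull_min hpure hconv hq
  rw [one_div, inv_mul_le_iff₀ hTpos]
  exact this

theorem two_le_size (h : 2 ≤ X.dim) : 2 ≤ X.size + 1 :=
  h.trans ((Fintype.card_subtype_le _).trans_eq (by simp))

/-- The learner plays mixed strategies of small regret. -/
theorem exists_plays (hX : X.IsStandard) (hdim : 2 ≤ X.dim) {ε : ℝ} (hε : 0 < ε) (hε2 : ε ≤ 2)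
    {u : ℕ → X.Terminal → ℝ} (hu : ∀ t, u t ∈ X.utilities) :
    ∃ π : ℕ → X.Mixed, X.Plays k ε nextProgram observeProgram u π
        ((length ε + 1 : ℕ) *
          (roundCost ((X.size + 1) ^ (k + 1) * (X.size + 1) ^ (k + 1)) : ℕ)) ∧
      ∀ T : ℕ, 0 < T → 16 * ((X.size + 1 : ℝ) ^ (k + 1)) ^ 3 / ε ^ 2 ≤ T →
        X.RegretAtMost (X.mediatorDeviations k) u π T ε := by
  have hn := two_le_size hdim
  choose next after π G V hplay hready hmass hGπ hV hroot hR using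
    fun (m : {m // IsReady X k ε m}) (t : ℕ) => exists_round hε hε2 hn m.2 (hu t)
  -- The run is assembled round by round; the invariant `IsReady` is carried along, so that every
  -- round can be continued.
  let m : ℕ → {m // IsReady X k ε m} := fun t =>
    Nat.rec ⟨X.startMemory k ε, isReady_startMemory X k ε⟩
      (fun t m => ⟨after m t, hready m t⟩) t
  refine ⟨fun t => π (m t) t, ⟨fun t => (m t).1, fun t => next (m t) t, rfl, fun t => ?_⟩, ?_⟩
  · obtain ⟨h1, c, d, h2, h3, h4⟩ := hplay (m t) t
    exact ⟨h1, c, d, h2, h3, by exact_mod_cast h4⟩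
  · intro T hT0 hT
    refine regretAtMost_of_rounds hX hε hu (G := fun t => G (m t) t) (V := fun t => V (m t) t)
      (R := fun t => pairArr (m t).1 2) (fun s t => rfl) (fun τ s t => hR (m τ) τ s t)
      (fun τ => hmass (m τ) τ) (fun τ => hGπ (m τ) τ) (fun τ => hV (m τ) τ)
      (fun τ => hroot (m τ) τ) hT0 hT

/-! ### The exponents -/

/-- Since N ≥ 2, the bound n ≤ 4N gives n ≤ N³, and k + 1 ≤ 2K. -/
theorem pow_positions_le (hX : X.IsStandard) (hdim : 2 ≤ X.dim) :
    (X.size + 1) ^ (k + 1) ≤ X.dim ^ (6 * max k 1) := by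
  have h1 : X.size + 1 ≤ X.dim ^ 3 := by
    refine hX.size_le.trans ?_
    have := Nat.mul_le_mul hdim hdim
    calc 4 * X.dim ≤ X.dim * X.dim * X.dim := Nat.mul_le_mul_right _ this
      _ = X.dim ^ 3 := by ring
  calc (X.size + 1) ^ (k + 1) ≤ (X.dim ^ 3) ^ (k + 1) := Nat.pow_le_pow_left h1 _
    _ = X.dim ^ (3 * (k + 1)) := by rw [← pow_mul]
    _ ≤ X.dim ^ (6 * max k 1) := Nat.pow_le_pow_right (by omega) (by omega)

end TreeProblem

theorem mainTheorem2 :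
    ∃ (C : ℕ) (next observe : RealRAM.Program),
      ∀ (X : TreeProblem) (k : ℕ) (ε : ℝ), X.IsStandard → 2 ≤ X.dim → 0 < ε → ε ≤ 2 →
        ∀ u : ℕ → X.Terminal → ℝ, (∀ t, u t ∈ X.utilities) →
          ∃ π : ℕ → X.Mixed,
            X.Plays k ε next observe u π ((X.dim : ℝ) ^ (C * max k 1) / ε) ∧
            ∀ T : ℕ, (X.dim : ℝ) ^ (C * max k 1) / ε ^ 2 ≤ (T : ℝ) →
              X.RegretAtMost (X.mediatorDeviations k) u π T ε := by
  obtain ⟨A, hA⟩ := RealRAM.polyBounded_roundCost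
  -- The horizon needs 16 M³ ≤ N^((4 + 18)K). The steps need 8 · A (M² + 1)^A ≤ N^((3 + A + 13A)K),
  -- where constants are turned into powers of N by 2 ≤ N. The exponent 22 + 14A covers both.
  refine ⟨22 + 14 * A, RealRAM.nextProgram, RealRAM.observeProgram, fun X k ε hX hdim hε hε2 u hu => ?_⟩
  obtain ⟨π, ⟨m, m', h0, hm⟩, hreg⟩ := TreeProblem.exists_plays (k := k) hX hdim hε hε2 hu
  have hpos := TreeProblem.pow_positions_le (k := k) hX hdim
  obtain ⟨M, hM⟩ : ∃ M, M = (X.size + 1) ^ (k + 1) := ⟨_, rfl⟩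
  obtain ⟨K, hK⟩ : ∃ K, K = max k 1 := ⟨_, rfl⟩
  have hK1 : 1 ≤ K := by omega
  have hd0 : 0 < X.dim := by omega
  have hd1 : (1 : ℝ) ≤ X.dim := by exact_mod_cast hd0
  rw [← hM] at hm hpos
  rw [← hK] at hpos ⊢
  have hpow : ∀ a, 2 ^ a ≤ X.dim ^ (a * K) := fun a =>
    (Nat.pow_le_pow_left hdim a).trans
      (Nat.pow_le_pow_right hd0 (Nat.le_mul_of_pos_right _ hK1))
  refine ⟨π, ⟨m, m', h0, fun t => ?_⟩, fun T hT => hreg T ?_ ?_⟩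
  · obtain ⟨h1, c, d, h2, h3, h4⟩ := hm t
    refine ⟨h1, c, d, h2, h3, h4.trans ?_⟩
    have hcost : 8 * RealRAM.roundCost (M * M) ≤ X.dim ^ ((22 + 14 * A) * K) := by
      have hW : M * M + 1 ≤ X.dim ^ (13 * K) := by
        have h5 : M * M ≤ X.dim ^ (6 * K) * X.dim ^ (6 * K) := Nat.mul_le_mul hpos hpos
        have h6 := hpow 1
        have h7 : 1 ≤ X.dim ^ (6 * K) * X.dim ^ (6 * K) := Nat.succ_le_of_lt (by positivity)
        calc M * M + 1 ≤ 2 ^ 1 * (X.dim ^ (6 * K) * X.dim ^ (6 * K)) := by omega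
          _ ≤ X.dim ^ (1 * K) * (X.dim ^ (6 * K) * X.dim ^ (6 * K)) :=
            Nat.mul_le_mul_right _ h6
          _ = X.dim ^ (13 * K) := by rw [← pow_add, ← pow_add]; congr 1; ring
      calc 8 * RealRAM.roundCost (M * M) ≤ 2 ^ 3 * (2 ^ A * (X.dim ^ (13 * K)) ^ A) := by
            refine Nat.mul_le_mul (by norm_num) ((hA _).trans ?_)
            exact Nat.mul_le_mul Nat.lt_two_pow_self.le (Nat.pow_le_pow_left hW A)
        _ ≤ X.dim ^ (3 * K) * (X.dim ^ (A * K) * (X.dim ^ (13 * K)) ^ A) :=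
            Nat.mul_le_mul (hpow 3) (Nat.mul_le_mul_right _ (hpow A))
        _ = X.dim ^ ((3 + 14 * A) * K) := by
            rw [← pow_mul, ← pow_add, ← pow_add]; congr 1; ring
        _ ≤ X.dim ^ ((22 + 14 * A) * K) :=
            Nat.pow_le_pow_right hd0 (Nat.mul_le_mul_right _ (by omega))
    have hcost' : 8 * (RealRAM.roundCost (M * M) : ℝ) ≤ (X.dim : ℝ) ^ ((22 + 14 * A) * K) := by
      exact_mod_cast hcost
    obtain ⟨-, hL, -⟩ := TreeProblem.length_spec hε hε2
    -- The 8 in the step bound comes from L ≤ 6/ε and 1 ≤ 2/ε.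
    have hL' : ((TreeProblem.length ε + 1 : ℕ) : ℝ) ≤ 8 / ε := by
      have : (1 : ℝ) ≤ 2 / ε := by rw [le_div_iff₀ hε]; linarith
      push_cast
      calc (TreeProblem.length ε : ℝ) + 1 ≤ 6 / ε + 2 / ε := add_le_add hL this
        _ = 8 / ε := by ring
    calc ((TreeProblem.length ε + 1 : ℕ) : ℝ) * (RealRAM.roundCost (M * M) : ℕ)
        ≤ 8 / ε * (RealRAM.roundCost (M * M) : ℕ) := by gcongr
      _ = 8 * (RealRAM.roundCost (M * M) : ℝ) / ε := by ring
      _ ≤ _ := by gcongr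
  · have : (0 : ℝ) < T := lt_of_lt_of_le (by positivity) hT
    exact_mod_cast this
  · refine le_trans ?_ hT
    have h16 : 16 * M ^ 3 ≤ X.dim ^ ((22 + 14 * A) * K) :=
      calc 16 * M ^ 3 ≤ 2 ^ 4 * (X.dim ^ (6 * K)) ^ 3 :=
            Nat.mul_le_mul (by norm_num) (Nat.pow_le_pow_left hpos 3)
        _ ≤ X.dim ^ (4 * K) * (X.dim ^ (6 * K)) ^ 3 := Nat.mul_le_mul_right _ (hpow 4)
        _ = X.dim ^ (22 * K) := by rw [← pow_mul, ← pow_add]; congr 1; ring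
        _ ≤ _ := Nat.pow_le_pow_right hd0 (Nat.mul_le_mul_right _ (by omega))
    have h16' : 16 * ((X.size + 1 : ℝ) ^ (k + 1)) ^ 3 ≤ (X.dim : ℝ) ^ ((22 + 14 * A) * K) := by
      rw [hM] at h16
      exact_mod_cast h16
    gcongr
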